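/- Fix $\lambda\in\mathbb R$. Let $\eta=\eta_\lambda$ be the unique positive root of $t^4+2\lambda t^3-1$ and put $p(\lambda)=-\sqrt{(1+\eta^4)/(3+\eta^4)}$. For $\xi>0$ let $Q(t)=t^4+4\lambda t^3+4(\lambda^2-\xi^2)t^2+1$. A \emph{B-curve with parameters} $(\lambda,e_1)$ is a $\mathcal C^4$ arc-length parameterized curve $\gamma:\mathbb R\to\mathbb S^2$ with positive, non-constant, periodic geodesic curvature $\kappa=\ddot\gamma\cdot(\gamma\times\dot\gamma)$, such that $\mu=\sqrt\kappa$ satisfies $\dot\mu^2=-\mu^2Q(\mu)$ for some $\xi>0$ and $e_1$ is the largest real root of $Q$; then $\xi=\frac1{2e_1}\sqrt{1+(e_1(e_1+2\lambda))^2}$. The number $\lambda$ is its multiplier; a \emph{B-string} is a closed (periodic) B-curve. Let $\omega$ be the least period of $\kappa$ and $F=(\gamma,\dot\gamma,\gamma\times\dot\gamma)$ the Frenet frame (these three vectors are the columns of $F$); the \emph{monodromy} of $\gamma$ is $F(\omega)F(0)^{-1}\in SO(3)$. The B-curve is \emph{standard} if $$\mu(\tfrac\omega2)=e_1,\qquad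 \gamma(\tfrac\omega2)=\frac{(1,\,-e_1(e_1+2\lambda),\,0)}{\sqrt{1+(e_1(e_1+2\lambda))^2}},\qquad \dot\gamma(\tfrac\omega2)=(0,0,-1).$$ Let $R(a)=\begin{pmatrix}1&0&0\\0&\cos a&-\sin a\\0&\sin a&\cos a\end{pmatrix}$. Theorem. (1) For every $e_1>\eta$ there is exactly one standard B-curve $\gamma_{\lambda,e_1}$ with parameters $(\lambda,e_1)$. Let $\mu$ and $\omega$ be its $\sqrt\kappa$ and least period of $\kappa$, and let $$\theta_{\lambda,e_1}(s)=2\xi\int_{\omega/2}^{s}\frac{\mu^2(\mu+2\lambda)}{1-4\xi^2\mu^2}\,dt,\qquad \Psi_\lambda(e_1)=\theta_{\lambda,e_1}(\omega)-\theta_{\lambda,e_1}(0).$$ Let $\widehat\Psi_\lambda(e_1)\in\mathbb R/2\pi\mathbb Z$ be the class of $\Psi_\lambda(e_1)$ if $4\lambda\xi+1\neq0$, and of $\Psi_\lambda(e_1)+\pi$ if $4\lambda\xi+1=0$. (2) There is a countable set $\Delta_\lambda\subset(\eta,\infty)$, not bounded above, such that every B-curve with parameters $(\lambda,e_1)$ is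 closed if and only if $e_1\in\Delta_\lambda$. (3) For every rational $q$ with $1+p(\lambda)<q<\frac12$ there is $e_1\in\Delta_\lambda$ such that $\widehat\Psi_\lambda(e_1)=2\pi q$ modulo $2\pi$ and the standard B-string $\gamma_{\lambda,e_1}$ has monodromy $R(-2\pi q)$; moreover there is a B-string with the same parameters $(\lambda,e_1)$ (not in standard form), in particular with multiplier $\lambda$, whose monodromy is $R(2\pi q)$, the rotation by $2\pi q$ about the $Ox$-axis. (4) $\Psi_\lambda(e_1)\to2\pi p(\lambda)$ as $e_1\to\eta^+$. As $e_1\to\infty$, $\Psi_\lambda(e_1)\to-\pi$ if $\lambda\ge0$ and $\Psi_\lambda(e_1)\to\pi$ if $\lambda<0$. -/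

import Mathlib

open Filter Topology Matrix

namespace BCurve

noncomputable section

/-! Curves `γ : ℝ → (Fin 3 → ℝ)` take values in `ℝ³` with coordinates `(x, y, z)`; lengths and angles are
always measured with the Euclidean dot product `⬝ᵥ` (the norm of `Fin 3 → ℝ` is used only through its
topology, in derivatives). -/

/-- The geodesic curvature `κ` of an arc-length parameterized curve `γ` on the unit sphere, determined
by `∇_T T = κ N`, where `T = γ'` and `N = γ × T`; that is `κ = γ'' · (γ × γ')`. -/
def curvature (γ : ℝ → Fin 3 → ℝ) (s : ℝ) : ℝ :=
  deriv (deriv γ) s ⬝ᵥ (γ s ⨯₃ deriv γ s)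

/-- The `μ`-invariant `μ = √κ`. -/
def muInv (γ : ℝ → Fin 3 → ℝ) (s : ℝ) : ℝ := Real.sqrt (curvature γ s)

/-- The spherical Frenet frame `(γ, γ', γ × γ')`, as a matrix with these columns. -/
def frame (γ : ℝ → Fin 3 → ℝ) (s : ℝ) : Matrix (Fin 3) (Fin 3) ℝ :=
  (Matrix.of ![γ s, deriv γ s, γ s ⨯₃ deriv γ s])ᵀ

/-- `w` is the least (positive) period of `f`. -/
def IsLeastPeriod {α : Type*} (f : ℝ → α) (w : ℝ) : Prop :=
  IsLeast {T : ℝ | 0 < T ∧ Function.Periodic f T} w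

/-- The quartic polynomial `Q(t) = t⁴ + 4λt³ + 4(λ² - ξ²)t² + 1`. -/
def quartic (lam ξ t : ℝ) : ℝ := t ^ 4 + 4 * lam * t ^ 3 + 4 * (lam ^ 2 - ξ ^ 2) * t ^ 2 + 1

/-- `γ` is an arc-length parameterized curve of class `C⁴` on the unit sphere, with positive,
non-constant, periodic curvature, whose `μ`-invariant satisfies `μ'² = -μ² Q(μ)`, where `Q` has
multiplier `lam` and constant of integration `ξ`. -/
structure IsBCurveWithConst (lam ξ : ℝ) (γ : ℝ → Fin 3 → ℝ) : Prop where
  contDiff : ContDiff ℝ 4 γ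
  sphere : ∀ s, γ s ⬝ᵥ γ s = 1
  unitSpeed : ∀ s, deriv γ s ⬝ᵥ deriv γ s = 1
  convex : ∀ s, 0 < curvature γ s
  nonconst : ∃ s t, curvature γ s ≠ curvature γ t
  periodic : ∃ T, 0 < T ∧ Function.Periodic (curvature γ) T
  ode : ∀ s, deriv (muInv γ) s ^ 2 = -(muInv γ s ^ 2 * quartic lam ξ (muInv γ s))

/-- `γ` is a B-curve with parameters `lam` (the multiplier) and `e₁` (the largest root of `Q`).
A B-curve with multiplier `lam` is one for some `e₁`; a B-string is a closed B-curve. -/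
def IsBCurveWithParams (lam e₁ : ℝ) (γ : ℝ → Fin 3 → ℝ) : Prop :=
  ∃ ξ, 0 < ξ ∧ IsBCurveWithConst lam ξ γ ∧ IsGreatest {t : ℝ | quartic lam ξ t = 0} e₁

/-- The curve is closed (that is, periodic). -/
def IsClosedCurve (γ : ℝ → Fin 3 → ℝ) : Prop := ∃ T, 0 < T ∧ Function.Periodic γ T

/-- `γ` is the standard B-curve with parameters `lam` and `e₁`, and `w` is the least period of its
curvature: at `w / 2` the `μ`-invariant is equal to `e₁`, and `γ`, `γ'` have the prescribed values. -/
structure IsStandardBCurve (lam e₁ : ℝ) (γ : ℝ → Fin 3 → ℝ) (w : ℝ) : Prop where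
  params : IsBCurveWithParams lam e₁ γ
  leastPeriod : IsLeastPeriod (curvature γ) w
  mu_half : muInv γ (w / 2) = e₁
  pos_half : γ (w / 2) =
    ![1 / Real.sqrt (1 + (e₁ * (e₁ + 2 * lam)) ^ 2),
      -(e₁ * (e₁ + 2 * lam)) / Real.sqrt (1 + (e₁ * (e₁ + 2 * lam)) ^ 2), 0]
  vel_half : deriv γ (w / 2) = ![0, 0, -1]

/-- The monodromy `F(ω) F(0)⁻¹` of `γ` is `M`, where `F` is the Frenet frame and `ω` is the least
period of the curvature. -/
def HasMonodromy (γ : ℝ → Fin 3 → ℝ) (M : Matrix (Fin 3) (Fin 3) ℝ) : Prop :=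
  ∃ w, IsLeastPeriod (curvature γ) w ∧ frame γ w * (frame γ 0)⁻¹ = M

/-- The rotation by the angle `a` about the `Ox`-axis. -/
def rotX (a : ℝ) : Matrix (Fin 3) (Fin 3) ℝ :=
  !![1, 0, 0; 0, Real.cos a, -Real.sin a; 0, Real.sin a, Real.cos a]

theorem exists_eta (lam : ℝ) : ∃! t : ℝ, 0 < t ∧ t ^ 4 + 2 * lam * t ^ 3 - 1 = 0 := by
  have hc : ContinuousOn (fun t : ℝ => t ^ 4 + 2 * lam * t ^ 3 - 1)
      (Set.Icc 0 (1 + 2 * |lam|)) := by fun_prop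
  have hl : 0 ≤ |lam| := abs_nonneg lam
  have h0 : (0 : ℝ) ∈ Set.Icc ((fun t : ℝ => t ^ 4 + 2 * lam * t ^ 3 - 1) 0)
      ((fun t : ℝ => t ^ 4 + 2 * lam * t ^ 3 - 1) (1 + 2 * |lam|)) := by
    constructor
    · norm_num
    · have h1 : 1 ≤ (1 + 2 * |lam|) ^ 3 := one_le_pow₀ (by linarith)
      have h2 : 1 ≤ 1 + 2 * |lam| + 2 * lam := by linarith [neg_abs_le lam]
      have h3 := mul_le_mul h1 h2 zero_le_one (by linarith)
      simp only
      nlinarith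
  obtain ⟨t, ht, hft⟩ := intermediate_value_Icc (by linarith) hc h0
  simp only at hft
  have htp : 0 < t := by
    rcases ht.1.lt_or_eq with h | h
    · exact h
    · rw [← h] at hft; norm_num at hft
  refine ⟨t, ⟨htp, hft⟩, ?_⟩
  have key : ∀ a b : ℝ, 0 < a → a < b → a ^ 4 + 2 * lam * a ^ 3 - 1 = 0 →
      b ^ 4 + 2 * lam * b ^ 3 - 1 = 0 → False := by
    intro a b ha hab h1 h2
    have hb : 0 < b := ha.trans hab
    have hcube : a ^ 3 < b ^ 3 := pow_lt_pow_left₀ hab ha.le (by norm_num)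
    have e : a ^ 3 * b ^ 3 * (b - a) = a ^ 3 - b ^ 3 := by linear_combination a ^ 3 * h2 - b ^ 3 * h1
    have : 0 < a ^ 3 * b ^ 3 * (b - a) := mul_pos (by positivity) (by linarith)
    linarith
  rintro y ⟨hy, hfy⟩
  rcases lt_trichotomy y t with h | h | h
  · exact (key y t hy h hfy hft).elim
  · exact h
  · exact (key t y htp h hft hfy).elim

/-- `η_λ`, the unique positive solution of `t⁴ + 2λt³ - 1 = 0`. -/
def eta (lam : ℝ) : ℝ := (exists_eta lam).choose

theorem eta_spec (lam : ℝ) : 0 < eta lam ∧ eta lam ^ 4 + 2 * lam * eta lam ^ 3 - 1 = 0 :=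
  (exists_eta lam).choose_spec.1

/-- `p(λ) = -√((1 + η_λ⁴) / (3 + η_λ⁴))`. -/
def p (lam : ℝ) : ℝ := -Real.sqrt ((1 + eta lam ^ 4) / (3 + eta lam ^ 4))

/-- The constant of integration `ξ` in terms of the parameters:
`ξ = √(1 + (e₁(e₁ + 2λ))²) / (2e₁)`, equivalently `Q(e₁) = 0`. -/
def xi (lam e₁ : ℝ) : ℝ := 1 / (2 * e₁) * Real.sqrt (1 + (e₁ * (e₁ + 2 * lam)) ^ 2)

/-- The angular function `θ` of a standard B-curve `γ` with parameters `lam`, `e₁`, where `w` is the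
least period of its curvature. -/
def angular (lam e₁ : ℝ) (γ : ℝ → Fin 3 → ℝ) (w s : ℝ) : ℝ :=
  2 * xi lam e₁ * ∫ t in (w / 2)..s,
    muInv γ t ^ 2 * (muInv γ t + 2 * lam) / (1 - 4 * xi lam e₁ ^ 2 * muInv γ t ^ 2)

/-- The jump `Ψ = θ(ω) - θ(0)`. -/
def jump (lam e₁ : ℝ) (γ : ℝ → Fin 3 → ℝ) (w : ℝ) : ℝ :=
  angular lam e₁ γ w w - angular lam e₁ γ w 0

open Classical in
/-- The regularized jump as an angle, i.e. modulo `2π`: it is `Ψ`, except at exceptional parameters,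
where it is `Ψ + π`. The parameters are exceptional when `4λξ + 1 = 0` (in particular `λ < 0`); then
the smaller positive root of `Q` is `-2λ = 1/(2ξ)` and the curve passes through the pole `(1,0,0)`. -/
def regularizedJump (lam e₁ : ℝ) (γ : ℝ → Fin 3 → ℝ) (w : ℝ) : Real.Angle :=
  if 4 * lam * xi lam e₁ + 1 = 0 then ((jump lam e₁ γ w + Real.pi : ℝ) : Real.Angle)
  else (jump lam e₁ γ w : Real.Angle)

end

end BCurve

namespace BCurve

noncomputable section

open scoped ContDiff

/-! ### The function `η` -/

/-! Put `u = 1/μ`, `r = u'`, `v = μ + 2λ`. The equation for `μ` becomes `u² + r² + v² = 4ξ²`, and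
`r' = -u + κv`, `v' = -κr` say that `(u, r, v)` are the coordinates, in the Frenet frame, of a fixed
vector of length `2ξ`. Placing that vector on the `Ox`-axis gives the first coordinates of `γ`, `γ'`
and `γ × γ'`; only a rotation about `Ox` is left to find.

The angle `θ` solves this away from the poles, but its integrand can degenerate there. Write instead
`y + iz = -(v - ir)e^{iα}/(2ξ)`. Then `α' = κ + v/(2ξ + u)`, whose denominator is always positive.
The resulting `curve` satisfies the Frenet equations (`RootPair.isFrenet_curve`), and one period of
`κ` multiplies its frame by the rotation through the increment `rotPeriod` of `α`. Hence it is
closed exactly when this increment is a rational multiple of `2π`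
(`RootPair.isClosedCurve_curve_iff`). Every B-curve is a moved and shifted copy:
`hasDerivAt_deriv_recip` upgrades the first-order equation to a regular second-order one, so `μ` is
unique up to a shift, and a curve is determined by its curvature and initial frame.

For the dependence on `e₁`, write the positive roots of `Q` as `x e^{±τ}`; then `x = η(λ / cosh τ)`
is analytic in `τ`, and `τ > 0` corresponds to `e₁ > η`. The substitution `μ = (a+b)/2 + (a-b)/2 cos
φ` turns the increment into an integral over the fixed interval `[0, π]`, analytic even across the
double root `τ = 0` (`contDiff_rotIntegral`). It equals `-2πp(λ)` at `τ = 0` (`rotIntegral_zero`)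
and tends to `π` at infinity (`tendsto_rotIntegral`). Since `-p > 1/2` it is not constant, so its
level sets are countable. It takes rational multiples of `2π` for arbitrarily large `τ`, and it
takes every value between `π` and `-2πp`.

Finally, `θ' + α'` is the derivative of the polar angle of `v + ir`. Over half a period this angle
goes from `0` to `0`, `π/2` or `π` according to the sign of `b + 2λ`. Hence `Ψ` is minus the
increment of `α`, up to `0`, `π` or `2π` (`jump_stdCurve`); the regularization removes the case `π`,
and the sign of `b + 2λ` decides the limits. -/

theorem eq_eta {l t : ℝ} (ht : 0 < t) (h : t ^ 4 + 2 * l * t ^ 3 - 1 = 0) : t = eta l :=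
  (exists_eta l).unique ⟨ht, h⟩ (eta_spec l)

theorem eta_pos (l : ℝ) : 0 < eta l := (eta_spec l).1

theorem eta_eq (l : ℝ) : eta l ^ 4 + 2 * l * eta l ^ 3 = 1 := by linarith [(eta_spec l).2]

theorem eta_zero : eta 0 = 1 := (eq_eta one_pos (by norm_num)).symm

/-- On the positive axis `η` inverts `t ↦ (1 - t⁴)/(2t³)`, whose derivative is negative there, so
the inverse function theorem applies. The local inverse is `η` because the positive root is unique.
Analytic smoothness is included, and is used later. -/
theorem contDiffAt_eta {n : WithTop ℕ∞} (hn : n ≠ 0) (l : ℝ) : ContDiffAt ℝ n eta l := by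
  have hp := eta_pos l
  have he := eta_eq l
  set f : ℝ → ℝ := fun t => (1 - t ^ 4) / (2 * t ^ 3) with hf
  have hfl : f (eta l) = l := by
    simp only [hf]; field_simp; linarith
  have hfc : ContDiffAt ℝ n f (eta l) := by
    apply ContDiffAt.div
    · fun_prop
    · fun_prop
    · positivity
  set d : ℝ := (-(4 * eta l ^ 3) * (2 * eta l ^ 3) - (1 - eta l ^ 4) * (6 * eta l ^ 2)) /
    (2 * eta l ^ 3) ^ 2 with hd
  have hfd : HasDerivAt f d (eta l) := by
    have h1 : HasDerivAt (fun t : ℝ => 1 - t ^ 4) (-(4 * eta l ^ 3)) (eta l) := by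
      simpa using (hasDerivAt_pow 4 (eta l)).const_sub 1
    have h2 : HasDerivAt (fun t : ℝ => 2 * t ^ 3) (6 * eta l ^ 2) (eta l) := by
      exact ((hasDerivAt_pow 3 (eta l)).const_mul 2).congr_deriv (by norm_num; ring)
    exact h1.fun_div h2 (by positivity)
  have hd0 : d ≠ 0 := by
    have : d < 0 := by
      apply div_neg_of_neg_of_pos _ (by positivity)
      have : 0 < eta l ^ 2 := by positivity
      have : 0 < eta l ^ 6 := by positivity
      nlinarith
    exact this.ne
  have hfe : HasFDerivAt f
      ((ContinuousLinearEquiv.unitsEquivAut ℝ (Units.mk0 d hd0) : ℝ ≃L[ℝ] ℝ) : ℝ →L[ℝ] ℝ)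
      (eta l) := by
    have hde : ((ContinuousLinearEquiv.unitsEquivAut ℝ (Units.mk0 d hd0) : ℝ ≃L[ℝ] ℝ) :
        ℝ →L[ℝ] ℝ) = ContinuousLinearMap.toSpanSingleton ℝ d := by
      ext
      simp
    rw [hde]
    exact hfd.hasFDerivAt
  have hg := hfc.to_localInverse hfe hn
  rw [hfl] at hg
  refine hg.congr_of_eventuallyEq ?_
  have hcont := hg.continuousAt
  have hga : hfc.localInverse hfe hn l = eta l := by
    have := hfc.localInverse_apply_image hfe hn
    rwa [hfl] at this
  have hpos : ∀ᶠ y in 𝓝 l, 0 < hfc.localInverse hfe hn y :=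
    hcont.eventually_const_lt (by rw [hga]; exact hp)
  have hinv : ∀ᶠ y in 𝓝 l, f (hfc.localInverse hfe hn y) = y := by
    have := (hfc.hasStrictFDerivAt' hfe hn).eventually_right_inverse
    rwa [hfl] at this
  filter_upwards [hpos, hinv] with y h1 h2
  refine (eq_eta h1 ?_).symm
  simp only [hf] at h2
  rw [div_eq_iff (by positivity)] at h2
  linarith

theorem contDiff_eta {n : WithTop ℕ∞} (hn : n ≠ 0) : ContDiff ℝ n eta :=
  contDiff_iff_contDiffAt.2 (contDiffAt_eta hn)

theorem continuous_eta : Continuous eta := (contDiff_eta one_ne_zero).continuous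

/-! ### Pairs of positive roots of the quartic -/

/-- `a > b` are the positive roots of the quartic with parameters `lam` and `ξ`. -/
structure RootPair (lam a b ξ : ℝ) : Prop where
  b_pos : 0 < b
  lt : b < a
  xi_pos : 0 < ξ
  eq_a : 4 * ξ ^ 2 * a ^ 2 = 1 + a ^ 2 * (a + 2 * lam) ^ 2
  eq_b : 4 * ξ ^ 2 * b ^ 2 = 1 + b ^ 2 * (b + 2 * lam) ^ 2

/-- The positive quadratic factor of the quartic with roots `a` and `b`. -/
def cofactor (a b t : ℝ) : ℝ := t ^ 2 + (a + b) / (a * b) ^ 2 * t + 1 / (a * b)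

theorem cofactor_pos {a b t : ℝ} (ha : 0 < a) (hb : 0 < b) (ht : 0 ≤ t) : 0 < cofactor a b t := by
  unfold cofactor; positivity

namespace RootPair

variable {lam a b ξ : ℝ}

theorem a_pos (h : RootPair lam a b ξ) : 0 < a := h.b_pos.trans h.lt

/-- Eliminate `ξ` between the two root equations and cancel `a - b`. Besides the root equations this
is the only constraint on the pair. -/
theorem rel (h : RootPair lam a b ξ) : a + b = (4 * lam + (a + b)) * (a * b) ^ 2 := by
  have hd : a - b ≠ 0 := sub_ne_zero.2 h.lt.ne'
  apply mul_left_cancel₀ hd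
  linear_combination b ^ 2 * h.eq_a - a ^ 2 * h.eq_b

theorem xi_sq (h : RootPair lam a b ξ) :
    4 * (lam ^ 2 - ξ ^ 2) = a * b + 1 / (a * b) - (a + b) ^ 2 / (a * b) ^ 2 := by
  have ha := h.a_pos
  have hb := h.b_pos
  have hr := h.rel
  have h1 := h.eq_a
  have h4 : 4 * lam = (a + b) / (a * b) ^ 2 - (a + b) := by
    field_simp; linarith
  have h2 : 4 * (lam ^ 2 - ξ ^ 2) = -(a ^ 4 + 4 * lam * a ^ 3 + 1) / a ^ 2 := by
    field_simp; linarith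
  rw [h2, h4]
  field_simp
  ring

theorem quartic_eq (h : RootPair lam a b ξ) (t : ℝ) :
    quartic lam ξ t = (t - a) * (t - b) * cofactor a b t := by
  have ha := h.a_pos
  have hb := h.b_pos
  have h4 : 4 * lam = (a + b) / (a * b) ^ 2 - (a + b) := by
    have := h.rel
    field_simp; linarith
  unfold quartic cofactor
  rw [h.xi_sq, h4]
  field_simp
  ring

theorem mem_Icc_of_quartic_nonpos (h : RootPair lam a b ξ) {t : ℝ} (ht : 0 < t)
    (hq : quartic lam ξ t ≤ 0) : b ≤ t ∧ t ≤ a := by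
  rw [h.quartic_eq] at hq
  have hc := cofactor_pos h.a_pos h.b_pos ht.le
  have hle : (t - a) * (t - b) ≤ 0 := by
    by_contra! hcon
    exact absurd hq (not_le.2 (mul_pos hcon hc))
  have := h.lt
  constructor <;> nlinarith

theorem eq_or_eq_of_quartic_eq_zero (h : RootPair lam a b ξ) {t : ℝ} (ht : 0 < t)
    (hq : quartic lam ξ t = 0) : t = a ∨ t = b := by
  rw [h.quartic_eq] at hq
  have hc := cofactor_pos h.a_pos h.b_pos ht.le
  rcases mul_eq_zero.1 hq with h1 | h1
  · rcases mul_eq_zero.1 h1 with h2 | h2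
    · left; linarith
    · right; linarith
  · exact absurd h1 hc.ne'

theorem isGreatest (h : RootPair lam a b ξ) : IsGreatest {t : ℝ | quartic lam ξ t = 0} a := by
  refine ⟨by simp [h.quartic_eq], fun t ht => ?_⟩
  rcases le_or_gt t 0 with h0 | h0
  · exact h0.trans h.a_pos.le
  · rcases h.eq_or_eq_of_quartic_eq_zero h0 ht with h1 | h1
    · exact h1.le
    · rw [h1]; exact h.lt.le

theorem add_two_mul_pos (h : RootPair lam a b ξ) : 0 < a + 2 * lam := by
  have ha := h.a_pos
  have hb := h.b_pos
  have hlt := h.lt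
  have hr := h.rel
  have h1 : 0 < 4 * lam + (a + b) := by
    by_contra! hcon
    have : (4 * lam + (a + b)) * (a * b) ^ 2 ≤ 0 :=
      mul_nonpos_of_nonpos_of_nonneg hcon (by positivity)
    linarith
  linarith

/-- If `a ≤ η` then `a³(a + 2λ) ≤ 1`, and `4λ + a + b ≤ 2(a + 2λ)` turns `rel` into `a + b < 2b`,
against `b < a`. -/
theorem eta_lt (h : RootPair lam a b ξ) : eta lam < a := by
  by_contra! hcon
  have ha := h.a_pos
  have hb := h.b_pos
  have hlt := h.lt
  have he := eta_eq lam
  have hep := eta_pos lam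
  have h2 : a ^ 3 * (a + 2 * lam) ≤ 1 := by
    have h3 : a ^ 3 ≤ eta lam ^ 3 := by gcongr
    have h4 := h.add_two_mul_pos
    calc a ^ 3 * (a + 2 * lam) ≤ eta lam ^ 3 * (eta lam + 2 * lam) := by gcongr
      _ = 1 := by linear_combination he
  have hr := h.rel
  have hmul := h.add_two_mul_pos
  have h5 : (a * b) ^ 2 * (4 * lam + (a + b)) < a * (b / a) * 2 ∨ a + b ≤ 2 * b := by
    left
    have h6 : (4 * lam + (a + b)) ≤ 2 * (a + 2 * lam) := by linarith
    calc (a * b) ^ 2 * (4 * lam + (a + b)) ≤ (a * b) ^ 2 * (2 * (a + 2 * lam)) := by gcongr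
      _ = 2 * b ^ 2 / a * (a ^ 3 * (a + 2 * lam)) := by field_simp
      _ ≤ 2 * b ^ 2 / a * 1 := by gcongr
      _ = 2 * b * (b / a) := by ring
      _ < 2 * b * 1 := by gcongr; rwa [div_lt_one ha]
      _ = a * (b / a) * 2 := by field_simp
  rcases h5 with h5 | h5
  · have : a * (b / a) = b := by field_simp
    rw [this] at h5
    linarith
  · linarith

theorem xi_eq (h : RootPair lam a b ξ) : xi lam a = ξ := by
  have ha := h.a_pos
  unfold xi
  have h1 : 1 + (a * (a + 2 * lam)) ^ 2 = (2 * ξ * a) ^ 2 := by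
    linear_combination -h.eq_a
  rw [h1, Real.sqrt_sq (by have := h.xi_pos; positivity)]
  field_simp

/-- Since `Q(t) = t²(t + 2λ)² + 1 - 4ξ²t²`, the point `1/(2ξ)` is a root exactly when it equals
`-2λ`. It cannot be the larger root, as `a + 2λ > 0`. -/
theorem exceptional_iff (h : RootPair lam a b ξ) : 4 * lam * ξ + 1 = 0 ↔ b + 2 * lam = 0 := by
  have hb := h.b_pos
  have hx := h.xi_pos
  constructor
  · intro h0
    have h1 : (0 : ℝ) < 1 / (2 * ξ) := by positivity
    have h2 : quartic lam ξ (1 / (2 * ξ)) = 0 := by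
      have : lam = -1 / (4 * ξ) := by field_simp; linarith
      unfold quartic
      rw [this]
      field_simp
      ring
    have h3 : 1 / (2 * ξ) + 2 * lam = 0 := by
      field_simp; linarith
    rcases h.eq_or_eq_of_quartic_eq_zero h1 h2 with h4 | h4
    · have := h.add_two_mul_pos
      rw [← h4] at this
      linarith
    · rw [← h4]; exact h3
  · intro h0
    have h1 := h.eq_b
    rw [h0] at h1
    have h2 : (2 * ξ * b - 1) * (2 * ξ * b + 1) = 0 := by linear_combination h1
    rcases mul_eq_zero.1 h2 with h3 | h3
    · have : b = -2 * lam := by linarith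
      rw [this] at h3
      linarith
    · have : 0 < 2 * ξ * b := by positivity
      linarith

end RootPair

/-! ### Parametrization of the root pairs -/

/-- The geometric mean of the two positive roots. -/
def rootMean (lam τ : ℝ) : ℝ := eta (lam / Real.cosh τ)

/-- The root `x e ^ τ`; the other positive root is `x e ^ (-τ)`. -/
def root (lam τ : ℝ) : ℝ := rootMean lam τ * Real.exp τ

theorem rootMean_pos (lam τ : ℝ) : 0 < rootMean lam τ := eta_pos _

theorem root_pos (lam τ : ℝ) : 0 < root lam τ := mul_pos (rootMean_pos _ _) (Real.exp_pos _)

theorem rootMean_neg (lam τ : ℝ) : rootMean lam (-τ) = rootMean lam τ := by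
  simp [rootMean]

theorem rootMean_zero (lam : ℝ) : rootMean lam 0 = eta lam := by simp [rootMean]

theorem root_zero (lam : ℝ) : root lam 0 = eta lam := by simp [root, rootMean_zero]

theorem contDiff_rootMean {n : WithTop ℕ∞} (hn : n ≠ 0) (lam : ℝ) :
    ContDiff ℝ n (rootMean lam) :=
  (contDiff_eta hn).comp (contDiff_const.div Real.contDiff_cosh fun x => (Real.cosh_pos x).ne')

theorem continuous_rootMean (lam : ℝ) : Continuous (rootMean lam) :=
  (contDiff_rootMean one_ne_zero lam).continuous

theorem continuous_root (lam : ℝ) : Continuous (root lam) :=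
  (continuous_rootMean lam).mul Real.continuous_exp

theorem rootMean_eq (lam τ : ℝ) :
    2 * lam * rootMean lam τ ^ 3 = Real.cosh τ * (1 - rootMean lam τ ^ 4) := by
  have h := eta_eq (lam / Real.cosh τ)
  have hc := Real.cosh_pos τ
  unfold rootMean
  field_simp at h
  linarith

theorem root_mul_root_neg (lam τ : ℝ) : root lam τ * root lam (-τ) = rootMean lam τ ^ 2 := by
  simp only [root, rootMean_neg, Real.exp_neg]
  field_simp [Real.exp_ne_zero]

theorem root_add_root_neg (lam τ : ℝ) :
    root lam τ + root lam (-τ) = 2 * Real.cosh τ * rootMean lam τ := by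
  simp only [root, rootMean_neg, Real.cosh_eq]
  ring

theorem root_sub_root_neg (lam τ : ℝ) :
    root lam τ - root lam (-τ) = 2 * Real.sinh τ * rootMean lam τ := by
  simp only [root, rootMean_neg, Real.sinh_eq]
  ring

theorem root_rel (lam τ : ℝ) : root lam τ + root lam (-τ) =
    (4 * lam + (root lam τ + root lam (-τ))) * (root lam τ * root lam (-τ)) ^ 2 := by
  rw [root_mul_root_neg, root_add_root_neg]
  linear_combination -2 * rootMean lam τ * rootMean_eq lam τ

theorem tendsto_rootMean (lam : ℝ) : Tendsto (rootMean lam) atTop (𝓝 1) := by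
  have h1 : Tendsto Real.cosh atTop atTop := by
    refine tendsto_atTop_mono (fun t => ?_) (Real.tendsto_exp_atTop.atTop_div_const two_pos)
    rw [Real.cosh_eq]
    have := Real.exp_pos (-t)
    linarith
  have h2 : Tendsto (fun τ => lam / Real.cosh τ) atTop (𝓝 0) := h1.const_div_atTop lam
  have := (continuous_eta.tendsto 0).comp h2
  rwa [eta_zero] at this

theorem tendsto_root (lam : ℝ) : Tendsto (root lam) atTop atTop :=
  (tendsto_rootMean lam).pos_mul_atTop one_pos Real.tendsto_exp_atTop

/-- The larger root determines its partner: dividing `root_rel` by the square of the partner leaves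
a decreasing function of the partner on one side and an increasing one on the other. The ratio of
the two roots is `e^{2τ}`, which then determines `τ`. -/
theorem root_injective (lam : ℝ) : Function.Injective (root lam) := by
  have key : ∀ a b c : ℝ, 0 < a → 0 < b → b < c → a + b = (4 * lam + (a + b)) * (a * b) ^ 2 →
      a + c = (4 * lam + (a + c)) * (a * c) ^ 2 → False := by
    intro a b c ha hb hbc h1 h2
    have hc := hb.trans hbc
    have h1' : (a + b) / b ^ 2 = (4 * lam + (a + b)) * a ^ 2 := by
      field_simp; linarith
    have h2' : (a + c) / c ^ 2 = (4 * lam + (a + c)) * a ^ 2 := by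
      field_simp; linarith
    have h3 : (a + c) / c ^ 2 < (a + b) / b ^ 2 := by
      have e : ∀ t : ℝ, 0 < t → (a + t) / t ^ 2 = a / t ^ 2 + 1 / t := by
        intro t ht; field_simp
      rw [e c hc, e b hb]
      gcongr
    have h4 : (4 * lam + (a + b)) * a ^ 2 < (4 * lam + (a + c)) * a ^ 2 := by gcongr
    linarith
  intro s t hst
  have hs := root_rel lam s
  have ht := root_rel lam t
  rw [← hst] at ht
  have heq : root lam (-s) = root lam (-t) := by
    rcases lt_trichotomy (root lam (-s)) (root lam (-t)) with h | h | h
    · exact (key _ _ _ (root_pos _ _) (root_pos _ _) h hs ht).elim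
    · exact h
    · exact (key _ _ _ (root_pos _ _) (root_pos _ _) h ht hs).elim
  have e : ∀ r : ℝ, root lam r / root lam (-r) = Real.exp (2 * r) := by
    intro r
    have := rootMean_pos lam r
    rw [root, root, rootMean_neg, mul_div_mul_left _ _ this.ne', ← Real.exp_sub]
    ring_nf
  have h2 : Real.exp (2 * s) = Real.exp (2 * t) := by
    rw [← e, ← e, heq, hst]
  have := Real.exp_injective h2
  linarith

theorem root_strictMono (lam : ℝ) : StrictMono (root lam) := by
  rcases (continuous_root lam).strictMono_of_inj (root_injective lam) with h | h
  · exact h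
  · exfalso
    have h1 : root lam 1 < root lam (-1) := h (by norm_num)
    have h2 := root_sub_root_neg lam 1
    have h3 : 0 < 2 * Real.sinh 1 * rootMean lam 1 :=
      mul_pos (mul_pos two_pos (Real.sinh_pos_iff.2 one_pos)) (rootMean_pos _ _)
    linarith

theorem exists_root_eq (lam : ℝ) {e : ℝ} (he : eta lam < e) : ∃ τ, root lam τ = e := by
  refine mem_range_of_exists_le_of_exists_ge (continuous_root lam) ⟨0, ?_⟩ ?_
  · rw [root_zero]; exact he.le
  · exact ((tendsto_root lam).eventually_ge_atTop e).exists

/-- The inverse of `root lam`. -/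
def rootParam (lam : ℝ) : ℝ → ℝ := Function.invFun (root lam)

theorem root_rootParam {lam e : ℝ} (he : eta lam < e) : root lam (rootParam lam e) = e :=
  Function.invFun_eq (exists_root_eq lam he)

theorem rootParam_root (lam τ : ℝ) : rootParam lam (root lam τ) = τ :=
  Function.leftInverse_invFun (root_injective lam) τ

theorem rootParam_pos {lam e : ℝ} (he : eta lam < e) : 0 < rootParam lam e := by
  rw [← (root_strictMono lam).lt_iff_lt, root_zero, root_rootParam he]
  exact he

theorem eta_lt_root {lam τ : ℝ} (h : 0 < τ) : eta lam < root lam τ := by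
  rw [← root_zero]; exact root_strictMono lam h

theorem tendsto_rootParam_eta (lam : ℝ) : Tendsto (rootParam lam) (𝓝[>] (eta lam)) (𝓝 0) := by
  rw [Metric.tendsto_nhds]
  intro ε hε
  filter_upwards [self_mem_nhdsWithin,
    mem_nhdsWithin_of_mem_nhds (Iio_mem_nhds (eta_lt_root (lam := lam) hε))] with e h1 h2
  have h3 := rootParam_pos h1
  rw [Real.dist_eq, sub_zero, abs_of_pos h3, ← (root_strictMono lam).lt_iff_lt, root_rootParam h1]
  exact h2

theorem tendsto_rootParam_atTop (lam : ℝ) : Tendsto (rootParam lam) atTop atTop := by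
  rw [tendsto_atTop]
  intro M
  filter_upwards [eventually_gt_atTop (eta lam), eventually_ge_atTop (root lam M)] with e h1 h2
  rw [← (root_strictMono lam).le_iff_le, root_rootParam h1]
  exact h2

/-- The smaller positive root as a function of the larger one. -/
def smallRoot (lam e : ℝ) : ℝ := root lam (-rootParam lam e)

theorem xi_sq_mul {lam e : ℝ} (he : 0 < e) :
    0 < xi lam e ∧ 4 * xi lam e ^ 2 * e ^ 2 = 1 + e ^ 2 * (e + 2 * lam) ^ 2 := by
  constructor
  · unfold xi; positivity
  · unfold xi
    rw [mul_pow, Real.sq_sqrt (by positivity)]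
    field_simp
    ring

/-- The elimination behind `RootPair.rel` is run backwards: that relation and the root equation of
`e` yield the root equation of the partner. -/
theorem rootPair_smallRoot {lam e : ℝ} (he : eta lam < e) :
    RootPair lam e (smallRoot lam e) (xi lam e) := by
  have hτ := rootParam_pos he
  have he0 : 0 < e := (eta_pos lam).trans he
  have hx := xi_sq_mul (lam := lam) he0
  have hb : 0 < smallRoot lam e := root_pos _ _
  have hr := root_rel lam (rootParam lam e)
  rw [root_rootParam he, ← smallRoot] at hr
  refine ⟨hb, ?_, hx.1, hx.2, ?_⟩
  · conv_rhs => rw [← root_rootParam he]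
    exact root_strictMono lam (by linarith)
  · have h : e ^ 2 * (4 * xi lam e ^ 2 * smallRoot lam e ^ 2 -
      (1 + smallRoot lam e ^ 2 * (smallRoot lam e + 2 * lam) ^ 2)) = 0 := by
      linear_combination smallRoot lam e ^ 2 * hx.2 - (e - smallRoot lam e) * hr
    have := (mul_eq_zero.1 h).resolve_left (by positivity)
    linarith

/-! ### The angle variable -/

/-- The `μ`-invariant in terms of the angle variable. -/
def muAngle (a b φ : ℝ) : ℝ := (a + b) / 2 + (a - b) / 2 * Real.cos φ

/-- The speed of the angle variable. -/
def angleSpeed (a b φ : ℝ) : ℝ := muAngle a b φ * √(cofactor a b (muAngle a b φ))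

/-- The time as a function of the angle variable. -/
def time (a b φ : ℝ) : ℝ := ∫ t in (0 : ℝ)..φ, 1 / angleSpeed a b t

/-- The angle variable as a function of time. -/
def angle (a b : ℝ) : ℝ → ℝ := Function.invFun (time a b)

/-- The period of the `μ`-invariant. -/
def period (a b : ℝ) : ℝ := time a b (2 * Real.pi)

/-- The explicit solution of the equation of the `μ`-invariant with `μ 0 = a`. -/
def mu (a b s : ℝ) : ℝ := muAngle a b (angle a b s)

/-- The derivative of `1 / μ`. -/
def recipDot (a b s : ℝ) : ℝ :=
  (a - b) / 2 * Real.sin (angle a b s) * √(cofactor a b (mu a b s)) / mu a b s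

theorem muAngle_neg (a b φ : ℝ) : muAngle a b (-φ) = muAngle a b φ := by simp [muAngle]

theorem muAngle_add_two_pi (a b φ : ℝ) : muAngle a b (φ + 2 * Real.pi) = muAngle a b φ := by
  simp [muAngle]

theorem contDiff_muAngle (a b : ℝ) {n : WithTop ℕ∞} : ContDiff ℝ n (muAngle a b) := by
  unfold muAngle
  exact contDiff_const.add (contDiff_const.mul Real.contDiff_cos)

theorem contDiff_cofactor (a b : ℝ) {n : WithTop ℕ∞} : ContDiff ℝ n (cofactor a b) := by
  unfold cofactor
  fun_prop

/-- The rate of rotation about the `Ox`-axis, in terms of `μ`. -/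
def rotRate (lam ξ t : ℝ) : ℝ := t ^ 2 + (t + 2 * lam) / (2 * ξ + 1 / t)

/-- The rotation angle about the `Ox`-axis. -/
def rotAngle (lam a b ξ s : ℝ) : ℝ := ∫ t in (0 : ℝ)..s, rotRate lam ξ (mu a b t)

/-- The angle of the rotation which relates successive periods of the explicit curve. -/
def rotPeriod (lam a b ξ : ℝ) : ℝ := 2 * rotAngle lam a b ξ (period a b / 2)

namespace RootPair

variable {lam a b ξ : ℝ}

theorem muAngle_mem (h : RootPair lam a b ξ) (φ : ℝ) :
    b ≤ muAngle a b φ ∧ muAngle a b φ ≤ a := by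
  have h1 := Real.neg_one_le_cos φ
  have h2 := Real.cos_le_one φ
  have := h.lt
  unfold muAngle
  constructor <;> nlinarith

theorem muAngle_pos (h : RootPair lam a b ξ) (φ : ℝ) : 0 < muAngle a b φ :=
  h.b_pos.trans_le (h.muAngle_mem φ).1

theorem cofactor_muAngle_pos (h : RootPair lam a b ξ) (φ : ℝ) :
    0 < cofactor a b (muAngle a b φ) :=
  cofactor_pos h.a_pos h.b_pos (h.muAngle_pos φ).le

theorem angleSpeed_pos (h : RootPair lam a b ξ) (φ : ℝ) : 0 < angleSpeed a b φ :=
  mul_pos (h.muAngle_pos φ) (Real.sqrt_pos.2 (h.cofactor_muAngle_pos φ))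

theorem angleSpeed_le (h : RootPair lam a b ξ) (φ : ℝ) :
    angleSpeed a b φ ≤ a * √(cofactor a b a) := by
  have h1 := (h.muAngle_mem φ).2
  have h2 := h.muAngle_pos φ
  have ha := h.a_pos
  have hb := h.b_pos
  unfold angleSpeed
  gcongr
  unfold cofactor
  gcongr

theorem contDiff_angleSpeed (h : RootPair lam a b ξ) {n : WithTop ℕ∞} :
    ContDiff ℝ n (angleSpeed a b) :=
  (contDiff_muAngle a b).mul
    (((contDiff_cofactor a b).comp (contDiff_muAngle a b)).sqrt
      fun φ => (h.cofactor_muAngle_pos φ).ne')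

theorem continuous_recip_angleSpeed (h : RootPair lam a b ξ) :
    Continuous fun φ => 1 / angleSpeed a b φ :=
  continuous_const.div (h.contDiff_angleSpeed (n := 0)).continuous
    fun φ => (h.angleSpeed_pos φ).ne'

theorem hasDerivAt_time (h : RootPair lam a b ξ) (φ : ℝ) :
    HasDerivAt (time a b) (1 / angleSpeed a b φ) φ :=
  h.continuous_recip_angleSpeed.integral_hasStrictDerivAt 0 φ |>.hasDerivAt

theorem time_strictMono (h : RootPair lam a b ξ) : StrictMono (time a b) :=
  strictMono_of_deriv_pos fun φ => by
    rw [(h.hasDerivAt_time φ).deriv]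
    exact one_div_pos.2 (h.angleSpeed_pos φ)

theorem continuous_time (h : RootPair lam a b ξ) : Continuous (time a b) :=
  continuous_iff_continuousAt.2 fun φ => (h.hasDerivAt_time φ).continuousAt

theorem time_neg (φ : ℝ) : time a b (-φ) = -time a b φ := by
  unfold time
  have h1 : ∫ t in (0 : ℝ)..(-φ), 1 / angleSpeed a b t =
      ∫ t in (0 : ℝ)..(-φ), 1 / angleSpeed a b (-t) := by
    congr 1; ext t
    simp [angleSpeed, muAngle_neg]
  rw [h1, intervalIntegral.integral_comp_neg (fun t => 1 / angleSpeed a b t), neg_neg, neg_zero,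
    intervalIntegral.integral_symm]

theorem time_zero : time a b 0 = 0 := by simp [time]

theorem time_add_two_pi (h : RootPair lam a b ξ) (φ : ℝ) :
    time a b (φ + 2 * Real.pi) = time a b φ + period a b := by
  have hd : ∀ x, HasDerivAt (fun φ => time a b (φ + 2 * Real.pi) - time a b φ) 0 x := by
    intro x
    have h1 := (h.hasDerivAt_time (x + 2 * Real.pi)).comp_add_const x (2 * Real.pi)
    refine (h1.sub (h.hasDerivAt_time x)).congr_deriv ?_
    simp [angleSpeed, muAngle_add_two_pi]
  have := is_const_of_deriv_eq_zero (fun x => (hd x).differentiableAt) (fun x => (hd x).deriv) φ 0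
  simp only [zero_add, time_zero, sub_zero] at this
  unfold period
  linarith

theorem time_pi (h : RootPair lam a b ξ) : time a b Real.pi = period a b / 2 := by
  have h1 := h.time_add_two_pi (-Real.pi)
  rw [time_neg] at h1
  have : -Real.pi + 2 * Real.pi = Real.pi := by ring
  rw [this] at h1
  linarith

/-- The angle variable moves at a speed bounded by its value at `φ = 0`, where `μ = a`, so the
elapsed time grows at least linearly. Thus the angle is defined for all times. -/
theorem tendsto_time_atTop (h : RootPair lam a b ξ) : Tendsto (time a b) atTop atTop := by
  have ha := h.a_pos
  have hR := cofactor_pos h.a_pos h.b_pos ha.le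
  have hM : 0 < a * √(cofactor a b a) := mul_pos ha (Real.sqrt_pos.2 hR)
  have hlim : Tendsto (fun φ : ℝ => φ * (1 / (a * √(cofactor a b a)))) atTop atTop :=
    tendsto_id.atTop_mul_const (by positivity)
  refine tendsto_atTop_mono' _ ?_ hlim
  filter_upwards [eventually_ge_atTop 0] with φ hφ
  have h1 : ∫ _ in (0 : ℝ)..φ, 1 / (a * √(cofactor a b a)) ≤ time a b φ := by
    unfold time
    apply intervalIntegral.integral_mono_on hφ
    · simp
    · exact h.continuous_recip_angleSpeed.intervalIntegrable _ _
    · intro t _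
      exact one_div_le_one_div_of_le (h.angleSpeed_pos t) (h.angleSpeed_le t)
  rwa [intervalIntegral.integral_const, smul_eq_mul, sub_zero] at h1

theorem time_surjective (h : RootPair lam a b ξ) : Function.Surjective (time a b) := by
  refine h.continuous_time.surjective h.tendsto_time_atTop ?_
  have : time a b = fun φ => -time a b (-φ) := by ext φ; rw [time_neg, neg_neg]
  rw [this]
  exact tendsto_neg_atTop_atBot.comp (h.tendsto_time_atTop.comp tendsto_neg_atBot_atTop)

theorem time_angle (h : RootPair lam a b ξ) (s : ℝ) : time a b (angle a b s) = s :=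
  Function.invFun_eq (h.time_surjective s)

theorem angle_time (h : RootPair lam a b ξ) (φ : ℝ) : angle a b (time a b φ) = φ :=
  Function.leftInverse_invFun h.time_strictMono.injective φ

theorem angle_zero (h : RootPair lam a b ξ) : angle a b 0 = 0 := by
  have := h.angle_time 0
  rwa [time_zero] at this

theorem angle_strictMono (h : RootPair lam a b ξ) : StrictMono (angle a b) := by
  intro s t hst
  rw [← h.time_strictMono.lt_iff_lt, h.time_angle, h.time_angle]
  exact hst

theorem angle_neg (h : RootPair lam a b ξ) (s : ℝ) : angle a b (-s) = -angle a b s := by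
  apply h.time_strictMono.injective
  rw [h.time_angle, time_neg, h.time_angle]

theorem angle_add_period (h : RootPair lam a b ξ) (s : ℝ) :
    angle a b (s + period a b) = angle a b s + 2 * Real.pi := by
  apply h.time_strictMono.injective
  rw [h.time_angle, h.time_add_two_pi, h.time_angle]

theorem angle_half_period (h : RootPair lam a b ξ) : angle a b (period a b / 2) = Real.pi := by
  rw [← h.time_pi, h.angle_time]

theorem period_pos (h : RootPair lam a b ξ) : 0 < period a b := by
  rw [← time_zero (a := a) (b := b)]
  exact h.time_strictMono (by positivity)

theorem continuous_angle (h : RootPair lam a b ξ) : Continuous (angle a b) :=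
  h.angle_strictMono.monotone.continuous_of_surjective fun φ => ⟨_, h.angle_time φ⟩

theorem hasDerivAt_angle (h : RootPair lam a b ξ) (s : ℝ) :
    HasDerivAt (angle a b) (angleSpeed a b (angle a b s)) s := by
  have := HasDerivAt.of_local_left_inverse h.continuous_angle.continuousAt
    (h.hasDerivAt_time (angle a b s)) (one_div_pos.2 (h.angleSpeed_pos _)).ne'
    (Eventually.of_forall h.time_angle)
  simpa using this

/-- Bootstrap: the angle solves an autonomous equation with smooth right-hand side, so each order of
smoothness yields the next. -/
theorem contDiff_angle (h : RootPair lam a b ξ) : ContDiff ℝ ∞ (angle a b) := by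
  rw [contDiff_infty]
  intro n
  induction n with
  | zero => exact contDiff_zero.2 h.continuous_angle
  | succ n ih =>
    have : ((n + 1 : ℕ) : WithTop ℕ∞) = (n : WithTop ℕ∞) + 1 := by push_cast; rfl
    rw [this, contDiff_succ_iff_deriv]
    refine ⟨fun s => (h.hasDerivAt_angle s).differentiableAt, by simp, ?_⟩
    have hd : deriv (angle a b) = fun s => angleSpeed a b (angle a b s) :=
      funext fun s => (h.hasDerivAt_angle s).deriv
    rw [hd]
    exact h.contDiff_angleSpeed.comp ih

/-! ### The explicit `μ`-invariant -/

theorem mu_mem (h : RootPair lam a b ξ) (s : ℝ) : b ≤ mu a b s ∧ mu a b s ≤ a :=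
  h.muAngle_mem _

theorem mu_pos (h : RootPair lam a b ξ) (s : ℝ) : 0 < mu a b s := h.muAngle_pos _

theorem mu_zero (h : RootPair lam a b ξ) : mu a b 0 = a := by
  rw [mu, h.angle_zero, muAngle, Real.cos_zero]; ring

theorem mu_half_period (h : RootPair lam a b ξ) : mu a b (period a b / 2) = b := by
  rw [mu, h.angle_half_period, muAngle, Real.cos_pi]; ring

theorem mu_neg (h : RootPair lam a b ξ) (s : ℝ) : mu a b (-s) = mu a b s := by
  rw [mu, h.angle_neg, muAngle_neg, mu]

theorem mu_add_period (h : RootPair lam a b ξ) (s : ℝ) :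
    mu a b (s + period a b) = mu a b s := by
  rw [mu, h.angle_add_period, muAngle_add_two_pi, mu]

theorem recipDot_add_period (h : RootPair lam a b ξ) (s : ℝ) :
    recipDot a b (s + period a b) = recipDot a b s := by
  rw [recipDot, h.mu_add_period, h.angle_add_period, Real.sin_add_two_pi, recipDot]

theorem contDiff_mu (h : RootPair lam a b ξ) : ContDiff ℝ ∞ (mu a b) :=
  (contDiff_muAngle a b).comp h.contDiff_angle

theorem continuous_mu (h : RootPair lam a b ξ) : Continuous (mu a b) := h.contDiff_mu.continuous

theorem contDiff_recipDot (h : RootPair lam a b ξ) : ContDiff ℝ ∞ (recipDot a b) := by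
  unfold recipDot
  refine ContDiff.div ((contDiff_const.mul (Real.contDiff_sin.comp h.contDiff_angle)).mul
    (((contDiff_cofactor a b).comp h.contDiff_mu).sqrt fun s => ?_)) h.contDiff_mu
    fun s => (h.mu_pos s).ne'
  exact (h.cofactor_muAngle_pos _).ne'

theorem hasDerivAt_mu (h : RootPair lam a b ξ) (s : ℝ) :
    HasDerivAt (mu a b) (-(mu a b s ^ 2 * recipDot a b s)) s := by
  have h1 : HasDerivAt (mu a b)
      ((a - b) / 2 * (-Real.sin (angle a b s) * angleSpeed a b (angle a b s))) s :=
    (((h.hasDerivAt_angle s).cos).const_mul ((a - b) / 2)).const_add ((a + b) / 2)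
  refine h1.congr_deriv ?_
  have := h.mu_pos s
  rw [angleSpeed, ← mu, recipDot]
  field_simp

theorem hasDerivAt_recip_mu (h : RootPair lam a b ξ) (s : ℝ) :
    HasDerivAt (fun s => 1 / mu a b s) (recipDot a b s) s := by
  have hp := h.mu_pos s
  have := (h.hasDerivAt_mu s).fun_inv hp.ne'
  simp only [one_div]
  refine this.congr_deriv ?_
  field_simp

theorem recipDot_sq (h : RootPair lam a b ξ) (s : ℝ) :
    recipDot a b s ^ 2 * mu a b s ^ 2 = -quartic lam ξ (mu a b s) := by
  have hp := h.mu_pos s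
  have hc : 0 < cofactor a b (mu a b s) := h.cofactor_muAngle_pos _
  have h1 : recipDot a b s ^ 2 * mu a b s ^ 2 =
      ((a - b) / 2) ^ 2 * (Real.sin (angle a b s)) ^ 2 * cofactor a b (mu a b s) := by
    rw [recipDot, div_pow, mul_pow, Real.sq_sqrt hc.le]
    field_simp
  rw [h1, h.quartic_eq, Real.sin_sq]
  have h2 : mu a b s = (a + b) / 2 + (a - b) / 2 * Real.cos (angle a b s) := rfl
  have h3 : ((a - b) / 2) ^ 2 * (1 - Real.cos (angle a b s) ^ 2) =
      -((mu a b s - a) * (mu a b s - b)) := by rw [h2]; ring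
  rw [h3]; ring

/-- This is the squared length of the conserved vector with Frenet coordinates `(1/μ, r, μ + 2λ)`.
It makes the explicit position and velocity unit vectors. -/
theorem energy (h : RootPair lam a b ξ) (s : ℝ) :
    (1 / mu a b s) ^ 2 + recipDot a b s ^ 2 + (mu a b s + 2 * lam) ^ 2 = 4 * ξ ^ 2 := by
  have hp := h.mu_pos s
  have h1 := h.recipDot_sq s
  have h2 : recipDot a b s ^ 2 = -quartic lam ξ (mu a b s) / mu a b s ^ 2 := by
    rw [eq_div_iff (by positivity), h1]
  rw [h2, quartic]
  field_simp
  ring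

/-- The formula for `recipDot` is differentiated directly: differentiating `energy` instead would
require dividing by `recipDot`, which vanishes at the turning points. -/
theorem hasDerivAt_recipDot (h : RootPair lam a b ξ) (s : ℝ) :
    HasDerivAt (recipDot a b) (-(1 / mu a b s) + mu a b s ^ 2 * (mu a b s + 2 * lam)) s := by
  have hp := h.mu_pos s
  have hc : 0 < cofactor a b (mu a b s) := h.cofactor_muAngle_pos _
  have ha := h.a_pos
  have hb := h.b_pos
  have hsin := (h.hasDerivAt_angle s).sin
  have hcof : HasDerivAt (fun s => cofactor a b (mu a b s))
      ((2 * mu a b s + (a + b) / (a * b) ^ 2) * -(mu a b s ^ 2 * recipDot a b s)) s := by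
    have h1 : HasDerivAt (cofactor a b) (2 * mu a b s + (a + b) / (a * b) ^ 2) (mu a b s) := by
      have := (((hasDerivAt_pow 2 (mu a b s)).add ((hasDerivAt_id (mu a b s)).const_mul
        ((a + b) / (a * b) ^ 2))).add_const (1 / (a * b)))
      refine this.congr_deriv ?_
      norm_num
    exact h1.comp s (h.hasDerivAt_mu s)
  have htot := (((hsin.const_mul ((a - b) / 2)).mul (hcof.sqrt hc.ne')).div
    (h.hasDerivAt_mu s) hp.ne')
  refine htot.congr_deriv ?_
  have hmu : (a - b) / 2 * Real.cos (angle a b s) = mu a b s - (a + b) / 2 := by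
    rw [mu, muAngle]; ring
  have hrd : recipDot a b s =
    (a - b) / 2 * Real.sin (angle a b s) * √(cofactor a b (mu a b s)) / mu a b s := rfl
  have hsq : ((a - b) / 2 * Real.sin (angle a b s)) ^ 2 =
      -((mu a b s - a) * (mu a b s - b)) := by
    rw [mul_pow, Real.sin_sq]
    linear_combination -((a - b) / 2 * Real.cos (angle a b s) + (mu a b s - (a + b) / 2)) * hmu
  have hspeed : angleSpeed a b (angle a b s) = mu a b s * √(cofactor a b (mu a b s)) := rfl
  rw [hspeed, hrd]
  set r := √(cofactor a b (mu a b s)) with hr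
  have hr0 : 0 < r := Real.sqrt_pos.2 hc
  have hr2 : r ^ 2 = cofactor a b (mu a b s) := Real.sq_sqrt hc.le
  set m := mu a b s
  set σ := Real.sin (angle a b s)
  set c := Real.cos (angle a b s)
  have e1 : (((a - b) / 2 * (c * (m * r)) * r +
      (a - b) / 2 * σ * ((2 * m + (a + b) / (a * b) ^ 2) * -(m ^ 2 * ((a - b) / 2 * σ * r / m)) /
        (2 * r))) * m - (a - b) / 2 * σ * r * -(m ^ 2 * ((a - b) / 2 * σ * r / m))) / m ^ 2 =
      (a - b) / 2 * c * r ^ 2 - ((a - b) / 2 * σ) ^ 2 * (2 * m + (a + b) / (a * b) ^ 2) / 2 +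
        ((a - b) / 2 * σ) ^ 2 * r ^ 2 / m := by
    field_simp
    ring
  refine e1.trans ?_
  rw [hmu, hsq, hr2, cofactor]
  have h4 : 2 * lam = ((a + b) / (a * b) ^ 2 - (a + b)) / 2 := by
    have := h.rel
    field_simp; linarith
  rw [h4]
  field_simp
  ring

/-! ### The rotation angle -/

theorem denom_pos (h : RootPair lam a b ξ) (s : ℝ) : 0 < 2 * ξ + 1 / mu a b s := by
  have := h.xi_pos
  have := h.mu_pos s
  positivity

theorem contDiff_rotRate_mu (h : RootPair lam a b ξ) :
    ContDiff ℝ ∞ fun s => rotRate lam ξ (mu a b s) := by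
  unfold rotRate
  refine (h.contDiff_mu.pow 2).add ((h.contDiff_mu.add contDiff_const).div
    (contDiff_const.add (contDiff_const.div h.contDiff_mu fun s => (h.mu_pos s).ne')) fun s => ?_)
  exact (h.denom_pos s).ne'

theorem hasDerivAt_rotAngle (h : RootPair lam a b ξ) (s : ℝ) :
    HasDerivAt (rotAngle lam a b ξ) (rotRate lam ξ (mu a b s)) s :=
  h.contDiff_rotRate_mu.continuous.integral_hasStrictDerivAt 0 s |>.hasDerivAt

theorem contDiff_rotAngle (h : RootPair lam a b ξ) : ContDiff ℝ ∞ (rotAngle lam a b ξ) := by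
  rw [contDiff_infty_iff_deriv]
  refine ⟨fun s => (h.hasDerivAt_rotAngle s).differentiableAt, ?_⟩
  have : deriv (rotAngle lam a b ξ) = fun s => rotRate lam ξ (mu a b s) :=
    funext fun s => (h.hasDerivAt_rotAngle s).deriv
  rw [this]
  exact h.contDiff_rotRate_mu

theorem rotAngle_zero : rotAngle lam a b ξ 0 = 0 := by simp [rotAngle]

/-- The increment over a period is constant because the rate is periodic. Evaluating it from minus
to plus half a period, where the rotation angle is odd, gives twice the value at the half period. -/
theorem rotAngle_add_period (h : RootPair lam a b ξ) (s : ℝ) :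
    rotAngle lam a b ξ (s + period a b) = rotAngle lam a b ξ s + rotPeriod lam a b ξ := by
  have hd : ∀ x, HasDerivAt (fun s => rotAngle lam a b ξ (s + period a b) -
      rotAngle lam a b ξ s) 0 x := by
    intro x
    have h1 := (h.hasDerivAt_rotAngle (x + period a b)).comp_add_const x (period a b)
    refine (h1.sub (h.hasDerivAt_rotAngle x)).congr_deriv ?_
    simp [h.mu_add_period]
  have hodd : rotAngle lam a b ξ (-(period a b / 2)) = -rotAngle lam a b ξ (period a b / 2) := by
    unfold rotAngle
    have h1 : ∫ t in (0 : ℝ)..(-(period a b / 2)), rotRate lam ξ (mu a b t) =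
        ∫ t in (0 : ℝ)..(-(period a b / 2)), rotRate lam ξ (mu a b (-t)) := by
      congr 1; ext t
      rw [h.mu_neg]
    rw [h1, intervalIntegral.integral_comp_neg (fun t => rotRate lam ξ (mu a b t)), neg_neg,
      neg_zero, intervalIntegral.integral_symm]
  have := is_const_of_deriv_eq_zero (fun x => (hd x).differentiableAt) (fun x => (hd x).deriv) s
    (-(period a b / 2))
  simp only [hodd] at this
  have e : -(period a b / 2) + period a b = period a b / 2 := by ring
  rw [e] at this
  rw [rotPeriod]
  linarith

end RootPair

/-! ### Frenet curves on the sphere -/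

/-- A unit speed spherical curve satisfying the Frenet equations with curvature `κ`. -/
structure IsFrenet (κ : ℝ → ℝ) (γ : ℝ → Fin 3 → ℝ) : Prop where
  sphere : ∀ s, γ s ⬝ᵥ γ s = 1
  unitSpeed : ∀ s, deriv γ s ⬝ᵥ deriv γ s = 1
  hasDerivAt : ∀ s, HasDerivAt γ (deriv γ s) s
  frenet : ∀ s, HasDerivAt (deriv γ) (-γ s + κ s • (γ s ⨯₃ deriv γ s)) s

theorem hasDerivAt_dotProduct {f g : ℝ → Fin 3 → ℝ} {f' g' : Fin 3 → ℝ} {s : ℝ}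
    (hf : HasDerivAt f f' s) (hg : HasDerivAt g g' s) :
    HasDerivAt (fun t => f t ⬝ᵥ g t) (f' ⬝ᵥ g s + f s ⬝ᵥ g') s := by
  rw [hasDerivAt_pi] at hf hg
  simp only [dotProduct, ← Finset.sum_add_distrib]
  exact HasDerivAt.fun_sum fun i _ => (hf i).mul (hg i)

theorem pos_dot_vel {γ : ℝ → Fin 3 → ℝ} (hs : ∀ s, γ s ⬝ᵥ γ s = 1) {s : ℝ} {T : Fin 3 → ℝ}
    (h : HasDerivAt γ T s) : γ s ⬝ᵥ T = 0 := by
  have h1 := hasDerivAt_dotProduct h h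
  have h2 : HasDerivAt (fun t => γ t ⬝ᵥ γ t) 0 s := by
    simp only [hs]; exact hasDerivAt_const _ _
  have h3 := h1.unique h2
  rw [dotProduct_comm T] at h3
  linarith

theorem crossProduct_dot_self {x y : Fin 3 → ℝ} (hx : x ⬝ᵥ x = 1) (hy : y ⬝ᵥ y = 1)
    (hxy : x ⬝ᵥ y = 0) : (x ⨯₃ y) ⬝ᵥ (x ⨯₃ y) = 1 := by
  rw [cross_dot_cross, hx, hy, hxy, dotProduct_comm y x, hxy]; norm_num

/-- The matrix with the given columns. -/
def columns (x y z : Fin 3 → ℝ) : Matrix (Fin 3) (Fin 3) ℝ := (Matrix.of ![x, y, z])ᵀ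

theorem columns_transpose_mul {x y : Fin 3 → ℝ} (hx : x ⬝ᵥ x = 1) (hy : y ⬝ᵥ y = 1)
    (hxy : x ⬝ᵥ y = 0) : (columns x y (x ⨯₃ y))ᵀ * columns x y (x ⨯₃ y) = 1 := by
  have hyx : y ⬝ᵥ x = 0 := by rw [dotProduct_comm, hxy]
  have h1 := crossProduct_dot_self hx hy hxy
  have h2 := dot_self_cross x y
  have h3 := dot_cross_self x y
  have h4 : (x ⨯₃ y) ⬝ᵥ x = 0 := by rw [dotProduct_comm, h2]
  have h5 : (x ⨯₃ y) ⬝ᵥ y = 0 := by rw [dotProduct_comm, h3]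
  ext i j
  rw [Matrix.mul_apply']
  fin_cases i <;> fin_cases j <;> simp [columns, Matrix.transpose] <;>
    first
      | exact hx | exact hxy | exact hyx | exact hy | exact h1 | exact h2 | exact h3 | exact h4
      | exact h5

theorem columns_mul_transpose {x y : Fin 3 → ℝ} (hx : x ⬝ᵥ x = 1) (hy : y ⬝ᵥ y = 1)
    (hxy : x ⬝ᵥ y = 0) : columns x y (x ⨯₃ y) * (columns x y (x ⨯₃ y))ᵀ = 1 :=
  mul_eq_one_comm.1 (columns_transpose_mul hx hy hxy)

theorem frame_eq_columns (γ : ℝ → Fin 3 → ℝ) (s : ℝ) :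
    frame γ s = columns (γ s) (deriv γ s) (γ s ⨯₃ deriv γ s) := rfl

theorem mulVec_columns (M : Matrix (Fin 3) (Fin 3) ℝ) (x y z : Fin 3 → ℝ) :
    M * columns x y z = columns (M *ᵥ x) (M *ᵥ y) (M *ᵥ z) := by
  ext i j
  rw [Matrix.mul_apply']
  fin_cases j <;> rfl

theorem columns_inj {x y z x' y' z' : Fin 3 → ℝ} (h : columns x y z = columns x' y' z') :
    x = x' ∧ y = y' ∧ z = z' := by
  refine ⟨?_, ?_, ?_⟩ <;> ext i
  · exact congrFun (congrFun h i) 0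
  · exact congrFun (congrFun h i) 1
  · exact congrFun (congrFun h i) 2

theorem eq_of_dotProduct_eq {x y w z : Fin 3 → ℝ} (hx : x ⬝ᵥ x = 1) (hy : y ⬝ᵥ y = 1)
    (hxy : x ⬝ᵥ y = 0) (h1 : x ⬝ᵥ w = x ⬝ᵥ z) (h2 : y ⬝ᵥ w = y ⬝ᵥ z)
    (h3 : (x ⨯₃ y) ⬝ᵥ w = (x ⨯₃ y) ⬝ᵥ z) : w = z := by
  have h := columns_mul_transpose hx hy hxy
  have e : (columns x y (x ⨯₃ y))ᵀ *ᵥ w = (columns x y (x ⨯₃ y))ᵀ *ᵥ z := by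
    ext i
    fin_cases i
    · exact h1
    · exact h2
    · exact h3
  rw [← Matrix.one_mulVec w, ← Matrix.one_mulVec z, ← h, ← Matrix.mulVec_mulVec,
    ← Matrix.mulVec_mulVec, e]

/-- Expand `γ''` in the orthonormal frame: differentiating `γ · γ' = 0` and `γ' · γ' = 1` gives the
components `-1` and `0`, and the third is the curvature by definition. -/
theorem isFrenet_of_contDiff {γ : ℝ → Fin 3 → ℝ} (hc : ContDiff ℝ 2 γ)
    (hs : ∀ s, γ s ⬝ᵥ γ s = 1) (hu : ∀ s, deriv γ s ⬝ᵥ deriv γ s = 1) :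
    IsFrenet (curvature γ) γ := by
  have hd : ∀ s, HasDerivAt γ (deriv γ s) s := fun s =>
    (hc.differentiable two_ne_zero s).hasDerivAt
  have hd2 : ∀ s, HasDerivAt (deriv γ) (deriv (deriv γ) s) s := fun s => by
    have : ContDiff ℝ 1 (deriv γ) := by
      rw [show (2 : WithTop ℕ∞) = 1 + 1 by norm_num, contDiff_succ_iff_deriv] at hc
      exact hc.2.2
    exact (this.differentiable one_ne_zero s).hasDerivAt
  refine ⟨hs, hu, hd, fun s => ?_⟩
  refine (hd2 s).congr_deriv ?_
  have hxy : ∀ s, γ s ⬝ᵥ deriv γ s = 0 := fun s => pos_dot_vel hs (hd s)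
  refine eq_of_dotProduct_eq (hs s) (hu s) (hxy s) ?_ ?_ ?_
  · have h1 := hasDerivAt_dotProduct (hd s) (hd2 s)
    have h2 : HasDerivAt (fun t => γ t ⬝ᵥ deriv γ t) 0 s := by
      simp only [hxy]; exact hasDerivAt_const _ _
    have h3 := h1.unique h2
    rw [hu] at h3
    simp only [dotProduct_add, dotProduct_neg, dotProduct_smul, hs, dot_self_cross, smul_zero]
    linarith
  · rw [pos_dot_vel hu (hd2 s)]
    simp only [dotProduct_add, dotProduct_neg, dotProduct_smul, dot_cross_self, smul_zero]
    rw [dotProduct_comm, hxy]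
    simp
  · simp only [dotProduct_add, dotProduct_neg, dotProduct_smul,
      crossProduct_dot_self (hs s) (hu s) (hxy s)]
    rw [dotProduct_comm _ (γ s), dot_self_cross, dotProduct_comm, curvature]
    simp

namespace IsFrenet

variable {κ : ℝ → ℝ} {γ γ₁ γ₂ : ℝ → Fin 3 → ℝ}

theorem orth (h : IsFrenet κ γ) (s : ℝ) : γ s ⬝ᵥ deriv γ s = 0 :=
  pos_dot_vel h.sphere (h.hasDerivAt s)

theorem curvature_eq (h : IsFrenet κ γ) : curvature γ = κ := by
  ext s
  rw [curvature, (h.frenet s).deriv, add_dotProduct, neg_dotProduct, smul_dotProduct,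
    dot_self_cross, crossProduct_dot_self (h.sphere s) (h.unitSpeed s) (h.orth s)]
  simp

theorem frame_transpose_mul (h : IsFrenet κ γ) (s : ℝ) : (frame γ s)ᵀ * frame γ s = 1 :=
  columns_transpose_mul (h.sphere s) (h.unitSpeed s) (h.orth s)

theorem frame_inv (h : IsFrenet κ γ) (s : ℝ) : (frame γ s)⁻¹ = (frame γ s)ᵀ :=
  Matrix.inv_eq_left_inv (h.frame_transpose_mul s)

theorem comp_add_const (h : IsFrenet κ γ) (c : ℝ) :
    IsFrenet (fun s => κ (s + c)) (fun s => γ (s + c)) := by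
  have hd : deriv (fun s => γ (s + c)) = fun s => deriv γ (s + c) := by
    ext1 s; exact deriv_comp_add_const _ _ _
  refine ⟨fun s => h.sphere _, fun s => ?_, fun s => ?_, fun s => ?_⟩
  · rw [hd]; exact h.unitSpeed _
  · rw [hd]; exact (h.hasDerivAt (s + c)).comp_add_const s c
  · rw [hd]; exact (h.frenet (s + c)).comp_add_const s c

theorem hasDerivAt_normal (h : IsFrenet κ γ) (s : ℝ) :
    HasDerivAt (fun s => γ s ⨯₃ deriv γ s) (-κ s • deriv γ s) s := by
  have h1 := hasDerivAt_pi.1 (h.hasDerivAt s)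
  have h2 := hasDerivAt_pi.1 (h.frenet s)
  have hs := h.sphere s
  have ho := h.orth s
  simp only [dotProduct, Fin.sum_univ_three] at hs ho
  rw [hasDerivAt_pi]
  simp only [cross_apply] at h2 ⊢
  intro i
  fin_cases i
  · refine (((h1 1).mul (h2 2)).sub ((h1 2).mul (h2 1))).congr_deriv ?_
    simp
    linear_combination κ s * (γ s 0 * ho - deriv γ s 0 * hs)
  · refine (((h1 2).mul (h2 0)).sub ((h1 0).mul (h2 2))).congr_deriv ?_
    simp
    linear_combination κ s * (γ s 1 * ho - deriv γ s 1 * hs)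
  · refine (((h1 0).mul (h2 1)).sub ((h1 1).mul (h2 0))).congr_deriv ?_
    simp
    linear_combination κ s * (γ s 2 * ho - deriv γ s 2 * hs)

/-- Both frames satisfy `F' = F A` with the same skew-symmetric `A`, so the derivative of `F₁ F₂ᵀ`
vanishes. This gives the uniqueness of a curve with prescribed curvature and initial frame. -/
theorem frame_mul_transpose_const (h₁ : IsFrenet κ γ₁) (h₂ : IsFrenet κ γ₂) (s t : ℝ) :
    frame γ₁ s * (frame γ₂ s)ᵀ = frame γ₁ t * (frame γ₂ t)ᵀ := by
  ext i j
  have hd : ∀ s, HasDerivAt (fun s => (frame γ₁ s * (frame γ₂ s)ᵀ) i j) 0 s := by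
    intro s
    simp only [Matrix.mul_apply, Fin.sum_univ_three, frame, Matrix.transpose_apply,
      Matrix.of_apply, Matrix.cons_val_zero, Matrix.cons_val_one, Matrix.cons_val_two,
      Matrix.head_cons, Matrix.tail_cons]
    have a1 := hasDerivAt_pi.1 (h₁.hasDerivAt s) i
    have a2 := hasDerivAt_pi.1 (h₁.frenet s) i
    have a3 := hasDerivAt_pi.1 (h₁.hasDerivAt_normal s) i
    have b1 := hasDerivAt_pi.1 (h₂.hasDerivAt s) j
    have b2 := hasDerivAt_pi.1 (h₂.frenet s) j
    have b3 := hasDerivAt_pi.1 (h₂.hasDerivAt_normal s) j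
    refine (((a1.mul b1).add (a2.mul b2)).add (a3.mul b3)).congr_deriv ?_
    simp only [Pi.add_apply, Pi.neg_apply, Pi.smul_apply, smul_eq_mul]
    ring
  exact is_const_of_deriv_eq_zero (fun x => (hd x).differentiableAt) (fun x => (hd x).deriv) s t

/-- Two curves with the same curvature differ by a constant matrix. -/
theorem frame_eq (h₁ : IsFrenet κ γ₁) (h₂ : IsFrenet κ γ₂) (s t : ℝ) :
    frame γ₁ s = frame γ₁ t * (frame γ₂ t)ᵀ * frame γ₂ s := by
  rw [← h₁.frame_mul_transpose_const h₂ s t, Matrix.mul_assoc, h₂.frame_transpose_mul,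
    Matrix.mul_one]

theorem eq_mulVec (h₁ : IsFrenet κ γ₁) (h₂ : IsFrenet κ γ₂) (s t : ℝ) :
    γ₁ s = (frame γ₁ t * (frame γ₂ t)ᵀ) *ᵥ γ₂ s := by
  have h := h₁.frame_eq h₂ s t
  rw [frame_eq_columns γ₂ s, mulVec_columns] at h
  exact (columns_inj h).1

theorem eq_of_eq_at (h₁ : IsFrenet κ γ₁) (h₂ : IsFrenet κ γ₂) {t : ℝ} (h0 : γ₁ t = γ₂ t)
    (h1 : deriv γ₁ t = deriv γ₂ t) : γ₁ = γ₂ := by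
  ext1 s
  have hf : frame γ₁ t = frame γ₂ t := by simp only [frame, h0, h1]
  have := mul_eq_one_comm.1 (h₂.frame_transpose_mul t)
  rw [h₁.eq_mulVec h₂ s t, hf, this, Matrix.one_mulVec]

end IsFrenet

/-! ### The explicit curve -/

/-- The position vector of the explicit curve, where `u = 1 / μ`, `r = u'`, `v = μ + 2 lam`. -/
def positionVec (ξ u r v α : ℝ) : Fin 3 → ℝ :=
  ![u / (2 * ξ), -(v * Real.cos α + r * Real.sin α) / (2 * ξ),
    -(v * Real.sin α - r * Real.cos α) / (2 * ξ)]

/-- The velocity vector of the explicit curve. -/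
def velocityVec (ξ u r v α : ℝ) : Fin 3 → ℝ :=
  ![r / (2 * ξ),
    -(r * v / (2 * ξ + u) * Real.cos α - (u + v ^ 2 / (2 * ξ + u)) * Real.sin α) / (2 * ξ),
    -(r * v / (2 * ξ + u) * Real.sin α + (u + v ^ 2 / (2 * ξ + u)) * Real.cos α) / (2 * ξ)]

/-- The normal vector of the explicit curve. -/
def normalVec (ξ u r v α : ℝ) : Fin 3 → ℝ :=
  ![v / (2 * ξ),
    ((2 * ξ - v ^ 2 / (2 * ξ + u)) * Real.cos α - r * v / (2 * ξ + u) * Real.sin α) / (2 * ξ),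
    ((2 * ξ - v ^ 2 / (2 * ξ + u)) * Real.sin α + r * v / (2 * ξ + u) * Real.cos α) / (2 * ξ)]

theorem positionVec_dot_self {ξ u r v α : ℝ} (hξ : 0 < ξ)
    (he : u ^ 2 + r ^ 2 + v ^ 2 = 4 * ξ ^ 2) :
    positionVec ξ u r v α ⬝ᵥ positionVec ξ u r v α = 1 := by
  have ht := Real.sin_sq_add_cos_sq α
  simp only [positionVec, dotProduct, Fin.sum_univ_three, Matrix.cons_val]
  field_simp
  linear_combination he + (v ^ 2 + r ^ 2) * ht

theorem velocityVec_dot_self {ξ u r v α : ℝ} (hξ : 0 < ξ) (hu : 0 < u)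
    (he : u ^ 2 + r ^ 2 + v ^ 2 = 4 * ξ ^ 2) :
    velocityVec ξ u r v α ⬝ᵥ velocityVec ξ u r v α = 1 := by
  have ht := Real.sin_sq_add_cos_sq α
  have hD : (0 : ℝ) < 2 * ξ + u := by positivity
  have hv : v ^ 2 = 4 * ξ ^ 2 - u ^ 2 - r ^ 2 := by linarith
  have e1 : velocityVec ξ u r v α ⬝ᵥ velocityVec ξ u r v α =
      (r ^ 2 + (r * v / (2 * ξ + u)) ^ 2 + (u + v ^ 2 / (2 * ξ + u)) ^ 2) / (4 * ξ ^ 2) := by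
    simp only [velocityVec, dotProduct, Fin.sum_univ_three, Matrix.cons_val]
    generalize r * v / (2 * ξ + u) = A
    generalize u + v ^ 2 / (2 * ξ + u) = B
    field_simp
    linear_combination 4 * (A ^ 2 + B ^ 2) * ht
  rw [e1, mul_div_assoc, mul_pow, div_pow, hv]
  field_simp
  ring

theorem positionVec_cross_velocityVec {ξ u r v α : ℝ} (hξ : 0 < ξ) (hu : 0 < u)
    (he : u ^ 2 + r ^ 2 + v ^ 2 = 4 * ξ ^ 2) :
    positionVec ξ u r v α ⨯₃ velocityVec ξ u r v α = normalVec ξ u r v α := by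
  have ht := Real.sin_sq_add_cos_sq α
  have hD : (0 : ℝ) < 2 * ξ + u := by positivity
  have hA : r * v / (2 * ξ + u) * (2 * ξ + u) = r * v := by field_simp
  have hB : v ^ 2 / (2 * ξ + u) * (2 * ξ + u) = v ^ 2 := by field_simp
  have hAv : r * (r * v / (2 * ξ + u)) + v * (v ^ 2 / (2 * ξ + u)) = v * (2 * ξ - u) := by
    field_simp
    linear_combination v * he
  have hAr : r * (v ^ 2 / (2 * ξ + u)) = v * (r * v / (2 * ξ + u)) := by ring
  simp only [positionVec, velocityVec, normalVec, cross_apply, Matrix.cons_val]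
  generalize r * v / (2 * ξ + u) = A at *
  generalize v ^ 2 / (2 * ξ + u) = B at *
  ext i
  fin_cases i <;> simp only [Matrix.cons_val, Fin.zero_eta, Fin.mk_one, Fin.reduceFinMk]
  · field_simp
    linear_combination (r * A + v * (u + B)) * ht + hAv
  · field_simp
    linear_combination Real.cos α * he + Real.cos α * hB + Real.sin α * hA
  · field_simp
    linear_combination Real.sin α * he + Real.sin α * hB - Real.cos α * hA

theorem IsLeastPeriod.unique {α : Type*} {f : ℝ → α} {w w' : ℝ} (h : IsLeastPeriod f w)
    (h' : IsLeastPeriod f w') : w = w' := IsLeast.unique h h'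

/-- The explicit curve with `μ 0 = a`. -/
def curve (lam a b ξ s : ℝ) : Fin 3 → ℝ :=
  positionVec ξ (1 / mu a b s) (recipDot a b s) (mu a b s + 2 * lam) (rotAngle lam a b ξ s)

theorem rotX_mulVec (A x y z : ℝ) : rotX A *ᵥ ![x, y, z] =
    ![x, Real.cos A * y - Real.sin A * z, Real.sin A * y + Real.cos A * z] := by
  ext i
  fin_cases i <;> simp [rotX, Matrix.mulVec, dotProduct, Fin.sum_univ_three]
  ring

theorem rotX_add_two_pi_mul (A : ℝ) (n : ℤ) : rotX (A + n * (2 * Real.pi)) = rotX A := by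
  simp [rotX, Real.cos_add_int_mul_two_pi, Real.sin_add_int_mul_two_pi]

theorem positionVec_add (ξ u r v α A : ℝ) :
    positionVec ξ u r v (α + A) = rotX A *ᵥ positionVec ξ u r v α := by
  simp only [positionVec, rotX_mulVec, Real.cos_add, Real.sin_add]
  ext i
  fin_cases i <;> simp only [Matrix.cons_val, Fin.zero_eta, Fin.mk_one, Fin.reduceFinMk] <;> ring

theorem velocityVec_add (ξ u r v α A : ℝ) :
    velocityVec ξ u r v (α + A) = rotX A *ᵥ velocityVec ξ u r v α := by
  simp only [velocityVec, rotX_mulVec, Real.cos_add, Real.sin_add]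
  ext i
  fin_cases i <;> simp only [Matrix.cons_val, Fin.zero_eta, Fin.mk_one, Fin.reduceFinMk] <;> ring

theorem normalVec_add (ξ u r v α A : ℝ) :
    normalVec ξ u r v (α + A) = rotX A *ᵥ normalVec ξ u r v α := by
  simp only [normalVec, rotX_mulVec, Real.cos_add, Real.sin_add]
  ext i
  fin_cases i <;> simp only [Matrix.cons_val, Fin.zero_eta, Fin.mk_one, Fin.reduceFinMk] <;> ring

theorem contDiff_positionVec {ξ : ℝ} {u r v α : ℝ → ℝ} {n : WithTop ℕ∞}
    (hu : ContDiff ℝ n u) (hr : ContDiff ℝ n r) (hv : ContDiff ℝ n v) (hα : ContDiff ℝ n α) :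
    ContDiff ℝ n fun s => positionVec ξ (u s) (r s) (v s) (α s) := by
  have hc : ContDiff ℝ n fun s => Real.cos (α s) := Real.contDiff_cos.comp hα
  have hs : ContDiff ℝ n fun s => Real.sin (α s) := Real.contDiff_sin.comp hα
  rw [contDiff_pi]
  intro i
  fin_cases i
  · exact hu.div_const _
  · exact ((hv.mul hc).add (hr.mul hs)).neg.div_const _
  · exact ((hv.mul hs).sub (hr.mul hc)).neg.div_const _

namespace RootPair

variable {lam a b ξ : ℝ}

theorem hasDerivAt_add_two_mul (h : RootPair lam a b ξ) (s : ℝ) :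
    HasDerivAt (fun s => mu a b s + 2 * lam) (-(mu a b s ^ 2 * recipDot a b s)) s :=
  (h.hasDerivAt_mu s).add_const _

theorem hasDerivAt_curve (h : RootPair lam a b ξ) (s : ℝ) :
    HasDerivAt (curve lam a b ξ) (velocityVec ξ (1 / mu a b s) (recipDot a b s)
      (mu a b s + 2 * lam) (rotAngle lam a b ξ s)) s := by
  have hu := h.hasDerivAt_recip_mu s
  have hr := h.hasDerivAt_recipDot s
  have hv := h.hasDerivAt_add_two_mul s
  have hα := h.hasDerivAt_rotAngle s
  have hD := h.denom_pos s
  have he := h.energy s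
  have hξ := h.xi_pos
  -- The energy identity in the form `v² + r² = (2ξ - u)(2ξ + u)`.
  have e1 : 1 / mu a b s + (mu a b s + 2 * lam) ^ 2 / (2 * ξ + 1 / mu a b s) =
      2 * ξ - recipDot a b s ^ 2 / (2 * ξ + 1 / mu a b s) := by
    rw [eq_sub_iff_add_eq, add_assoc, ← add_div]
    rw [show (mu a b s + 2 * lam) ^ 2 + recipDot a b s ^ 2 =
      (2 * ξ - 1 / mu a b s) * (2 * ξ + 1 / mu a b s) by linear_combination he,
      mul_div_cancel_right₀ _ hD.ne']
    ring
  rw [hasDerivAt_pi]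
  intro i
  fin_cases i
  · exact hu.div_const _
  · refine (((hv.mul hα.cos).add (hr.mul hα.sin)).neg.div_const (2 * ξ)).congr_deriv ?_
    simp only [velocityVec, rotRate, Matrix.cons_val, Fin.mk_one]
    congr 1
    ring
  · refine (((hv.mul hα.sin).sub (hr.mul hα.cos)).neg.div_const (2 * ξ)).congr_deriv ?_
    simp only [velocityVec, rotRate, Matrix.cons_val, Fin.reduceFinMk]
    congr 1
    ring

theorem deriv_curve (h : RootPair lam a b ξ) : deriv (curve lam a b ξ) = fun s =>
    velocityVec ξ (1 / mu a b s) (recipDot a b s) (mu a b s + 2 * lam) (rotAngle lam a b ξ s) :=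
  funext fun s => (h.hasDerivAt_curve s).deriv

theorem hasDerivAt_velocityVec (h : RootPair lam a b ξ) (s : ℝ) :
    HasDerivAt (fun s => velocityVec ξ (1 / mu a b s) (recipDot a b s) (mu a b s + 2 * lam)
      (rotAngle lam a b ξ s)) (-curve lam a b ξ s + mu a b s ^ 2 • normalVec ξ (1 / mu a b s)
        (recipDot a b s) (mu a b s + 2 * lam) (rotAngle lam a b ξ s)) s := by
  have hu := h.hasDerivAt_recip_mu s
  have hr := h.hasDerivAt_recipDot s
  have hv := h.hasDerivAt_add_two_mul s
  have hα := h.hasDerivAt_rotAngle s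
  have hD := h.denom_pos s
  have he := h.energy s
  have hξ := h.xi_pos
  have hA := (hr.mul hv).div (hu.const_add (2 * ξ)) hD.ne'
  have hB := hu.add ((hv.fun_pow 2).div (hu.const_add (2 * ξ)) hD.ne')
  -- The components of the velocity in the plane orthogonal to `Ox`, read in the frame rotating by
  -- `α`, obey these two scalar identities. Only the first needs the energy identity.
  have eA : ∀ u r v m D : ℝ, D = 2 * ξ + u → 0 < D → u ^ 2 + r ^ 2 + v ^ 2 = 4 * ξ ^ 2 →
      -((((-u + m ^ 2 * v) * v + r * -(m ^ 2 * r)) * D - r * v * r) / D ^ 2) +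
        (m ^ 2 + v / D) * (u + v ^ 2 / D) = v + m ^ 2 * (2 * ξ - v ^ 2 / D) := by
    intro u r v m D h1 h2 h3
    have h4 : ξ = (D - u) / 2 := by linarith
    subst h4
    field_simp
    linear_combination (m ^ 2 * D + v) * h3
  have eB : ∀ u r v m D : ℝ, 0 < D →
      -(r + ((2 : ℕ) * v ^ (2 - 1) * -(m ^ 2 * r) * D - v ^ 2 * r) / D ^ 2) -
        (m ^ 2 + v / D) * (r * v / D) = -r + m ^ 2 * (r * v / D) := by
    intro u r v m D h2
    field_simp
    push_cast
    ring
  replace eA := eA _ _ _ (mu a b s) _ rfl hD he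
  replace eB := eB (1 / mu a b s) (recipDot a b s) (mu a b s + 2 * lam) (mu a b s) _ hD
  rw [hasDerivAt_pi]
  intro i
  fin_cases i
  · refine (hr.div_const (2 * ξ)).congr_deriv ?_
    simp [curve, positionVec, normalVec]
    ring
  · refine (((hA.mul hα.cos).sub (hB.mul hα.sin)).neg.div_const (2 * ξ)).congr_deriv ?_
    simp only [curve, positionVec, normalVec, rotRate, Matrix.cons_val, Fin.mk_one, Pi.add_apply,
      Pi.neg_apply, Pi.smul_apply, smul_eq_mul, Pi.mul_apply, Pi.div_apply]
    linear_combination Real.cos (rotAngle lam a b ξ s) / (2 * ξ) * eA -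
      Real.sin (rotAngle lam a b ξ s) / (2 * ξ) * eB
  · refine (((hA.mul hα.sin).add (hB.mul hα.cos)).neg.div_const (2 * ξ)).congr_deriv ?_
    simp only [curve, positionVec, normalVec, rotRate, Matrix.cons_val, Fin.reduceFinMk,
      Pi.add_apply, Pi.neg_apply, Pi.smul_apply, smul_eq_mul, Pi.mul_apply, Pi.div_apply]
    linear_combination Real.sin (rotAngle lam a b ξ s) / (2 * ξ) * eA +
      Real.cos (rotAngle lam a b ξ s) / (2 * ξ) * eB

theorem curve_cross_deriv (h : RootPair lam a b ξ) (s : ℝ) :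
    curve lam a b ξ s ⨯₃ deriv (curve lam a b ξ) s = normalVec ξ (1 / mu a b s)
      (recipDot a b s) (mu a b s + 2 * lam) (rotAngle lam a b ξ s) := by
  rw [h.deriv_curve]
  exact positionVec_cross_velocityVec h.xi_pos (one_div_pos.2 (h.mu_pos s)) (h.energy s)

theorem isFrenet_curve (h : RootPair lam a b ξ) :
    IsFrenet (fun s => mu a b s ^ 2) (curve lam a b ξ) := by
  refine ⟨fun s => positionVec_dot_self h.xi_pos (h.energy s), fun s => ?_, fun s => ?_,
    fun s => ?_⟩
  · rw [h.deriv_curve]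
    exact velocityVec_dot_self h.xi_pos (one_div_pos.2 (h.mu_pos s)) (h.energy s)
  · rw [h.deriv_curve]
    exact h.hasDerivAt_curve s
  · rw [h.curve_cross_deriv, h.deriv_curve]
    exact h.hasDerivAt_velocityVec s

theorem contDiff_curve (h : RootPair lam a b ξ) : ContDiff ℝ ∞ (curve lam a b ξ) :=
  contDiff_positionVec (contDiff_const.div h.contDiff_mu fun s => (h.mu_pos s).ne')
    h.contDiff_recipDot (h.contDiff_mu.add contDiff_const) h.contDiff_rotAngle

/-! ### Curves with the explicit curvature: least period, monodromy and closure -/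

theorem muInv_eq (h : RootPair lam a b ξ) {γ : ℝ → Fin 3 → ℝ} {c : ℝ}
    (hF : IsFrenet (fun s => mu a b (s + c) ^ 2) γ) : muInv γ = fun s => mu a b (s + c) := by
  ext s
  rw [muInv, hF.curvature_eq, Real.sqrt_sq (h.mu_pos _).le]

theorem isBCurveWithParams (h : RootPair lam a b ξ) {γ : ℝ → Fin 3 → ℝ} {c : ℝ}
    (hc : ContDiff ℝ 4 γ) (hF : IsFrenet (fun s => mu a b (s + c) ^ 2) γ) :
    IsBCurveWithParams lam a γ := by
  refine ⟨ξ, h.xi_pos, ⟨hc, hF.sphere, hF.unitSpeed, fun s => ?_, ?_, ?_, fun s => ?_⟩,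
    h.isGreatest⟩
  · rw [hF.curvature_eq]
    have := h.mu_pos (s + c)
    positivity
  · refine ⟨0 - c, period a b / 2 - c, ?_⟩
    rw [hF.curvature_eq]
    simp only [sub_add_cancel, h.mu_zero, h.mu_half_period]
    have := h.b_pos
    have := h.lt
    intro h2
    nlinarith
  · refine ⟨period a b, h.period_pos, fun s => ?_⟩
    rw [hF.curvature_eq]
    simp only
    rw [add_right_comm, h.mu_add_period]
  · rw [h.muInv_eq hF, ((h.hasDerivAt_mu (s + c)).comp_add_const s c).deriv]
    linear_combination mu a b (s + c) ^ 2 * h.recipDot_sq (s + c)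

/-- A period carries a maximum of `μ` to a maximum, and the maxima occur only where the angle is a
multiple of `2π`. -/
theorem isLeastPeriod_mu_sq (h : RootPair lam a b ξ) (c : ℝ) :
    IsLeastPeriod (fun s => mu a b (s + c) ^ 2) (period a b) := by
  refine ⟨⟨h.period_pos, fun s => ?_⟩, fun T hT => ?_⟩
  · simp only
    rw [add_right_comm, h.mu_add_period]
  · by_contra! hcon
    have h1 := hT.2 (0 - c)
    simp only [sub_add_cancel] at h1
    rw [show 0 - c + T + c = T by ring, h.mu_zero,
      sq_eq_sq₀ (h.mu_pos _).le h.a_pos.le, mu, muAngle] at h1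
    have h2 : Real.cos (angle a b T) = 1 := by
      have hne : (a - b) / 2 ≠ 0 := by have := h.lt; intro h0; linarith
      apply mul_left_cancel₀ hne
      linarith
    have h3 : 0 < angle a b T := by
      rw [← h.angle_zero]; exact h.angle_strictMono hT.1
    have h4 : angle a b T < 2 * Real.pi := by
      have := h.angle_strictMono hcon
      rwa [period, h.angle_time] at this
    rw [Real.cos_eq_one_iff_of_lt_of_lt (by linarith) h4] at h2
    linarith

theorem frame_curve_add_period (h : RootPair lam a b ξ) (s : ℝ) :
    frame (curve lam a b ξ) (s + period a b) =
      rotX (rotPeriod lam a b ξ) * frame (curve lam a b ξ) s := by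
  rw [frame_eq_columns, frame_eq_columns, h.curve_cross_deriv, h.curve_cross_deriv, h.deriv_curve,
    mulVec_columns, ← normalVec_add]
  simp only [curve]
  rw [← velocityVec_add, ← positionVec_add, h.mu_add_period, h.recipDot_add_period,
    h.rotAngle_add_period]

theorem hasMonodromy_curve (h : RootPair lam a b ξ) (c : ℝ) :
    HasMonodromy (fun s => curve lam a b ξ (s + c)) (rotX (rotPeriod lam a b ξ)) := by
  have hF := h.isFrenet_curve.comp_add_const c
  refine ⟨period a b, ?_, ?_⟩
  · rw [hF.curvature_eq]; exact h.isLeastPeriod_mu_sq c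
  · have hfr : ∀ s, frame (fun s => curve lam a b ξ (s + c)) s =
        frame (curve lam a b ξ) (s + c) := by
      intro s
      simp only [frame, deriv_comp_add_const]
    rw [hF.frame_inv, hfr, hfr, zero_add, add_comm (period a b) c, h.frame_curve_add_period,
      Matrix.mul_assoc, mul_eq_one_comm.1 (h.isFrenet_curve.frame_transpose_mul c), Matrix.mul_one]

theorem angle_nat_mul_period (h : RootPair lam a b ξ) (n : ℕ) :
    angle a b (n * period a b) = n * (2 * Real.pi) := by
  induction n with
  | zero => simp [h.angle_zero]
  | succ n ih =>
    push_cast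
    rw [add_mul, one_mul, h.angle_add_period, ih]
    ring

theorem add_nat_mul_period (h : RootPair lam a b ξ) (s : ℝ) (n : ℕ) :
    mu a b (s + n * period a b) = mu a b s ∧ recipDot a b (s + n * period a b) = recipDot a b s ∧
      rotAngle lam a b ξ (s + n * period a b) = rotAngle lam a b ξ s + n * rotPeriod lam a b ξ := by
  induction n with
  | zero => simp
  | succ n ih =>
    have e : s + ((n + 1 : ℕ) : ℝ) * period a b = s + n * period a b + period a b := by
      push_cast; ring
    rw [e, h.mu_add_period, h.recipDot_add_period, h.rotAngle_add_period]
    refine ⟨ih.1, ih.2.1, ?_⟩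
    rw [ih.2.2]
    push_cast
    ring

theorem recipDot_zero (h : RootPair lam a b ξ) : recipDot a b 0 = 0 := by
  simp [recipDot, h.angle_zero]

theorem curve_zero (h : RootPair lam a b ξ) :
    curve lam a b ξ 0 = ![1 / a / (2 * ξ), -(a + 2 * lam) / (2 * ξ), 0] := by
  simp [curve, positionVec, h.recipDot_zero, h.mu_zero, rotAngle_zero]

theorem deriv_curve_zero (h : RootPair lam a b ξ) :
    deriv (curve lam a b ξ) 0 = ![0, 0, -1] := by
  have he := h.energy 0
  have hD := h.denom_pos 0
  have hξ := h.xi_pos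
  rw [h.deriv_curve]
  simp only [velocityVec, h.recipDot_zero, rotAngle_zero, Real.cos_zero, Real.sin_zero] at he ⊢
  have e1 : 1 / mu a b 0 + (mu a b 0 + 2 * lam) ^ 2 / (2 * ξ + 1 / mu a b 0) = 2 * ξ := by
    rw [show (mu a b 0 + 2 * lam) ^ 2 = (2 * ξ - 1 / mu a b 0) * (2 * ξ + 1 / mu a b 0) by
      linear_combination he, mul_div_cancel_right₀ _ hD.ne']
    ring
  rw [e1]
  ext i
  fin_cases i <;> simp [hξ.ne']

/-- The first coordinate alone forces a period of the curve to carry `μ = a` to `μ = a`, hence to be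
a multiple `k` of the period of `μ`. There `r = 0` and `v = a + 2λ > 0`, so the second coordinate
gives `cos (k * rotPeriod) = 1`. Conversely, the denominator of the rational number serves as the
number of periods. -/
theorem isClosedCurve_curve_iff (h : RootPair lam a b ξ) :
    IsClosedCurve (curve lam a b ξ) ↔ ∃ q : ℚ, rotPeriod lam a b ξ = 2 * Real.pi * q := by
  have hξ := h.xi_pos
  constructor
  · rintro ⟨T, hT, hper⟩
    have h1 : curve lam a b ξ T = curve lam a b ξ 0 := by
      have := hper 0; rwa [zero_add] at this
    have h2 : mu a b T = a := by
      have := congrFun h1 0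
      simp only [curve, positionVec, Matrix.cons_val, h.mu_zero] at this
      have h3 := h.a_pos
      have h4 := h.mu_pos T
      field_simp at this
      exact this.symm
    have h3 : Real.cos (angle a b T) = 1 := by
      rw [mu, muAngle] at h2
      have hne : (a - b) / 2 ≠ 0 := by have := h.lt; intro h0; linarith
      apply mul_left_cancel₀ hne
      linarith
    obtain ⟨n, hn⟩ := (Real.cos_eq_one_iff _).1 h3
    have h4 : 0 < angle a b T := by
      rw [← h.angle_zero]; exact h.angle_strictMono hT
    have hn0 : 0 < n := by
      rw [← hn] at h4
      have := pos_of_mul_pos_left h4 (by positivity)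
      exact_mod_cast this
    obtain ⟨k, rfl⟩ := Int.eq_ofNat_of_zero_le hn0.le
    have h5 : T = k * period a b := by
      apply h.angle_strictMono.injective
      rw [h.angle_nat_mul_period, ← hn]
      norm_cast
    obtain ⟨e1, e2, e3⟩ := h.add_nat_mul_period 0 k
    rw [zero_add] at e1 e2 e3
    have h6 := congrFun h1 1
    rw [h5] at h6
    simp only [curve, positionVec, Matrix.cons_val, e1, e2, e3, h.mu_zero, h.recipDot_zero,
      rotAngle_zero, Real.cos_zero, Real.sin_zero] at h6
    have h7 := h.add_two_mul_pos
    have h8 : Real.cos (k * rotPeriod lam a b ξ) = 1 := by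
      field_simp at h6
      simp only [zero_add, zero_mul, add_zero] at h6
      apply mul_left_cancel₀ h7.ne'
      linarith
    obtain ⟨m, hm⟩ := (Real.cos_eq_one_iff _).1 h8
    refine ⟨(m : ℚ) / k, ?_⟩
    have hk : (0 : ℝ) < k := by exact_mod_cast hn0
    push_cast
    field_simp
    linarith
  · rintro ⟨q, hq⟩
    refine ⟨q.den * period a b, mul_pos (by exact_mod_cast q.den_pos) h.period_pos, fun s => ?_⟩
    obtain ⟨e1, e2, e3⟩ := h.add_nat_mul_period s q.den
    have h1 : (q.den : ℝ) * rotPeriod lam a b ξ = q.num * (2 * Real.pi) := by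
      have hd : (q.den : ℝ) ≠ 0 := by exact_mod_cast q.den_ne_zero
      rw [hq]
      have : (q : ℝ) = q.num / q.den := by exact_mod_cast (Rat.num_div_den q).symm
      rw [this]
      field_simp
    rw [curve, e1, e2, e3, h1, curve]
    simp only [positionVec, Real.cos_add_int_mul_two_pi, Real.sin_add_int_mul_two_pi]

end RootPair

/-! ### Reversal of the monodromy -/

/-- The half-turn about the `Oy`-axis. -/
def halfTurn (x : Fin 3 → ℝ) : Fin 3 → ℝ := ![-x 0, x 1, -x 2]

theorem hasDerivAt_halfTurn {γ : ℝ → Fin 3 → ℝ} {T : Fin 3 → ℝ} {s : ℝ} (h : HasDerivAt γ T s) :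
    HasDerivAt (fun s => halfTurn (γ s)) (halfTurn T) s := by
  rw [hasDerivAt_pi] at h ⊢
  intro i
  fin_cases i
  · exact (h 0).neg
  · exact h 1
  · exact (h 2).neg

theorem halfTurn_cross (x y : Fin 3 → ℝ) : halfTurn x ⨯₃ halfTurn y = halfTurn (x ⨯₃ y) := by
  simp only [halfTurn, cross_apply]
  ext i
  fin_cases i <;> simp <;> ring

theorem halfTurn_dot (x y : Fin 3 → ℝ) : halfTurn x ⬝ᵥ halfTurn y = x ⬝ᵥ y := by
  simp [halfTurn, dotProduct, Fin.sum_univ_three]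

theorem halfTurn_eq_mulVec (x : Fin 3 → ℝ) : halfTurn x = !![-1, 0, 0; 0, 1, 0; 0, 0, -1] *ᵥ x := by
  ext i
  fin_cases i <;> simp [halfTurn, Matrix.mulVec, dotProduct, Fin.sum_univ_three]

namespace IsFrenet

variable {κ : ℝ → ℝ} {γ : ℝ → Fin 3 → ℝ}

theorem deriv_halfTurn (h : IsFrenet κ γ) :
    deriv (fun s => halfTurn (γ s)) = fun s => halfTurn (deriv γ s) :=
  funext fun s => (hasDerivAt_halfTurn (h.hasDerivAt s)).deriv

theorem comp_halfTurn (h : IsFrenet κ γ) : IsFrenet κ fun s => halfTurn (γ s) := by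
  have hd := h.deriv_halfTurn
  refine ⟨fun s => ?_, fun s => ?_, fun s => ?_, fun s => ?_⟩
  · rw [halfTurn_dot]; exact h.sphere s
  · rw [hd, halfTurn_dot]; exact h.unitSpeed s
  · rw [hd]; exact hasDerivAt_halfTurn (h.hasDerivAt s)
  · rw [hd, halfTurn_cross]
    refine (hasDerivAt_halfTurn (h.frenet s)).congr_deriv ?_
    simp only [halfTurn_eq_mulVec, Matrix.mulVec_add, Matrix.mulVec_neg, Matrix.mulVec_smul]

theorem frame_halfTurn (h : IsFrenet κ γ) (s : ℝ) : frame (fun s => halfTurn (γ s)) s =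
    !![-1, 0, 0; 0, 1, 0; 0, 0, -1] * frame γ s := by
  rw [frame_eq_columns, frame_eq_columns, mulVec_columns, h.deriv_halfTurn, halfTurn_cross]
  simp only [halfTurn_eq_mulVec]

/-- The monodromy is conjugated by the half-turn, which reverses the `Ox`-axis and so reverses the
sense of rotation about it, while the curvature is unchanged. -/
theorem hasMonodromy_halfTurn (h : IsFrenet κ γ) {A : ℝ} (hM : HasMonodromy γ (rotX A)) :
    HasMonodromy (fun s => halfTurn (γ s)) (rotX (-A)) := by
  obtain ⟨w, hw, hA⟩ := hM
  refine ⟨w, ?_, ?_⟩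
  · rw [h.comp_halfTurn.curvature_eq, ← h.curvature_eq]; exact hw
  · rw [h.comp_halfTurn.frame_inv, h.frame_halfTurn, h.frame_halfTurn, Matrix.transpose_mul,
      Matrix.mul_assoc, ← Matrix.mul_assoc (frame γ w), ← h.frame_inv, hA]
    ext i j
    fin_cases i <;> fin_cases j <;>
      simp [rotX, Matrix.mul_apply, Fin.sum_univ_three, Matrix.vecMul, dotProduct]

end IsFrenet

theorem contDiff_halfTurn {γ : ℝ → Fin 3 → ℝ} {n : WithTop ℕ∞} (h : ContDiff ℝ n γ) :
    ContDiff ℝ n fun s => halfTurn (γ s) := by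
  rw [contDiff_pi] at h ⊢
  intro i
  fin_cases i
  · exact (h 0).neg
  · exact h 1
  · exact (h 2).neg

theorem IsClosedCurve.halfTurn {γ : ℝ → Fin 3 → ℝ} (h : IsClosedCurve γ) :
    IsClosedCurve fun s => halfTurn (γ s) := by
  obtain ⟨T, hT, hp⟩ := h
  exact ⟨T, hT, fun s => by simp only [hp s]⟩

/-! ### Uniqueness of the `μ`-invariant -/

theorem RootPair.b_eq {lam a b b' ξ : ℝ} (h : RootPair lam a b ξ) (h' : RootPair lam a b' ξ) :
    b = b' := by
  have h1 : quartic lam ξ b' = 0 := by simp [h'.quartic_eq]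
  rcases h.eq_or_eq_of_quartic_eq_zero h'.b_pos h1 with h2 | h2
  · exact absurd h2 h'.lt.ne
  · exact h2.symm

theorem RootPair.b_lt_eta {lam a b ξ : ℝ} (h : RootPair lam a b ξ) : b < eta lam := by
  have h1 := rootPair_smallRoot h.eta_lt
  rw [h.xi_eq] at h1
  rw [h.b_eq h1, ← root_zero]
  exact root_strictMono lam (neg_lt_zero.2 (rootParam_pos h.eta_lt))

/-- The force in the equation `u'' = f u` of `u = 1 / μ`. -/
def force (lam x : ℝ) : ℝ := -x + (1 / x) ^ 2 * (1 / x + 2 * lam)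

/-- The only equilibrium of the second-order equation is `μ = η`, and `b < η < a`. -/
theorem RootPair.force_ne_zero {lam a b ξ : ℝ} (h : RootPair lam a b ξ) :
    force lam (1 / a) ≠ 0 ∧ force lam (1 / b) ≠ 0 := by
  have key : ∀ t : ℝ, 0 < t → t ≠ eta lam → force lam (1 / t) ≠ 0 := by
    intro t ht hne h0
    apply hne
    apply eq_eta ht
    unfold force at h0
    field_simp at h0
    linear_combination h0
  exact ⟨key a h.a_pos h.eta_lt.ne', key b h.b_pos h.b_lt_eta.ne⟩

theorem exists_lipschitzOnWith_force (lam : ℝ) {x y : ℝ} (hx : 0 < x) :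
    ∃ K, LipschitzOnWith K (force lam) (Set.Icc x y) := by
  set f' : ℝ → ℝ := fun t => -1 - 3 / t ^ 4 - 4 * lam / t ^ 3 with hf'
  have hd : ∀ t ∈ Set.Icc x y, HasDerivAt (force lam) (f' t) t := by
    intro t ht
    have ht0 : 0 < t := hx.trans_le ht.1
    have h1 := (hasDerivAt_inv ht0.ne')
    have h2 := (hasDerivAt_id t).neg.add ((h1.fun_pow 2).mul (h1.add_const (2 * lam)))
    have e : force lam = fun t => -t + t⁻¹ ^ 2 * (t⁻¹ + 2 * lam) := by
      ext t; simp [force]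
    rw [e]
    refine h2.congr_deriv ?_
    simp only [hf']
    norm_num
    field_simp
    ring
  have hc : ContinuousOn f' (Set.Icc x y) := by
    have hne : ∀ t ∈ Set.Icc x y, t ≠ 0 := fun t ht => (hx.trans_le ht.1).ne'
    refine (continuousOn_const.sub (continuousOn_const.div (by fun_prop) ?_)).sub
      (continuousOn_const.div (by fun_prop) ?_)
    · exact fun t ht => pow_ne_zero _ (hne t ht)
    · exact fun t ht => pow_ne_zero _ (hne t ht)
  obtain ⟨C, hC⟩ := isCompact_Icc.exists_bound_of_continuousOn hc
  refine ⟨C.toNNReal, (convex_Icc x y).lipschitzOnWith_of_nnnorm_hasDerivWithin_le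
    (fun t ht => (hd t ht).hasDerivWithinAt) fun t ht => ?_⟩
  rw [← NNReal.coe_le_coe, coe_nnnorm]
  exact (hC t ht).trans (Real.le_coe_toNNReal C)

/-- Uniqueness for the second order equation `u'' = f u` among solutions with bounded positive
values. -/
theorem eq_of_force {lam x y : ℝ} (hx : 0 < x) {u r u' r' : ℝ → ℝ}
    (hu : ∀ s, HasDerivAt u (r s) s) (hr : ∀ s, HasDerivAt r (force lam (u s)) s)
    (hm : ∀ s, u s ∈ Set.Icc x y)
    (hu' : ∀ s, HasDerivAt u' (r' s) s) (hr' : ∀ s, HasDerivAt r' (force lam (u' s)) s)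
    (hm' : ∀ s, u' s ∈ Set.Icc x y)
    {t : ℝ} (h0 : u t = u' t) (h1 : r t = r' t) : u = u' := by
  obtain ⟨K, hK⟩ := exists_lipschitzOnWith_force lam (y := y) hx
  have hV : LipschitzOnWith (max 1 (K * 1)) (fun z : ℝ × ℝ => (z.2, force lam z.1))
      {z : ℝ × ℝ | z.1 ∈ Set.Icc x y} :=
    LipschitzWith.prod_snd.lipschitzOnWith.prodMk
      (hK.comp LipschitzWith.prod_fst.lipschitzOnWith fun z hz => hz)
  have := ODE_solution_unique_univ (v := fun _ z => (z.2, force lam z.1))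
    (s := fun _ => {z : ℝ × ℝ | z.1 ∈ Set.Icc x y}) (f := fun s => (u s, r s))
    (g := fun s => (u' s, r' s)) (t₀ := t) (fun _ => hV)
    (fun s => ⟨(hu s).prodMk (hr s), hm s⟩) (fun s => ⟨(hu' s).prodMk (hr' s), hm' s⟩)
    (by simp only [h0, h1])
  ext s
  exact congrArg Prod.fst (congrFun this s)

namespace IsBCurveWithConst

variable {lam ξ : ℝ} {γ : ℝ → Fin 3 → ℝ}

theorem isFrenet (h : IsBCurveWithConst lam ξ γ) : IsFrenet (curvature γ) γ :=
  isFrenet_of_contDiff (h.contDiff.of_le (by norm_num)) h.sphere h.unitSpeed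

theorem contDiff_curvature (h : IsBCurveWithConst lam ξ γ) : ContDiff ℝ 2 (curvature γ) := by
  have h4 := h.contDiff
  rw [show (4 : WithTop ℕ∞) = 3 + 1 by norm_num, contDiff_succ_iff_deriv] at h4
  have h3 := h4.2.2
  have h2 := h3
  rw [show (3 : WithTop ℕ∞) = 2 + 1 by norm_num, contDiff_succ_iff_deriv] at h2
  have hγ := contDiff_pi.1 (h.contDiff.of_le (by norm_num : (2 : WithTop ℕ∞) ≤ 4))
  have hd := contDiff_pi.1 (h3.of_le (by norm_num : (2 : WithTop ℕ∞) ≤ 3))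
  have hdd := contDiff_pi.1 h2.2.2
  unfold curvature
  simp only [dotProduct, Fin.sum_univ_three, cross_apply, Matrix.cons_val]
  exact (((hdd 0).mul (((hγ 1).mul (hd 2)).sub ((hγ 2).mul (hd 1)))).add
    ((hdd 1).mul (((hγ 2).mul (hd 0)).sub ((hγ 0).mul (hd 2))))).add
    ((hdd 2).mul (((hγ 0).mul (hd 1)).sub ((hγ 1).mul (hd 0))))

theorem muInv_pos (h : IsBCurveWithConst lam ξ γ) (s : ℝ) : 0 < muInv γ s :=
  Real.sqrt_pos.2 (h.convex s)

theorem muInv_sq (h : IsBCurveWithConst lam ξ γ) (s : ℝ) : muInv γ s ^ 2 = curvature γ s :=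
  Real.sq_sqrt (h.convex s).le

theorem contDiff_muInv (h : IsBCurveWithConst lam ξ γ) : ContDiff ℝ 2 (muInv γ) :=
  h.contDiff_curvature.sqrt fun s => (h.convex s).ne'

theorem differentiable_muInv (h : IsBCurveWithConst lam ξ γ) : Differentiable ℝ (muInv γ) :=
  h.contDiff_muInv.differentiable two_ne_zero

theorem quartic_nonpos (h : IsBCurveWithConst lam ξ γ) (s : ℝ) :
    quartic lam ξ (muInv γ s) ≤ 0 := by
  have h1 := h.ode s
  have h2 := h.muInv_pos s
  by_contra! hcon
  have : 0 < muInv γ s ^ 2 * quartic lam ξ (muInv γ s) := by positivity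
  nlinarith [sq_nonneg (deriv (muInv γ) s)]

theorem exists_quartic_neg (h : IsBCurveWithConst lam ξ γ) :
    ∃ s, quartic lam ξ (muInv γ s) < 0 := by
  by_contra! hcon
  have h0 : ∀ s, deriv (muInv γ) s = 0 := by
    intro s
    have h1 := h.ode s
    rw [le_antisymm (h.quartic_nonpos s) (hcon s)] at h1
    simpa using h1
  obtain ⟨s, t, hst⟩ := h.nonconst
  apply hst
  rw [← h.muInv_sq, ← h.muInv_sq, is_const_of_deriv_eq_zero h.differentiable_muInv h0 s t]

/-- `Q` is `1` at `0`, negative at some value of `μ` because `μ` is not constant, and nonnegative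
far out. The intermediate value theorem gives roots on both sides of that value, and the greatest
root lies beyond the right-hand one. -/
theorem exists_rootPair (h : IsBCurveWithConst lam ξ γ) (hξ : 0 < ξ) {e : ℝ}
    (he : IsGreatest {t : ℝ | quartic lam ξ t = 0} e) : ∃ b, RootPair lam e b ξ := by
  obtain ⟨s, hs⟩ := h.exists_quartic_neg
  have ht := h.muInv_pos s
  set t := muInv γ s
  have hcont : Continuous (quartic lam ξ) := by unfold quartic; fun_prop
  have eq_of : ∀ x, quartic lam ξ x = 0 → 4 * ξ ^ 2 * x ^ 2 = 1 + x ^ 2 * (x + 2 * lam) ^ 2 := by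
    intro x hx
    unfold quartic at hx
    linear_combination -hx
  obtain ⟨b, hb, hb0⟩ : ∃ b ∈ Set.Icc 0 t, quartic lam ξ b = 0 :=
    intermediate_value_Icc' ht.le hcont.continuousOn ⟨hs.le, by simp [quartic]⟩
  have hl := neg_abs_le lam
  have hl0 := abs_nonneg lam
  -- Chosen so that `M + 2λ ≥ 2ξ`, which makes `M²((M + 2λ)² - 4ξ²) + 1` nonnegative.
  set M := t + 2 * ξ + 2 * |lam| with hM
  have hM0 : 0 ≤ quartic lam ξ M := by
    have h1 : quartic lam ξ M = M ^ 2 * ((M + 2 * lam - 2 * ξ) * (M + 2 * lam + 2 * ξ)) + 1 := by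
      unfold quartic; ring
    have h2 : 0 ≤ M + 2 * lam - 2 * ξ := by linarith
    have h3 : 0 ≤ M + 2 * lam + 2 * ξ := by linarith
    rw [h1]
    positivity
  obtain ⟨c, hc, hc0⟩ : ∃ c ∈ Set.Icc t M, quartic lam ξ c = 0 :=
    intermediate_value_Icc (by linarith) hcont.continuousOn ⟨hs.le, hM0⟩
  have hce : c ≤ e := he.2 hc0
  have hbt : b ≠ t := fun hbt => by rw [hbt] at hb0; exact hs.ne hb0
  have hb00 : b ≠ 0 := fun hb1 => by rw [hb1] at hb0; simp [quartic] at hb0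
  have hblt : b < t := lt_of_le_of_ne hb.2 hbt
  exact ⟨b, lt_of_le_of_ne hb.1 hb00.symm, hblt.trans_le (hc.1.trans hce), hξ, eq_of e he.1,
    eq_of b hb0⟩

variable {a b : ℝ}

theorem muInv_mem (h : IsBCurveWithConst lam ξ γ) (hp : RootPair lam a b ξ) (s : ℝ) :
    b ≤ muInv γ s ∧ muInv γ s ≤ a :=
  hp.mem_Icc_of_quartic_nonpos (h.muInv_pos s) (h.quartic_nonpos s)

/-- A maximum exists by periodicity, and there `Q(μ) = 0`. The value cannot be `b`, since `μ ≥ b`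
everywhere would then make `μ` constant. -/
theorem exists_muInv_eq (h : IsBCurveWithConst lam ξ γ) (hp : RootPair lam a b ξ) :
    ∃ s, muInv γ s = a ∧ deriv (muInv γ) s = 0 := by
  obtain ⟨T, hT, hper⟩ := h.periodic
  have hperm : Function.Periodic (muInv γ) T := fun s => by simp only [muInv, hper s]
  obtain ⟨s, -, hs⟩ := isCompact_Icc.exists_isMaxOn (Set.nonempty_Icc.2 hT.le)
    h.contDiff_muInv.continuous.continuousOn (s := Set.Icc 0 T)
  have hmax : ∀ t, muInv γ t ≤ muInv γ s := by
    intro t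
    obtain ⟨t', ht', htt⟩ := hperm.exists_mem_Ico₀ hT t
    rw [htt]
    exact hs ⟨ht'.1, ht'.2.le⟩
  have hd : deriv (muInv γ) s = 0 :=
    IsLocalMax.deriv_eq_zero (Eventually.of_forall hmax)
  refine ⟨s, ?_, hd⟩
  have h1 := h.ode s
  have hpos := h.muInv_pos s
  rw [hd] at h1
  have hq : quartic lam ξ (muInv γ s) = 0 := by
    have : muInv γ s ^ 2 * quartic lam ξ (muInv γ s) = 0 := by linarith
    exact (mul_eq_zero.1 this).resolve_left (by positivity)
  rcases hp.eq_or_eq_of_quartic_eq_zero hpos hq with h2 | h2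
  · exact h2
  · exfalso
    obtain ⟨t, ht⟩ := h.exists_quartic_neg
    have h3 := hmax t
    rw [h2] at h3
    have h4 := le_antisymm h3 (h.muInv_mem hp t).1
    rw [h4, hp.quartic_eq] at ht
    simp at ht

/-- The first-order equation alone would allow `μ` to rest at a turning point for a while. The `C⁴`
assumption excludes this: it makes `u''` continuous, and resting would mean a jump from `f(u)` to
`0`, with `f(u) ≠ 0` at both turning values. -/
theorem hasDerivAt_deriv_recip (h : IsBCurveWithConst lam ξ γ) (hp : RootPair lam a b ξ) (s : ℝ) :
    HasDerivAt (deriv fun s => 1 / muInv γ s) (force lam (1 / muInv γ s)) s := by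
  set u : ℝ → ℝ := fun s => 1 / muInv γ s with hu
  have hpos := h.muInv_pos
  have huC : ContDiff ℝ 2 u := contDiff_const.div h.contDiff_muInv fun s => (hpos s).ne'
  have hud : ∀ s, HasDerivAt u (deriv u s) s := fun s =>
    (huC.differentiable two_ne_zero s).hasDerivAt
  have hrC : ContDiff ℝ 1 (deriv u) := by
    rw [show (2 : WithTop ℕ∞) = 1 + 1 by norm_num, contDiff_succ_iff_deriv] at huC
    exact huC.2.2
  have hrd : ∀ s, HasDerivAt (deriv u) (deriv (deriv u) s) s := fun s =>
    (hrC.differentiable one_ne_zero s).hasDerivAt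
  have hrr : Continuous (deriv (deriv u)) := hrC.continuous_deriv le_rfl
  have hmud : ∀ s, HasDerivAt (muInv γ) (-(muInv γ s ^ 2 * deriv u s)) s := by
    intro s
    have h1 := (h.differentiable_muInv s).hasDerivAt
    have h2 := h1.fun_inv (hpos s).ne'
    have h3 : deriv u s = -deriv (muInv γ) s / muInv γ s ^ 2 := by
      simp only [hu, one_div]; exact h2.deriv
    refine h1.congr_deriv ?_
    have := hpos s
    rw [h3]
    field_simp
  have henergy : ∀ s, u s ^ 2 + deriv u s ^ 2 + (muInv γ s + 2 * lam) ^ 2 = 4 * ξ ^ 2 := by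
    intro s
    have h1 := h.ode s
    have h2 := hpos s
    rw [(hmud s).deriv, quartic] at h1
    have h3 : deriv u s ^ 2 = -(muInv γ s ^ 4 + 4 * lam * muInv γ s ^ 3 +
        4 * (lam ^ 2 - ξ ^ 2) * muInv γ s ^ 2 + 1) / muInv γ s ^ 2 := by
      field_simp
      apply mul_left_cancel₀ (pow_ne_zero 2 h2.ne')
      linear_combination h1
    rw [h3]
    simp only [hu]
    field_simp
    ring
  -- The defect of the second-order equation; differentiating the energy identity gives `u' w = 0`.
  set w : ℝ → ℝ := fun s => deriv (deriv u) s - force lam (u s) with hw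
  have hforce : ∀ s, force lam (u s) = -u s + muInv γ s ^ 2 * (muInv γ s + 2 * lam) := by
    intro s
    simp [force, hu]
  have hrw : ∀ s, deriv u s * w s = 0 := by
    intro s
    have h1 := (((hud s).fun_pow 2).add ((hrd s).fun_pow 2)).add
      (((hmud s).add_const (2 * lam)).fun_pow 2)
    have h2 : HasDerivAt (fun s => u s ^ 2 + deriv u s ^ 2 + (muInv γ s + 2 * lam) ^ 2) 0 s := by
      simp only [henergy]; exact hasDerivAt_const _ _
    have h3 := h1.unique h2
    simp only [hw, hforce]
    norm_num at h3
    linear_combination h3 / 2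
  have hwc : Continuous w := by
    simp only [hw, hforce]
    have := h.contDiff_muInv.continuous
    have := huC.continuous
    fun_prop
  obtain ⟨fa, fb⟩ := hp.force_ne_zero
  -- Where `w ≠ 0`, `u'` vanishes on a neighbourhood, so `u'' = 0` and `μ` is a root of `Q`; only
  -- two nonzero values of `w` remain.
  have hval : ∀ s, w s ≠ 0 → w s = -force lam (1 / a) ∨ w s = -force lam (1 / b) := by
    intro s hs
    have hev : ∀ᶠ t in 𝓝 s, deriv u t = 0 := by
      filter_upwards [hwc.continuousAt.eventually_ne hs] with t ht
      exact (mul_eq_zero.1 (hrw t)).resolve_right ht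
    have hdd : deriv (deriv u) s = 0 := by
      have : deriv u =ᶠ[𝓝 s] fun _ => 0 := hev
      rw [this.deriv_eq]; simp
    have hq : quartic lam ξ (muInv γ s) = 0 := by
      have h1 := h.ode s
      rw [(hmud s).deriv, hev.self_of_nhds] at h1
      have h2 := hpos s
      have : muInv γ s ^ 2 * quartic lam ξ (muInv γ s) = 0 := by linarith
      exact (mul_eq_zero.1 this).resolve_left (by positivity)
    simp only [hw, hdd, zero_sub]
    rcases hp.eq_or_eq_of_quartic_eq_zero (hpos s) hq with h2 | h2
    · left; simp only [hu, h2]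
    · right; simp only [hu, h2]
  -- The values of `w` lie in a finite set, so its zero set is clopen in the line. If that set were
  -- empty, `u'` would vanish identically and `μ` would be constant.
  have hclopen : IsClopen {s | w s = 0} := by
    refine ⟨isClosed_eq hwc continuous_const, ?_⟩
    have : {s | w s = 0} = {s | w s = -force lam (1 / a) ∨ w s = -force lam (1 / b)}ᶜ := by
      ext s
      simp only [Set.mem_ofPred_eq, Set.mem_compl_iff, not_or]
      constructor
      · intro h0
        rw [h0]
        exact ⟨fun h1 => fa (by linarith), fun h1 => fb (by linarith)⟩
      · intro h0
        by_contra hne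
        exact (hval s hne).elim h0.1 h0.2
    rw [this]
    exact ((isClosed_eq hwc continuous_const).union
      (isClosed_eq hwc continuous_const)).isOpen_compl
  have hall : ∀ s, w s = 0 := by
    rcases isClopen_iff.1 hclopen with h1 | h1
    · exfalso
      have h0 : ∀ s, deriv u s = 0 := by
        intro s
        refine (mul_eq_zero.1 (hrw s)).resolve_right fun h2 => ?_
        have : s ∈ {s | w s = 0} := h2
        rw [h1] at this
        exact this
      obtain ⟨s, hs⟩ := h.exists_quartic_neg
      have h2 := h.ode s
      rw [(hmud s).deriv, h0 s] at h2
      have h3 := hpos s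
      have : muInv γ s ^ 2 * quartic lam ξ (muInv γ s) < 0 :=
        mul_neg_of_pos_of_neg (by positivity) hs
      linarith
    · intro s
      have : s ∈ {s | w s = 0} := by rw [h1]; trivial
      exact this
  refine (hrd s).congr_deriv ?_
  have := hall s
  simp only [hw] at this
  linarith

/-- The `μ`-invariant is the explicit one, up to a shift. -/
theorem muInv_eq_mu (h : IsBCurveWithConst lam ξ γ) (hp : RootPair lam a b ξ) {s₀ : ℝ}
    (h0 : muInv γ s₀ = a) : muInv γ = fun s => mu a b (s + -s₀) := by
  have hpos := h.muInv_pos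
  have hd : deriv (muInv γ) s₀ = 0 := by
    have h1 := h.ode s₀
    rw [h0, hp.quartic_eq] at h1
    simpa using h1
  have huC : ContDiff ℝ 2 fun s => 1 / muInv γ s :=
    contDiff_const.div h.contDiff_muInv fun s => (hpos s).ne'
  have hmem : ∀ t, b ≤ t ∧ t ≤ a → 1 / t ∈ Set.Icc (1 / a) (1 / b) := fun t ht =>
    ⟨one_div_le_one_div_of_le (hp.b_pos.trans_le ht.1) ht.2,
      one_div_le_one_div_of_le hp.b_pos ht.1⟩
  have := eq_of_force (lam := lam) (x := 1 / a) (y := 1 / b) (t := s₀)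
    (one_div_pos.2 hp.a_pos)
    (u := fun s => 1 / muInv γ s) (r := deriv fun s => 1 / muInv γ s)
    (u' := fun s => 1 / mu a b (s + -s₀)) (r' := fun s => recipDot a b (s + -s₀))
    (fun s => (huC.differentiable two_ne_zero s).hasDerivAt)
    (h.hasDerivAt_deriv_recip hp) (fun s => hmem _ (h.muInv_mem hp s))
    (fun s => (hp.hasDerivAt_recip_mu (s + -s₀)).comp_add_const s (-s₀))
    (fun s => by
      refine ((hp.hasDerivAt_recipDot (s + -s₀)).comp_add_const s (-s₀)).congr_deriv ?_
      simp [force])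
    (fun s => hmem _ (hp.mu_mem _))
    (by simp only [add_neg_cancel, h0, hp.mu_zero])
    (by
      have h2 := ((h.differentiable_muInv s₀).hasDerivAt).fun_inv (hpos s₀).ne'
      simp only [one_div, h2.deriv, hd, add_neg_cancel, hp.recipDot_zero]
      simp)
  ext s
  have h3 := congrFun this s
  simp only [one_div, _root_.inv_inj] at h3
  exact h3

theorem isFrenet_mu (h : IsBCurveWithConst lam ξ γ) (hp : RootPair lam a b ξ) {s₀ : ℝ}
    (h0 : muInv γ s₀ = a) : IsFrenet (fun s => mu a b (s + -s₀) ^ 2) γ := by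
  have h1 := h.isFrenet
  have h2 : curvature γ = fun s => mu a b (s + -s₀) ^ 2 := by
    ext s
    rw [← h.muInv_sq, h.muInv_eq_mu hp h0]
  rwa [h2] at h1

end IsBCurveWithConst

/-! ### Standard and general B-curves -/

theorem IsBCurveWithParams.exists_const {lam e : ℝ} {γ : ℝ → Fin 3 → ℝ}
    (h : IsBCurveWithParams lam e γ) : eta lam < e ∧ IsBCurveWithConst lam (xi lam e) γ := by
  obtain ⟨ξ, hξ, hB, he⟩ := h
  obtain ⟨b, hp⟩ := hB.exists_rootPair hξ he
  rw [hp.xi_eq]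
  exact ⟨hp.eta_lt, hB⟩

/-- The standard B-curve. -/
def stdCurve (lam e : ℝ) : ℝ → Fin 3 → ℝ := fun s =>
  curve lam e (smallRoot lam e) (xi lam e) (s + -(period e (smallRoot lam e) / 2))

/-- The least period of the curvature of the standard B-curve. -/
def stdPeriod (lam e : ℝ) : ℝ := period e (smallRoot lam e)

/-- The angle of the rotation which relates successive periods of a standard B-curve. -/
def stdRotPeriod (lam e : ℝ) : ℝ := rotPeriod lam e (smallRoot lam e) (xi lam e)

theorem isFrenet_stdCurve {lam e : ℝ} (he : eta lam < e) :
    IsFrenet (fun s => mu e (smallRoot lam e) (s + -(period e (smallRoot lam e) / 2)) ^ 2)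
      (stdCurve lam e) :=
  (rootPair_smallRoot he).isFrenet_curve.comp_add_const _

theorem contDiff_stdCurve {lam e : ℝ} (he : eta lam < e) : ContDiff ℝ 4 (stdCurve lam e) :=
  (contDiff_infty.1 (rootPair_smallRoot he).contDiff_curve 4).comp
    (contDiff_id.add contDiff_const)

theorem muInv_stdCurve {lam e : ℝ} (he : eta lam < e) : muInv (stdCurve lam e) =
    fun s => mu e (smallRoot lam e) (s + -(period e (smallRoot lam e) / 2)) :=
  (rootPair_smallRoot he).muInv_eq (isFrenet_stdCurve he)

theorem isStandardBCurve_stdCurve {lam e : ℝ} (he : eta lam < e) :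
    IsStandardBCurve lam e (stdCurve lam e) (stdPeriod lam e) := by
  have hp := rootPair_smallRoot he
  have ha := hp.a_pos
  have hx : √(1 + (e * (e + 2 * lam)) ^ 2) = 2 * xi lam e * e := by
    unfold xi; field_simp
  have hξ := hp.xi_pos
  refine ⟨hp.isBCurveWithParams (contDiff_stdCurve he) (isFrenet_stdCurve he), ?_, ?_, ?_, ?_⟩
  · rw [(isFrenet_stdCurve he).curvature_eq]
    exact hp.isLeastPeriod_mu_sq _
  · rw [muInv_stdCurve he, stdPeriod]
    simp only [add_neg_cancel, hp.mu_zero]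
  · simp only [stdCurve, stdPeriod, add_neg_cancel, hp.curve_zero, hx]
    ext i
    fin_cases i
    · simp only [Matrix.cons_val, Fin.zero_eta]
      field_simp
    · simp only [Matrix.cons_val, Fin.mk_one]
      field_simp
    · rfl
  · have : deriv (stdCurve lam e) (stdPeriod lam e / 2) =
        deriv (curve lam e (smallRoot lam e) (xi lam e)) 0 := by
      unfold stdCurve stdPeriod
      rw [deriv_comp_add_const, add_neg_cancel]
    rw [this, hp.deriv_curve_zero]

theorem IsStandardBCurve.eq {lam e w : ℝ} {γ : ℝ → Fin 3 → ℝ} (h : IsStandardBCurve lam e γ w) :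
    γ = stdCurve lam e ∧ w = stdPeriod lam e := by
  obtain ⟨he, hB⟩ := h.params.exists_const
  have hp := rootPair_smallRoot he
  have hF := hB.isFrenet_mu hp h.mu_half
  have hw : w = stdPeriod lam e := by
    have h1 := h.leastPeriod
    rw [hF.curvature_eq] at h1
    exact h1.unique (hp.isLeastPeriod_mu_sq _)
  refine ⟨?_, hw⟩
  have hS := isStandardBCurve_stdCurve he
  rw [hw] at hF
  refine hF.eq_of_eq_at (isFrenet_stdCurve he) (t := stdPeriod lam e / 2) ?_ ?_
  · rw [hS.pos_half, ← hw, h.pos_half]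
  · rw [hS.vel_half, ← hw, h.vel_half]

theorem isStandardBCurve_iff {lam e w : ℝ} {γ : ℝ → Fin 3 → ℝ} (he : eta lam < e) :
    IsStandardBCurve lam e γ w ↔ γ = stdCurve lam e ∧ w = stdPeriod lam e := by
  refine ⟨fun h => h.eq, ?_⟩
  rintro ⟨rfl, rfl⟩
  exact isStandardBCurve_stdCurve he

theorem IsClosedCurve.of_eq_mulVec {γ γ' : ℝ → Fin 3 → ℝ} {M : Matrix (Fin 3) (Fin 3) ℝ} {c : ℝ}
    (h : ∀ s, γ s = M *ᵥ γ' (s + c)) (hc : IsClosedCurve γ') : IsClosedCurve γ := by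
  obtain ⟨T, hT, hp⟩ := hc
  refine ⟨T, hT, fun s => ?_⟩
  rw [h, h, add_right_comm, hp]

/-- Shifting the parameter to a maximum of `μ` gives the curve the same curvature as the explicit
one, so each is the image of a shift of the other under a constant matrix. -/
theorem IsBCurveWithParams.isClosedCurve_iff {lam e : ℝ} {γ : ℝ → Fin 3 → ℝ}
    (h : IsBCurveWithParams lam e γ) :
    IsClosedCurve γ ↔ ∃ q : ℚ, stdRotPeriod lam e = 2 * Real.pi * q := by
  obtain ⟨he, hB⟩ := h.exists_const
  have hp := rootPair_smallRoot he
  obtain ⟨s₀, h0, -⟩ := hB.exists_muInv_eq hp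
  have hF := hB.isFrenet_mu hp h0
  have hF' := hp.isFrenet_curve.comp_add_const (-s₀)
  rw [stdRotPeriod, ← hp.isClosedCurve_curve_iff]
  constructor
  · obtain ⟨M, hM⟩ : ∃ M : Matrix (Fin 3) (Fin 3) ℝ, ∀ s,
        curve lam e (smallRoot lam e) (xi lam e) s = M *ᵥ γ (s + s₀) :=
      ⟨_, fun s => by
        have := hF'.eq_mulVec hF (s + s₀) 0
        rwa [add_neg_cancel_right] at this⟩
    exact IsClosedCurve.of_eq_mulVec hM
  · exact fun hc => IsClosedCurve.of_eq_mulVec (c := -s₀) (fun s => hF.eq_mulVec hF' s 0) hc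

theorem hasMonodromy_stdCurve {lam e : ℝ} (he : eta lam < e) :
    HasMonodromy (stdCurve lam e) (rotX (stdRotPeriod lam e)) :=
  (rootPair_smallRoot he).hasMonodromy_curve _

/-! ### Analyticity of integrals depending on a parameter -/

section ContinuousMaps

variable {K : Type*} [TopologicalSpace K]

/-- The pointwise square root of a continuous function. -/
def sqrtMap (f : C(K, ℝ)) : C(K, ℝ) := ⟨fun x => √(f x), by fun_prop⟩

theorem sqrtMap_apply (f : C(K, ℝ)) (x : K) : sqrtMap f x = √(f x) := rfl

theorem eventually_forall_pos [CompactSpace K] {f : C(K, ℝ)} (hf : ∀ x, 0 < f x) :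
    ∀ᶠ g in 𝓝 f, ∀ x, 0 < g x := by
  have h := ContinuousMap.isOpen_setOfPred_mapsTo (X := K) (Y := ℝ) isCompact_univ (isOpen_Ioi (a := 0))
  filter_upwards [h.mem_nhds (fun x _ => hf x)] with g hg x
  exact hg (Set.mem_univ x)

/-- At a positive function the square root is a local inverse of squaring in the Banach algebra of
continuous functions, since multiplication by `2√f` is invertible. The positive branch is selected
by continuity in the uniform norm. -/
theorem contDiffAt_sqrtMap [CompactSpace K] {f : C(K, ℝ)} (hf : ∀ x, 0 < f x)
    {n : WithTop ℕ∞} (hn : n ≠ 0) : ContDiffAt ℝ n sqrtMap f := by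
  set y := sqrtMap f with hy
  have hypos : ∀ x, 0 < y x := fun x => Real.sqrt_pos.2 (hf x)
  have hyy : y * y = f := by
    ext x
    exact Real.mul_self_sqrt (hf x).le
  have hu : IsUnit ((2 : ℝ) • y) :=
    ContinuousMap.isUnit_iff_forall_ne_zero _ |>.2 fun x => by
      have := hypos x
      simp [this.ne']
  obtain ⟨v, hv⟩ := hu
  set E : C(K, ℝ) ≃L[ℝ] C(K, ℝ) := ContinuousLinearEquiv.equivOfInverse
    (ContinuousLinearMap.mul ℝ C(K, ℝ) (v : C(K, ℝ)))
    (ContinuousLinearMap.mul ℝ C(K, ℝ) ((v⁻¹ : C(K, ℝ)ˣ) : C(K, ℝ)))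
    (fun z => by simp) (fun z => by simp) with hE
  have hsc : ContDiffAt ℝ n (fun z : C(K, ℝ) => z * z) y := contDiffAt_id.mul contDiffAt_id
  have hsd : HasFDerivAt (fun z : C(K, ℝ) => z * z) (E : C(K, ℝ) →L[ℝ] C(K, ℝ)) y := by
    have h1 := (hasFDerivAt_id (𝕜 := ℝ) y).mul (hasFDerivAt_id y)
    refine h1.congr_fderiv ?_
    ext z x
    have : (E : C(K, ℝ) →L[ℝ] C(K, ℝ)) z = ((2 : ℝ) • y) * z := by rw [← hv]; rfl
    rw [this]
    simp
    ring
  have hg := hsc.to_localInverse hsd hn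
  have hga := hsc.localInverse_apply_image hsd hn
  have hri := (hsc.hasStrictFDerivAt' hsd hn).eventually_right_inverse
  simp only [hyy] at hg hga hri
  refine hg.congr_of_eventuallyEq ?_
  have hev : ∀ᶠ g in 𝓝 f, ∀ x, 0 < hsc.localInverse hsd hn g x := by
    have := hg.continuousAt
    rw [ContinuousAt, hga] at this
    exact this.eventually (eventually_forall_pos hypos)
  filter_upwards [hev, hri] with g h1 h2
  ext x
  have h3 : hsc.localInverse hsd hn g x * hsc.localInverse hsd hn g x = g x :=
    DFunLike.congr_fun h2 x
  rw [sqrtMap_apply, ← h3, Real.sqrt_mul_self (h1 x).le]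

theorem ringInverse_apply {f : C(K, ℝ)} (hf : ∀ x, f x ≠ 0) (x : K) :
    Ring.inverse f x = (f x)⁻¹ := by
  have hu : IsUnit f := ContinuousMap.isUnit_iff_forall_ne_zero _ |>.2 hf
  have h1 := DFunLike.congr_fun (Ring.mul_inverse_cancel f hu) x
  exact eq_inv_of_mul_eq_one_right h1

theorem contDiffAt_ringInverse_continuousMap [CompactSpace K] {f : C(K, ℝ)} (hf : ∀ x, f x ≠ 0)
    {n : WithTop ℕ∞} : ContDiffAt ℝ n Ring.inverse f := by
  obtain ⟨u, rfl⟩ : IsUnit f := ContinuousMap.isUnit_iff_forall_ne_zero _ |>.2 hf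
  exact contDiffAt_ringInverse ℝ u

end ContinuousMaps

/-- Integration over `[x, y]`, as a continuous linear functional on continuous functions. -/
def integralMap {x y : ℝ} (h : x ≤ y) : C(Set.Icc x y, ℝ) →L[ℝ] ℝ :=
  LinearMap.mkContinuous
    { toFun := fun f => ∫ t in x..y, Set.IccExtend h f t
      map_add' := fun f g => by
        rw [← intervalIntegral.integral_add]
        · rfl
        · exact (f.continuous.Icc_extend' (h := h)).intervalIntegrable _ _
        · exact (g.continuous.Icc_extend' (h := h)).intervalIntegrable _ _
      map_smul' := fun c f => by
        rw [RingHom.id_apply, smul_eq_mul, ← intervalIntegral.integral_const_mul]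
        rfl }
    |y - x| fun f => by
      rw [mul_comm]
      refine intervalIntegral.norm_integral_le_of_norm_le_const fun t _ => ?_
      exact f.norm_coe_le_norm _

theorem integralMap_eq {x y : ℝ} (h : x ≤ y) (f : C(Set.Icc x y, ℝ)) {g : ℝ → ℝ}
    (hg : ∀ t : Set.Icc x y, f t = g t) : integralMap h f = ∫ t in x..y, g t := by
  change ∫ t in x..y, Set.IccExtend h f t = _
  refine intervalIntegral.integral_congr fun t ht => ?_
  rw [Set.uIcc_of_le h] at ht
  rw [Set.IccExtend_of_mem h _ ht, hg]

/-! ### The rotation angle as a function of the parameter -/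

/-- The density of the rotation angle with respect to the angle variable. -/
def rotDensity (lam τ φ : ℝ) : ℝ :=
  rotRate lam (xi lam (root lam τ)) (muAngle (root lam τ) (root lam (-τ)) φ) /
    angleSpeed (root lam τ) (root lam (-τ)) φ

/-- The rotation angle over a period as a function of the parameter. -/
def rotIntegral (lam τ : ℝ) : ℝ := 2 * ∫ φ in (0 : ℝ)..Real.pi, rotDensity lam τ φ

/-- The angle variable replaces time. The interval of integration no longer depends on the roots,
and the integrand is continuous at the turning points. -/
theorem RootPair.rotPeriod_eq {lam a b ξ : ℝ} (h : RootPair lam a b ξ) : rotPeriod lam a b ξ =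
    2 * ∫ φ in (0 : ℝ)..Real.pi, rotRate lam ξ (muAngle a b φ) / angleSpeed a b φ := by
  have hd : ∀ φ, HasDerivAt (fun φ => rotAngle lam a b ξ (time a b φ))
      (rotRate lam ξ (muAngle a b φ) / angleSpeed a b φ) φ := by
    intro φ
    refine ((h.hasDerivAt_rotAngle (time a b φ)).comp φ (h.hasDerivAt_time φ)).congr_deriv ?_
    rw [mu, h.angle_time]
    ring
  have hc : Continuous fun φ => rotRate lam ξ (muAngle a b φ) / angleSpeed a b φ := by
    have h1 : Continuous fun φ => rotRate lam ξ (mu a b (time a b φ)) :=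
      h.contDiff_rotRate_mu.continuous.comp h.continuous_time
    simp only [mu, h.angle_time] at h1
    exact h1.div (h.contDiff_angleSpeed (n := 0)).continuous fun φ => (h.angleSpeed_pos φ).ne'
  rw [intervalIntegral.integral_eq_sub_of_hasDerivAt (fun φ _ => hd φ)
    (hc.intervalIntegrable _ _), time_zero, rotAngle_zero, h.time_pi, rotPeriod, sub_zero]

theorem rotIntegral_rootParam {lam e : ℝ} (he : eta lam < e) :
    rotIntegral lam (rootParam lam e) = stdRotPeriod lam e := by
  rw [stdRotPeriod, (rootPair_smallRoot he).rotPeriod_eq, rotIntegral]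
  simp only [rotDensity, root_rootParam he, smallRoot]

theorem muAngle_pos {a b : ℝ} (ha : 0 < a) (hb : 0 < b) (φ : ℝ) : 0 < muAngle a b φ := by
  have h1 := Real.neg_one_le_cos φ
  have h2 := Real.cos_le_one φ
  have : muAngle a b φ = a * ((1 + Real.cos φ) / 2) + b * ((1 - Real.cos φ) / 2) := by
    unfold muAngle; ring
  rw [this]
  rcases h1.eq_or_lt with h | h
  · rw [← h]; linarith
  · have h3 : 0 < a * ((1 + Real.cos φ) / 2) := mul_pos ha (by linarith)
    have h4 : 0 ≤ b * ((1 - Real.cos φ) / 2) := mul_nonneg hb.le (by linarith)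
    linarith

/-- The cosine on `[0, π]`. -/
def cosMap : C(Set.Icc (0 : ℝ) Real.pi, ℝ) := ⟨fun φ => Real.cos φ, by fun_prop⟩

/-- The integrand is viewed as a curve `F` in the Banach algebra of continuous functions on `[0,
π]`. It is built from analytic scalar functions of `τ` by sums, products, inverses and square roots,
and integration is a continuous linear functional. All `τ` are allowed, in particular the double
root `τ = 0`. -/
theorem contDiff_rotIntegral (lam : ℝ) : ContDiff ℝ ω (rotIntegral lam) := by
  rw [contDiff_iff_contDiffAt]
  intro τ₀
  have hω : (ω : WithTop ℕ∞) ≠ 0 := by simp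
  have ha : ContDiff ℝ ω (root lam) := (contDiff_rootMean hω lam).mul Real.contDiff_exp
  have hb : ContDiff ℝ ω fun τ => root lam (-τ) := ha.comp contDiff_neg
  have hξ : ContDiff ℝ ω fun τ => xi lam (root lam τ) := by
    unfold xi
    refine (contDiff_const.div (contDiff_const.mul ha) fun τ => ?_).mul
      ((contDiff_const.add ((ha.mul (ha.add contDiff_const)).pow 2)).sqrt fun τ => ?_)
    · have := root_pos lam τ; positivity
    · positivity
  have hxpos : ∀ τ, 0 < xi lam (root lam τ) := fun τ => (xi_sq_mul (root_pos lam τ)).1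
  set c := cosMap
  set m : ℝ → C(Set.Icc (0 : ℝ) Real.pi, ℝ) := fun τ =>
    ((root lam τ + root lam (-τ)) / 2) • 1 + ((root lam τ - root lam (-τ)) / 2) • c with hm
  have hmv : ∀ τ φ, m τ φ = muAngle (root lam τ) (root lam (-τ)) φ := by
    intro τ φ
    simp [hm, muAngle, c, cosMap]
  have hmpos : ∀ τ φ, 0 < m τ φ := fun τ φ => by
    rw [hmv]; exact muAngle_pos (root_pos _ _) (root_pos _ _) _
  have hmC : ContDiff ℝ ω m :=
    (((ha.add hb).div_const 2).smul contDiff_const).add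
      (((ha.sub hb).div_const 2).smul contDiff_const)
  set R : ℝ → C(Set.Icc (0 : ℝ) Real.pi, ℝ) := fun τ =>
    m τ * m τ + ((root lam τ + root lam (-τ)) / (root lam τ * root lam (-τ)) ^ 2) • m τ +
      (1 / (root lam τ * root lam (-τ))) • 1 with hR
  have hRv : ∀ τ φ, R τ φ = cofactor (root lam τ) (root lam (-τ)) (m τ φ) := by
    intro τ φ
    simp [hR, cofactor]
    ring
  have hRpos : ∀ τ φ, 0 < R τ φ := fun τ φ => by
    rw [hRv]; exact cofactor_pos (root_pos _ _) (root_pos _ _) (hmpos τ φ).le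
  have hab : ∀ τ, root lam τ * root lam (-τ) ≠ 0 := fun τ =>
    (mul_pos (root_pos _ _) (root_pos _ _)).ne'
  have hRC : ContDiff ℝ ω R :=
    ((hmC.mul hmC).add (((ha.add hb).div ((ha.mul hb).pow 2)
      fun τ => pow_ne_zero 2 (hab τ)).smul hmC)).add
      ((contDiff_const.div (ha.mul hb) hab).smul contDiff_const)
  have hminv : ContDiffAt ℝ ω (fun τ => Ring.inverse (m τ)) τ₀ :=
    (contDiffAt_ringInverse_continuousMap fun φ => (hmpos τ₀ φ).ne').comp τ₀ hmC.contDiffAt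
  set D : ℝ → C(Set.Icc (0 : ℝ) Real.pi, ℝ) := fun τ =>
    (2 * xi lam (root lam τ)) • 1 + Ring.inverse (m τ) with hD
  have hDv : ∀ τ φ, D τ φ = 2 * xi lam (root lam τ) + 1 / m τ φ := by
    intro τ φ
    simp [hD, ringInverse_apply fun φ => (hmpos τ φ).ne']
  have hDpos : ∀ τ φ, 0 < D τ φ := fun τ φ => by
    rw [hDv]
    have := hxpos τ
    have := hmpos τ φ
    positivity
  have hDC : ContDiffAt ℝ ω D τ₀ :=
    ((contDiff_const.mul hξ).smul contDiff_const).contDiffAt.add hminv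
  have hDinv : ContDiffAt ℝ ω (fun τ => Ring.inverse (D τ)) τ₀ :=
    (contDiffAt_ringInverse_continuousMap fun φ => (hDpos τ₀ φ).ne').comp τ₀ hDC
  set G : ℝ → C(Set.Icc (0 : ℝ) Real.pi, ℝ) := fun τ => m τ * sqrtMap (R τ) with hG
  have hGv : ∀ τ φ, G τ φ = angleSpeed (root lam τ) (root lam (-τ)) φ := by
    intro τ φ
    simp [hG, angleSpeed, sqrtMap_apply, hRv, hmv]
  have hGpos : ∀ τ φ, 0 < G τ φ := fun τ φ =>
    mul_pos (hmpos τ φ) (Real.sqrt_pos.2 (hRpos τ φ))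
  have hGC : ContDiffAt ℝ ω G τ₀ :=
    hmC.contDiffAt.mul ((contDiffAt_sqrtMap (hRpos τ₀) hω).comp τ₀ hRC.contDiffAt)
  have hGinv : ContDiffAt ℝ ω (fun τ => Ring.inverse (G τ)) τ₀ :=
    (contDiffAt_ringInverse_continuousMap fun φ => (hGpos τ₀ φ).ne').comp τ₀ hGC
  set F : ℝ → C(Set.Icc (0 : ℝ) Real.pi, ℝ) := fun τ =>
    (m τ * m τ + (m τ + (2 * lam) • 1) * Ring.inverse (D τ)) * Ring.inverse (G τ) with hF
  have hFC : ContDiffAt ℝ ω F τ₀ :=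
    ((hmC.mul hmC).contDiffAt.add ((hmC.add contDiff_const).contDiffAt.mul hDinv)).mul hGinv
  have hint : rotIntegral lam = fun τ => 2 * integralMap Real.pi_pos.le (F τ) := by
    ext τ
    rw [rotIntegral, integralMap_eq]
    intro φ
    simp only [hF, rotDensity, rotRate, ← hmv, ← hGv, ContinuousMap.mul_apply,
      ContinuousMap.add_apply, ContinuousMap.smul_apply, ContinuousMap.one_apply,
      ringInverse_apply fun φ => (hGpos τ φ).ne', ringInverse_apply fun φ => (hDpos τ φ).ne', hDv]
    simp only [smul_eq_mul]
    ring
  rw [hint]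
  exact contDiffAt_const.mul
    ((integralMap Real.pi_pos.le).contDiff.contDiffAt.comp τ₀ hFC)

/-! ### Limits of the rotation angle -/

/-- At the double root `μ` is constantly `η`, so the density does not depend on the angle. With `ρ =
√(1 + η⁴)` one finds `2ξ = ρ/η³`, rate `η² + 1/(ρ + η²) = ρ` and angle speed `√(3 + η⁴)`. -/
theorem rotIntegral_zero (lam : ℝ) : rotIntegral lam 0 = -(2 * Real.pi * p lam) := by
  have hη := eta_pos lam
  have he := eta_eq lam
  set e := eta lam with hedef
  set ρ := √(1 + e ^ 4) with hρ
  have hρ0 : 0 < ρ := Real.sqrt_pos.2 (by positivity)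
  have hρ2 : ρ ^ 2 = 1 + e ^ 4 := Real.sq_sqrt (by positivity)
  have hv : e + 2 * lam = 1 / e ^ 3 := by
    field_simp; linear_combination he
  have hm : ∀ φ, muAngle e e φ = e := by intro φ; simp [muAngle]
  have hR : cofactor e e e = (e ^ 4 + 3) / e ^ 2 := by
    unfold cofactor; field_simp; ring
  have hG : ∀ φ, angleSpeed e e φ = √(3 + e ^ 4) := by
    intro φ
    rw [angleSpeed, hm, hR, Real.sqrt_div (by positivity), Real.sqrt_sq hη.le, add_comm]
    field_simp
  have hxi : 2 * xi lam e = ρ / e ^ 3 := by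
    have h1 : 1 + (e * (e + 2 * lam)) ^ 2 = (1 + e ^ 4) / e ^ 4 := by
      rw [hv]; field_simp; ring
    have h2 : √(e ^ 4) = e ^ 2 := by
      rw [show e ^ 4 = (e ^ 2) ^ 2 by ring, Real.sqrt_sq (by positivity)]
    rw [xi, h1, Real.sqrt_div (by positivity), h2, ← hρ]
    field_simp
  have hrate : rotRate lam (xi lam e) e = ρ := by
    rw [rotRate, hxi, hv]
    field_simp
    linear_combination -hρ2
  have hd : ∀ φ, rotDensity lam 0 φ = ρ / √(3 + e ^ 4) := by
    intro φ
    rw [rotDensity, neg_zero, root_zero, ← hedef, hm, hG, hrate]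
  have hp : p lam = -(ρ / √(3 + e ^ 4)) := by
    rw [p, ← hedef, Real.sqrt_div (by positivity)]
  rw [rotIntegral, hp]
  simp only [hd, intervalIntegral.integral_const, smul_eq_mul]
  ring

/-- The half-angle formulas turn the integrand into `(cos (φ/2) / √2) / √(1 - sin² (φ/2) / 2)`, the
derivative of `2 arcsin (sin (φ/2) / √2)`; on `[0, π]` the cosine of the half angle is nonnegative.
-/
theorem integral_sqrt_limit :
    ∫ φ in (0 : ℝ)..Real.pi, √((1 + Real.cos φ) / (3 + Real.cos φ)) = Real.pi / 2 := by
  have hs2 : (0 : ℝ) < √2 := Real.sqrt_pos.2 two_pos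
  have hs2' : √2 ^ 2 = (2 : ℝ) := Real.sq_sqrt two_pos.le
  have hlt : ∀ φ : ℝ, (Real.sin (φ / 2) / √2) ^ 2 < 1 := by
    intro φ
    rw [div_pow, hs2']
    have := Real.sin_sq_le_one (φ / 2)
    linarith
  have hd : ∀ φ ∈ Set.uIcc 0 Real.pi, HasDerivAt
      (fun φ => 2 * Real.arcsin (Real.sin (φ / 2) / √2))
      (√((1 + Real.cos φ) / (3 + Real.cos φ))) φ := by
    intro φ hφ
    rw [Set.uIcc_of_le Real.pi_pos.le] at hφ
    have h1 := abs_lt.1 ((sq_lt_one_iff_abs_lt_one _).1 (hlt φ))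
    have h2 : HasDerivAt (fun φ : ℝ => Real.sin (φ / 2) / √2)
        (Real.cos (φ / 2) * (1 / 2) / √2) φ :=
      (((hasDerivAt_id φ).div_const 2).sin).div_const √2
    have h3 := ((Real.hasDerivAt_arcsin h1.1.ne' h1.2.ne).comp φ h2).const_mul 2
    refine h3.congr_deriv ?_
    have hcos : 0 ≤ Real.cos (φ / 2) :=
      Real.cos_nonneg_of_mem_Icc ⟨by linarith [hφ.1, Real.pi_pos], by linarith [hφ.2]⟩
    have hc2 : Real.cos φ = 2 * Real.cos (φ / 2) ^ 2 - 1 := by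
      rw [← Real.cos_two_mul]; ring_nf
    have hsin : Real.sin (φ / 2) ^ 2 = 1 - Real.cos (φ / 2) ^ 2 := Real.sin_sq _
    have hpos : 0 < 1 - (Real.sin (φ / 2) / √2) ^ 2 := by linarith [hlt φ]
    have e1 : (1 + Real.cos φ) / (3 + Real.cos φ) =
        (Real.cos (φ / 2) / √2) ^ 2 / (1 - (Real.sin (φ / 2) / √2) ^ 2) := by
      rw [div_pow, div_pow, hs2', hsin, hc2]
      have : 0 < 1 + Real.cos (φ / 2) ^ 2 := by positivity
      rw [div_eq_div_iff (by nlinarith) (by nlinarith)]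
      ring
    rw [e1, Real.sqrt_div (by positivity), Real.sqrt_sq (by positivity)]
    field_simp
  have hc : IntervalIntegrable (fun φ => √((1 + Real.cos φ) / (3 + Real.cos φ)))
      MeasureTheory.volume 0 Real.pi := by
    apply Continuous.intervalIntegrable
    refine (Continuous.div (by fun_prop) (by fun_prop) fun φ => ?_).sqrt
    have := Real.neg_one_le_cos φ
    intro h; linarith
  rw [intervalIntegral.integral_eq_sub_of_hasDerivAt hd hc]
  have h1 : Real.arcsin (Real.sin (Real.pi / 2) / √2) = Real.pi / 4 := by
    rw [Real.sin_pi_div_two]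
    have : (1 : ℝ) / √2 = Real.sin (Real.pi / 4) := by
      rw [Real.sin_pi_div_four]; field_simp; linarith
    rw [this, Real.arcsin_sin (by linarith [Real.pi_pos]) (by linarith [Real.pi_pos])]
  rw [h1]
  simp
  ring

theorem tendsto_xi_root (lam : ℝ) : Tendsto (fun τ => xi lam (root lam τ)) atTop atTop := by
  have h1 : Tendsto (fun τ => (root lam τ + 2 * lam) / 2) atTop atTop :=
    (tendsto_atTop_add_const_right _ _ (tendsto_root lam)).atTop_div_const two_pos
  refine tendsto_atTop_mono (fun τ => ?_) h1
  have ha := root_pos lam τ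
  obtain ⟨h2, h3⟩ := xi_sq_mul (lam := lam) ha
  set e := root lam τ
  have h4 : (e * (e + 2 * lam)) ^ 2 ≤ (2 * xi lam e * e) ^ 2 := by
    nlinarith
  have h5 := (abs_le_of_sq_le_sq' h4 (by positivity)).2
  have h6 : e + 2 * lam ≤ 2 * xi lam e := by
    apply le_of_mul_le_mul_left _ ha
    linarith
  linarith

/-- The first summand is at most `1` and carries the limit as `τ → ∞`; the second, from the term
`v/(2ξ + u)`, will tend to `0`. -/
theorem rotDensity_eq (lam τ φ : ℝ) : rotDensity lam τ φ =
    (√(1 + (root lam τ + root lam (-τ)) / muAngle (root lam τ) (root lam (-τ)) φ /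
      rootMean lam τ ^ 4 +
      1 / (rootMean lam τ * muAngle (root lam τ) (root lam (-τ)) φ) ^ 2))⁻¹ +
    (muAngle (root lam τ) (root lam (-τ)) φ + 2 * lam) /
      ((2 * xi lam (root lam τ) * muAngle (root lam τ) (root lam (-τ)) φ + 1) *
        √(cofactor (root lam τ) (root lam (-τ)) (muAngle (root lam τ) (root lam (-τ)) φ))) := by
  have hx := rootMean_pos lam τ
  have ha := root_pos lam τ
  have hb := root_pos lam (-τ)
  have hm := muAngle_pos ha hb φ
  have hR := cofactor_pos ha hb hm.le
  have hξ := (xi_sq_mul (lam := lam) ha).1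
  have h1 : cofactor (root lam τ) (root lam (-τ)) (muAngle (root lam τ) (root lam (-τ)) φ) =
      muAngle (root lam τ) (root lam (-τ)) φ ^ 2 *
      (1 + (root lam τ + root lam (-τ)) / muAngle (root lam τ) (root lam (-τ)) φ /
      rootMean lam τ ^ 4 +
      1 / (rootMean lam τ * muAngle (root lam τ) (root lam (-τ)) φ) ^ 2) := by
    rw [cofactor, root_mul_root_neg]
    field_simp
  have h2 : √(cofactor (root lam τ) (root lam (-τ)) (muAngle (root lam τ) (root lam (-τ)) φ)) =
      muAngle (root lam τ) (root lam (-τ)) φ *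
      √(1 + (root lam τ + root lam (-τ)) / muAngle (root lam τ) (root lam (-τ)) φ /
      rootMean lam τ ^ 4 +
      1 / (rootMean lam τ * muAngle (root lam τ) (root lam (-τ)) φ) ^ 2) := by
    rw [h1, Real.sqrt_mul (by positivity), Real.sqrt_sq hm.le]
  rw [rotDensity, rotRate, angleSpeed, h2]
  set m := muAngle (root lam τ) (root lam (-τ)) φ
  have hS : 0 < √(1 + (root lam τ + root lam (-τ)) / m / rootMean lam τ ^ 4 +
      1 / (rootMean lam τ * m) ^ 2) := Real.sqrt_pos.2 (by positivity)
  set S := √(1 + (root lam τ + root lam (-τ)) / m / rootMean lam τ ^ 4 +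
      1 / (rootMean lam τ * m) ^ 2)
  have : 0 < 2 * xi lam (root lam τ) * m + 1 := by positivity
  field_simp

/-- Two bounds suffice: the cofactor is at least `1/(ab) = 1/x²`, and `μ/(2ξμ + 1) ≤ 1/(2ξ)`. -/
theorem abs_second_term_le (lam τ φ : ℝ) :
    |(muAngle (root lam τ) (root lam (-τ)) φ + 2 * lam) /
      ((2 * xi lam (root lam τ) * muAngle (root lam τ) (root lam (-τ)) φ + 1) *
        √(cofactor (root lam τ) (root lam (-τ)) (muAngle (root lam τ) (root lam (-τ)) φ)))| ≤
    rootMean lam τ * (1 / (2 * xi lam (root lam τ)) + 2 * |lam| /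
      (2 * xi lam (root lam τ) * muAngle (root lam τ) (root lam (-τ)) φ + 1)) := by
  have hx := rootMean_pos lam τ
  have ha := root_pos lam τ
  have hb := root_pos lam (-τ)
  have hm := muAngle_pos ha hb φ
  have hR := cofactor_pos ha hb hm.le
  have hξ := (xi_sq_mul (lam := lam) ha).1
  set m := muAngle (root lam τ) (root lam (-τ)) φ
  set ξ := xi lam (root lam τ)
  have h1 : 1 / rootMean lam τ ≤ √(cofactor (root lam τ) (root lam (-τ)) m) := by
    apply Real.le_sqrt_of_sq_le
    rw [cofactor, root_mul_root_neg, div_pow, one_pow]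
    have : 0 ≤ m ^ 2 + (root lam τ + root lam (-τ)) / (rootMean lam τ ^ 2) ^ 2 * m := by
      positivity
    linarith
  have hD : 0 < 2 * ξ * m + 1 := by positivity
  have h2 : |m + 2 * lam| ≤ m + 2 * |lam| := by
    refine (abs_add_le _ _).trans ?_
    rw [abs_of_pos hm, abs_mul, abs_two]
  rw [abs_div, abs_mul, abs_of_pos hD, abs_of_nonneg (Real.sqrt_nonneg _)]
  calc |m + 2 * lam| / ((2 * ξ * m + 1) * √(cofactor (root lam τ) (root lam (-τ)) m))
      ≤ (m + 2 * |lam|) / ((2 * ξ * m + 1) * (1 / rootMean lam τ)) := by gcongr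
    _ = rootMean lam τ * (m / (2 * ξ * m + 1) + 2 * |lam| / (2 * ξ * m + 1)) := by
        field_simp
    _ ≤ rootMean lam τ * (1 / (2 * ξ) + 2 * |lam| / (2 * ξ * m + 1)) := by
        have : m / (2 * ξ * m + 1) ≤ 1 / (2 * ξ) := by
          rw [div_le_div_iff₀ hD (by positivity)]
          linarith
        gcongr

theorem muAngle_root (lam τ φ : ℝ) : muAngle (root lam τ) (root lam (-τ)) φ =
    root lam τ * ((1 + Real.cos φ) / 2 + Real.exp (-2 * τ) * ((1 - Real.cos φ) / 2)) := by
  have h1 : root lam (-τ) = root lam τ * Real.exp (-2 * τ) := by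
    rw [root, root, rootMean_neg, mul_assoc, ← Real.exp_add]
    ring_nf
  rw [h1, muAngle]
  ring

theorem tendsto_exp_neg_two_mul : Tendsto (fun τ : ℝ => Real.exp (-2 * τ)) atTop (𝓝 0) := by
  have h1 : Tendsto (fun τ : ℝ => 2 * τ) atTop atTop := tendsto_id.const_mul_atTop two_pos
  refine (Real.tendsto_exp_neg_atTop_nhds_zero.comp h1).congr fun τ => ?_
  simp

/-- For `cos φ > -1` both `μ` and `ξ` tend to infinity, while `(a + b)/μ` tends to `2/(1 + cos φ)`.
At `φ = π` instead `μ = b → 0`. -/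
theorem tendsto_rotDensity (lam : ℝ) {φ : ℝ} (hφ : -1 < Real.cos φ) :
    Tendsto (fun τ => rotDensity lam τ φ) atTop
      (𝓝 (√((1 + Real.cos φ) / (3 + Real.cos φ)))) := by
  have hx := tendsto_rootMean lam
  have hroot := tendsto_root lam
  have hξ := tendsto_xi_root lam
  have hE := tendsto_exp_neg_two_mul
  set m : ℝ → ℝ := fun τ => muAngle (root lam τ) (root lam (-τ)) φ with hm
  have hfac : Tendsto (fun τ : ℝ => (1 + Real.cos φ) / 2 +
      Real.exp (-2 * τ) * ((1 - Real.cos φ) / 2)) atTop (𝓝 ((1 + Real.cos φ) / 2)) := by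
    have := (hE.mul_const ((1 - Real.cos φ) / 2)).const_add ((1 + Real.cos φ) / 2)
    simpa using this
  have hmt : Tendsto m atTop atTop := by
    have := hroot.atTop_mul_pos (by linarith : 0 < (1 + Real.cos φ) / 2) hfac
    exact this.congr fun τ => (muAngle_root lam τ φ).symm
  have hratio : Tendsto (fun τ => (root lam τ + root lam (-τ)) / m τ) atTop
      (𝓝 (2 / (1 + Real.cos φ))) := by
    have h1 : Tendsto (fun τ : ℝ => (1 + Real.exp (-2 * τ)) / ((1 + Real.cos φ) / 2 +
        Real.exp (-2 * τ) * ((1 - Real.cos φ) / 2))) atTop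
        (𝓝 ((1 + 0) / ((1 + Real.cos φ) / 2))) :=
      (hE.const_add 1).div hfac (by linarith : (0 : ℝ) < (1 + Real.cos φ) / 2).ne'
    have h2 : ((1 : ℝ) + 0) / ((1 + Real.cos φ) / 2) = 2 / (1 + Real.cos φ) := by
      rw [add_zero, one_div_div]
    rw [h2] at h1
    refine h1.congr fun τ => ?_
    have h3 : root lam (-τ) = root lam τ * Real.exp (-2 * τ) := by
      rw [root, root, rootMean_neg, mul_assoc, ← Real.exp_add]
      ring_nf
    simp only [hm]
    rw [muAngle_root, h3, show root lam τ + root lam τ * Real.exp (-2 * τ) =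
      root lam τ * (1 + Real.exp (-2 * τ)) by ring, mul_div_mul_left _ _ (root_pos lam τ).ne']
  have hsmall : Tendsto (fun τ => 1 / (rootMean lam τ * m τ) ^ 2) atTop (𝓝 0) := by
    have h1 : Tendsto (fun τ => rootMean lam τ * m τ) atTop atTop := hx.pos_mul_atTop one_pos hmt
    have h2 := (tendsto_pow_atTop two_ne_zero).comp h1
    exact h2.const_div_atTop 1
  have hfirst : Tendsto (fun τ => (√(1 + (root lam τ + root lam (-τ)) / m τ / rootMean lam τ ^ 4 +
      1 / (rootMean lam τ * m τ) ^ 2))⁻¹) atTop (𝓝 (√((1 + Real.cos φ) / (3 + Real.cos φ)))) := by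
    have h1 := ((hratio.div (hx.pow 4) (by norm_num)).const_add 1).add hsmall
    have h2 : (1 : ℝ) + 2 / (1 + Real.cos φ) / 1 ^ 4 + 0 = (3 + Real.cos φ) / (1 + Real.cos φ) := by
      have : 1 + Real.cos φ ≠ 0 := by intro h; linarith
      field_simp
      ring
    rw [h2] at h1
    have h3 := h1.sqrt.inv₀ (Real.sqrt_pos.2 (div_pos (by linarith) (by linarith))).ne'
    rwa [← Real.sqrt_inv, inv_div] at h3
  have hsecond : Tendsto (fun τ => (m τ + 2 * lam) / ((2 * xi lam (root lam τ) * m τ + 1) *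
      √(cofactor (root lam τ) (root lam (-τ)) (m τ)))) atTop (𝓝 0) := by
    have h1 : Tendsto (fun τ => 2 * xi lam (root lam τ)) atTop atTop :=
      hξ.const_mul_atTop two_pos
    have h2 : Tendsto (fun τ => 2 * xi lam (root lam τ) * m τ + 1) atTop atTop :=
      tendsto_atTop_add_const_right _ _ (h1.atTop_mul_atTop₀ hmt)
    have h3 := hx.mul ((h1.const_div_atTop 1).add (h2.const_div_atTop (2 * |lam|)))
    simp only [add_zero, mul_zero] at h3
    exact squeeze_zero_norm (fun τ => abs_second_term_le lam τ φ) h3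
  have := hfirst.add hsecond
  rw [add_zero] at this
  exact this.congr fun τ => (rotDensity_eq lam τ φ).symm

theorem continuous_rotDensity (lam τ : ℝ) : Continuous (rotDensity lam τ) := by
  have ha := root_pos lam τ
  have hb := root_pos lam (-τ)
  have hm := muAngle_pos ha hb
  have hξ := (xi_sq_mul (lam := lam) ha).1
  have hmc : Continuous (muAngle (root lam τ) (root lam (-τ))) :=
    (contDiff_muAngle _ _ (n := 0)).continuous
  have hRc : Continuous (cofactor (root lam τ) (root lam (-τ))) :=
    (contDiff_cofactor _ _ (n := 0)).continuous
  unfold rotDensity rotRate angleSpeed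
  refine ((hmc.pow 2).add ((hmc.add continuous_const).div (continuous_const.add
    (continuous_const.div hmc fun φ => (hm φ).ne')) fun φ => ?_)).div
    (hmc.mul (hRc.comp hmc).sqrt) fun φ => ?_
  · exact (add_pos (mul_pos two_pos hξ) (one_div_pos.2 (hm φ))).ne'
  · exact (mul_pos (hm φ) (Real.sqrt_pos.2 (cofactor_pos ha hb (hm φ).le))).ne'

theorem tendsto_rotIntegral (lam : ℝ) : Tendsto (rotIntegral lam) atTop (𝓝 Real.pi) := by
  have hlim : Tendsto (fun τ => ∫ φ in (0 : ℝ)..Real.pi, rotDensity lam τ φ) atTop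
      (𝓝 (∫ φ in (0 : ℝ)..Real.pi, √((1 + Real.cos φ) / (3 + Real.cos φ)))) := by
    refine intervalIntegral.tendsto_integral_filter_of_dominated_convergence
      (fun _ => 1 + 2 * (1 + 2 * |lam|)) ?_ ?_ (by simp) ?_
    · exact Eventually.of_forall fun τ =>
        (continuous_rotDensity lam τ).aestronglyMeasurable
    -- For large `τ` the geometric mean is below `2` and `2ξ ≥ 1`, which bounds the second summand
    -- by `2(1 + 2|λ|)`.
    · filter_upwards [(tendsto_rootMean lam).eventually_lt_const one_lt_two,
        (tendsto_xi_root lam).eventually_ge_atTop (1 / 2)] with τ h1 h2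
      refine Eventually.of_forall fun φ _ => ?_
      have hx := rootMean_pos lam τ
      have ha := root_pos lam τ
      have hb := root_pos lam (-τ)
      have hm := muAngle_pos ha hb φ
      rw [rotDensity_eq, Real.norm_eq_abs]
      refine (abs_add_le _ _).trans (add_le_add ?_ ((abs_second_term_le lam τ φ).trans ?_))
      · rw [abs_of_nonneg (inv_nonneg.2 (Real.sqrt_nonneg _))]
        apply inv_le_one_of_one_le₀
        rw [Real.one_le_sqrt]
        have : 0 ≤ (root lam τ + root lam (-τ)) / muAngle (root lam τ) (root lam (-τ)) φ /
          rootMean lam τ ^ 4 + 1 / (rootMean lam τ * muAngle (root lam τ) (root lam (-τ)) φ) ^ 2 := by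
          positivity
        linarith
      · have h3 : (1 : ℝ) / (2 * xi lam (root lam τ)) ≤ 1 := by
          rw [div_le_one (by linarith)]
          linarith
        have h4 : 2 * |lam| / (2 * xi lam (root lam τ) *
            muAngle (root lam τ) (root lam (-τ)) φ + 1) ≤ 2 * |lam| := by
          apply div_le_self (by positivity)
          have : 0 < 2 * xi lam (root lam τ) * muAngle (root lam τ) (root lam (-τ)) φ :=
            mul_pos (by linarith) hm
          linarith
        have hl := abs_nonneg lam
        have hξ : 0 < xi lam (root lam τ) := by linarith
        gcongr
    · filter_upwards [MeasureTheory.volume.ae_ne Real.pi] with φ hne hφ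
      rw [Set.uIoc_of_le Real.pi_pos.le] at hφ
      apply tendsto_rotDensity
      rw [← Real.cos_pi]
      exact Real.cos_lt_cos_of_nonneg_of_le_pi hφ.1.le le_rfl (lt_of_le_of_ne hφ.2 hne)
  have := hlim.const_mul 2
  rwa [integral_sqrt_limit, mul_div_cancel₀ _ two_ne_zero] at this

/-! ### Values and level sets of the rotation integral -/

theorem one_half_lt_neg_p (lam : ℝ) : 1 / 2 < -p lam := by
  have := eta_pos lam
  rw [p, neg_neg]
  apply Real.lt_sqrt_of_sq_lt
  rw [lt_div_iff₀ (by positivity)]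
  have : 0 < eta lam ^ 4 := by positivity
  linarith

theorem analyticOnNhd_rotIntegral (lam : ℝ) : AnalyticOnNhd ℝ (rotIntegral lam) Set.univ :=
  (contDiff_rotIntegral lam).analyticOnNhd

theorem continuous_rotIntegral (lam : ℝ) : Continuous (rotIntegral lam) :=
  (contDiff_rotIntegral lam).continuous

/-- The zeros of a nonzero analytic function on the line form a discrete set, and a discrete
Lindelöf space is countable. -/
theorem countable_preimage_of_analytic {f : ℝ → ℝ} (hf : AnalyticOnNhd ℝ f Set.univ) {c z : ℝ}
    (hz : f z ≠ c) : {t | f t = c}.Countable := by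
  have hg : AnalyticOnNhd ℝ (fun t => f t - c) Set.univ := hf.sub analyticOnNhd_const
  rcases hg.eqOn_zero_or_eventually_ne_zero_of_preconnected isPreconnected_univ with h | h
  · exact absurd (sub_eq_zero.1 (h (Set.mem_univ z))) hz
  · have h1 : {t | f t = c}ᶜ ∈ codiscreteWithin (Set.univ : Set ℝ) := by
      filter_upwards [h] with t ht
      simpa [sub_eq_zero] using ht
    have h2 := isDiscrete_of_codiscreteWithin h1
    rw [Set.inter_univ] at h2
    have := h2.to_subtype
    exact Set.countable_coe_iff.1 countable_of_Lindelof_of_discrete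

/-- The function is not constant: its value at `0` exceeds `π`, its limit at infinity. -/
theorem countable_rotIntegral_eq (lam c : ℝ) : {τ | rotIntegral lam τ = c}.Countable := by
  by_cases h : rotIntegral lam 0 = c
  · have h1 : ∃ z, rotIntegral lam z ≠ c := by
      by_contra! hcon
      have h2 : Tendsto (rotIntegral lam) atTop (𝓝 c) :=
        tendsto_const_nhds.congr fun τ => (hcon τ).symm
      have h3 := tendsto_nhds_unique h2 (tendsto_rotIntegral lam)
      rw [rotIntegral_zero, h3] at h
      have := one_half_lt_neg_p lam
      have := Real.pi_pos
      nlinarith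
    obtain ⟨z, hz⟩ := h1
    exact countable_preimage_of_analytic (analyticOnNhd_rotIntegral lam) hz
  · exact countable_preimage_of_analytic (analyticOnNhd_rotIntegral lam) h

/-- Level sets are countable and `(T, ∞)` has infinite measure, so two different values occur beyond
`T`; a rational multiple of `2π` lies between them and is attained. -/
theorem exists_rotIntegral_rational (lam T : ℝ) :
    ∃ τ > T, ∃ q : ℚ, rotIntegral lam τ = 2 * Real.pi * q := by
  have hne : ∃ t > T, rotIntegral lam t ≠ rotIntegral lam (T + 1) := by
    by_contra! hcon
    have h1 : Set.Ioi T ⊆ {τ | rotIntegral lam τ = rotIntegral lam (T + 1)} := fun t ht => hcon t ht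
    have h2 := (countable_rotIntegral_eq lam (rotIntegral lam (T + 1))).mono h1
    have h3 := h2.measure_zero MeasureTheory.volume
    rw [Real.volume_Ioi] at h3
    exact ENNReal.top_ne_zero h3
  obtain ⟨t, ht, hne⟩ := hne
  have h2π : 0 < 2 * Real.pi := by positivity
  have hlt : min (rotIntegral lam t) (rotIntegral lam (T + 1)) / (2 * Real.pi) <
      max (rotIntegral lam t) (rotIntegral lam (T + 1)) / (2 * Real.pi) :=
    div_lt_div_of_pos_right (min_lt_max.2 hne) h2π
  obtain ⟨q, hq1, hq2⟩ := exists_rat_btwn hlt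
  rw [div_lt_iff₀' h2π] at hq1
  rw [lt_div_iff₀' h2π] at hq2
  obtain ⟨τ, hτ, he⟩ := intermediate_value_uIcc (continuous_rotIntegral lam).continuousOn
    (⟨hq1.le, hq2.le⟩ : 2 * Real.pi * (q : ℝ) ∈
      Set.uIcc (rotIntegral lam t) (rotIntegral lam (T + 1)))
  exact ⟨τ, (lt_min ht (lt_add_one T)).trans_le hτ.1, q, he⟩

theorem exists_rotIntegral_eq {lam c : ℝ} (h1 : Real.pi < c) (h2 : c < -(2 * Real.pi * p lam)) :
    ∃ τ > 0, rotIntegral lam τ = c := by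
  obtain ⟨T, hT, hT0⟩ := (((tendsto_rotIntegral lam).eventually_lt_const h1).and
    (eventually_gt_atTop 0)).exists
  obtain ⟨τ, hτ, he⟩ := intermediate_value_Ioo' hT0.le (continuous_rotIntegral lam).continuousOn
    ⟨hT, by rwa [rotIntegral_zero]⟩
  exact ⟨τ, hτ.1, he⟩

/-! ### The jump of the angular function -/

/-- The density of the angular function (up to the factor `2 ξ`) in terms of `μ`. -/
def angularDensity (lam ξ t : ℝ) : ℝ := t ^ 2 * (t + 2 * lam) / (1 - 4 * ξ ^ 2 * t ^ 2)

namespace RootPair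

variable {lam a b ξ : ℝ}

theorem recipDot_pos (h : RootPair lam a b ξ) {s : ℝ} (hs : s ∈ Set.Ioo 0 (period a b / 2)) :
    0 < recipDot a b s := by
  have h1 : 0 < angle a b s := by rw [← h.angle_zero]; exact h.angle_strictMono hs.1
  have h2 : angle a b s < Real.pi := by rw [← h.angle_half_period]; exact h.angle_strictMono hs.2
  have h3 := Real.sin_pos_of_pos_of_lt_pi h1 h2
  have h4 := h.cofactor_muAngle_pos (angle a b s)
  have h5 := h.mu_pos s
  have h6 := h.lt
  exact div_pos (mul_pos (mul_pos (by linarith) h3) (Real.sqrt_pos.2 h4)) h5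

theorem lt_mu (h : RootPair lam a b ξ) {s : ℝ} (hs : s ∈ Set.Ioo 0 (period a b / 2)) :
    b < mu a b s := by
  refine lt_of_le_of_ne (h.mu_mem s).1 fun hb => ?_
  have h1 := h.recipDot_sq s
  rw [h.quartic_eq, ← hb] at h1
  have h2 := h.recipDot_pos hs
  have h3 := h.b_pos
  have : 0 < recipDot a b s ^ 2 * b ^ 2 := by positivity
  simp only [sub_self, mul_zero, zero_mul, neg_zero] at h1
  linarith

theorem radius_eq (h : RootPair lam a b ξ) (s : ℝ) : 4 * ξ ^ 2 - (1 / mu a b s) ^ 2 =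
    recipDot a b s ^ 2 + (mu a b s + 2 * lam) ^ 2 := by linarith [h.energy s]

/-- Up to scale this is the squared distance of the curve from the `Ox`-axis. It vanishes only if `r
= v = 0`, which makes `μ` a root of `Q` equal to `-2λ`, hence `b`. -/
theorem radius_pos (h : RootPair lam a b ξ) (hb : b + 2 * lam ≠ 0) (s : ℝ) :
    0 < 4 * ξ ^ 2 - (1 / mu a b s) ^ 2 := by
  rw [h.radius_eq]
  by_contra! hcon
  have h1 : recipDot a b s = 0 := by nlinarith [sq_nonneg (mu a b s + 2 * lam)]
  have h2 : mu a b s + 2 * lam = 0 := by nlinarith [sq_nonneg (recipDot a b s)]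
  have h3 := h.recipDot_sq s
  have hq : quartic lam ξ (mu a b s) = 0 := by rw [h1] at h3; linarith
  rcases h.eq_or_eq_of_quartic_eq_zero (h.mu_pos s) hq with h4 | h4
  · have := h.add_two_mul_pos
    rw [h4] at h2
    linarith
  · rw [h4] at h2
    exact hb h2

theorem angularDensity_eq (h : RootPair lam a b ξ) (s : ℝ) : angularDensity lam ξ (mu a b s) =
    -((mu a b s + 2 * lam) / (4 * ξ ^ 2 - (1 / mu a b s) ^ 2)) := by
  have hm := h.mu_pos s
  have h1 : 1 - 4 * ξ ^ 2 * mu a b s ^ 2 =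
      mu a b s ^ 2 * -(4 * ξ ^ 2 - (1 / mu a b s) ^ 2) := by
    field_simp
    ring
  rw [angularDensity, h1, mul_div_mul_left _ _ (by positivity), div_neg]

/-- The polar angle `arccos (v / √(r ^ 2 + v ^ 2))` of the point `v + i r`. -/
theorem hasDerivAt_arccos (h : RootPair lam a b ξ) {s : ℝ}
    (hs : s ∈ Set.Ioo 0 (period a b / 2)) :
    HasDerivAt (fun s => Real.arccos ((mu a b s + 2 * lam) / √(4 * ξ ^ 2 - (1 / mu a b s) ^ 2)))
      (2 * ξ * angularDensity lam ξ (mu a b s) + rotRate lam ξ (mu a b s)) s := by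
  have hr := h.recipDot_pos hs
  have hm := h.mu_pos s
  have hξ := h.xi_pos
  have hW : 0 < 4 * ξ ^ 2 - (1 / mu a b s) ^ 2 := by
    rw [h.radius_eq]; positivity
  have hWr := h.radius_eq s
  have hD := h.denom_pos s
  have hdW := (((h.hasDerivAt_recip_mu s).fun_pow 2).const_sub (4 * ξ ^ 2)).sqrt hW.ne'
  set W := 4 * ξ ^ 2 - (1 / mu a b s) ^ 2 with hWdef
  have hWs : 0 < √W := Real.sqrt_pos.2 hW
  have hWq : √W ^ 2 = W := Real.sq_sqrt hW.le
  have hquot := (h.hasDerivAt_add_two_mul s).div hdW hWs.ne'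
  have hlt : ((mu a b s + 2 * lam) / √W) ^ 2 < 1 := by
    rw [div_pow, hWq, div_lt_one hW, hWr]
    have : 0 < recipDot a b s ^ 2 := by positivity
    linarith
  have habs := abs_lt.1 ((sq_lt_one_iff_abs_lt_one _).1 hlt)
  -- On the open half period `r > 0`, so `v + ir` lies in the upper half-plane and its polar angle
  -- is the arccosine.
  have hroot : √(1 - ((mu a b s + 2 * lam) / √W) ^ 2) = recipDot a b s / √W := by
    rw [show 1 - ((mu a b s + 2 * lam) / √W) ^ 2 = (recipDot a b s / √W) ^ 2 by
      rw [div_pow, div_pow, hWq]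
      field_simp
      linarith]
    exact Real.sqrt_sq (by positivity)
  have htot := (Real.hasDerivAt_arccos habs.1.ne' habs.2.ne).comp s hquot
  refine htot.congr_deriv ?_
  rw [hroot, h.angularDensity_eq, ← hWdef, rotRate]
  have hWfac : W = (2 * ξ - 1 / mu a b s) * (2 * ξ + 1 / mu a b s) := by rw [hWdef]; ring
  have e1 : (mu a b s + 2 * lam) / (2 * ξ + 1 / mu a b s) =
      (mu a b s + 2 * lam) * (2 * ξ - 1 / mu a b s) / W := by
    have hne : 2 * ξ - 1 / mu a b s ≠ 0 := by
      intro h0; rw [h0, zero_mul] at hWfac; exact hW.ne' hWfac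
    rw [hWfac]
    have hD' := hD.ne'
    generalize 2 * ξ - 1 / mu a b s = x at *
    generalize 2 * ξ + 1 / mu a b s = y at *
    field_simp
  rw [e1]
  generalize mu a b s + 2 * lam = v at *
  generalize 1 / mu a b s = u at *
  clear_value W
  clear hdW hquot htot
  generalize √W = q at hWq hWs ⊢
  rw [← hWq]
  field_simp
  push_cast
  ring

/-- In the exceptional case both numerator and denominator vanish where `μ = b`. There the radicand
has the factor `μ - b = v`, so the quotient equals `√(μ - b)` times a continuous function and tends
to `0`, which is also the value given by division by zero. -/
theorem continuous_polar (h : RootPair lam a b ξ) :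
    Continuous fun s => (mu a b s + 2 * lam) / √(4 * ξ ^ 2 - (1 / mu a b s) ^ 2) := by
  have hm := h.mu_pos
  have hmc := h.continuous_mu
  have hb := h.b_pos
  have hWc : Continuous fun s => √(4 * ξ ^ 2 - (1 / mu a b s) ^ 2) :=
    (continuous_const.sub ((continuous_const.div hmc fun s => (hm s).ne').pow 2)).sqrt
  by_cases hbl : b + 2 * lam = 0
  · have hξb : 4 * ξ ^ 2 = (1 / b) ^ 2 := by
      have h1 := h.eq_b
      rw [hbl] at h1
      field_simp
      linear_combination h1
    have e : (fun s => (mu a b s + 2 * lam) / √(4 * ξ ^ 2 - (1 / mu a b s) ^ 2)) = fun s =>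
        √(mu a b s - b) * (b * mu a b s / √(mu a b s + b)) := by
      ext s
      have h1 := hm s
      have h2 := (h.mu_mem s).1
      have h3 : 4 * ξ ^ 2 - (1 / mu a b s) ^ 2 =
          (mu a b s - b) * ((mu a b s + b) / (b * mu a b s) ^ 2) := by
        rw [hξb]; field_simp; ring
      have h4 : mu a b s + 2 * lam = mu a b s - b := by linarith
      have h5 : (0 : ℝ) < b * mu a b s := by positivity
      rw [h3, h4, Real.sqrt_mul (by linarith), Real.sqrt_div (by positivity), Real.sqrt_sq h5.le,
        ← div_div, Real.div_sqrt, div_div_eq_mul_div, mul_div_assoc]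
    rw [e]
    refine (hmc.sub continuous_const).sqrt.mul ((continuous_const.mul hmc).div
      (hmc.add continuous_const).sqrt fun s => ?_)
    exact (Real.sqrt_pos.2 (add_pos (hm s) hb)).ne'
  · exact (hmc.add continuous_const).div hWc fun s => (Real.sqrt_pos.2 (h.radius_pos hbl s)).ne'

/-- In the exceptional case the factor `μ - b` cancels and leaves a continuous function. The two
agree on the open half period, which is enough for integrability. -/
theorem intervalIntegrable_angularDensity (h : RootPair lam a b ξ) :
    IntervalIntegrable (fun s => angularDensity lam ξ (mu a b s)) MeasureTheory.volume 0
      (period a b / 2) := by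
  have hm := h.mu_pos
  have hmc := h.continuous_mu
  have hb := h.b_pos
  have hper := h.period_pos
  by_cases hbl : b + 2 * lam = 0
  · have hξb : 4 * ξ ^ 2 = (1 / b) ^ 2 := by
      have h1 := h.eq_b
      rw [hbl] at h1
      field_simp
      linear_combination h1
    have hc : Continuous fun s => -(b ^ 2 * mu a b s ^ 2 / (mu a b s + b)) := by
      refine ((continuous_const.mul (hmc.pow 2)).div (hmc.add continuous_const) fun s => ?_).neg
      exact (add_pos (hm s) hb).ne'
    refine (hc.intervalIntegrable 0 (period a b / 2)).congr_uIoo fun s hs => ?_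
    rw [Set.uIoo_of_le (by linarith)] at hs
    have h1 := h.lt_mu hs
    have h2 := hm s
    have h4 : mu a b s + 2 * lam = mu a b s - b := by linarith
    have h5 : (1 / b) ^ 2 - (1 / mu a b s) ^ 2 =
        (mu a b s - b) * ((mu a b s + b) / (b * mu a b s) ^ 2) := by field_simp; ring
    have h6 : mu a b s - b ≠ 0 := by intro h0; linarith
    simp only
    rw [h.angularDensity_eq, h4, hξb, h5]
    field_simp
  · simp only [h.angularDensity_eq]
    apply Continuous.intervalIntegrable
    exact ((hmc.add continuous_const).div (continuous_const.sub
      ((continuous_const.div hmc fun s => (hm s).ne').pow 2))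
      fun s => (h.radius_pos hbl s).ne').neg

/-- Integrating the derivative of the polar angle over the half period, from the value `0` at `μ =
a`. The three signs of `b + 2λ` are covered at once: when it is `0`, the quotient is `0` and the
arccosine is `π/2`. -/
theorem integral_angularDensity (h : RootPair lam a b ξ) :
    2 * ξ * ∫ s in (0 : ℝ)..(period a b / 2), angularDensity lam ξ (mu a b s) =
      Real.arccos ((b + 2 * lam) / |b + 2 * lam|) - rotAngle lam a b ξ (period a b / 2) := by
  have hper := h.period_pos
  have hi := h.intervalIntegrable_angularDensity.const_mul (2 * ξ)
  have hg := h.contDiff_rotRate_mu.continuous.intervalIntegrable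
    (μ := MeasureTheory.volume) 0 (period a b / 2)
  have h1 := intervalIntegral.integral_eq_sub_of_hasDerivAt_of_le (by linarith)
    (Real.continuous_arccos.comp h.continuous_polar).continuousOn
    (fun s hs => h.hasDerivAt_arccos hs) (hi.add hg)
  have hr0 := h.radius_eq 0
  have hr1 := h.radius_eq (period a b / 2)
  have hrd : recipDot a b (period a b / 2) = 0 := by simp [recipDot, h.angle_half_period]
  rw [h.recipDot_zero, h.mu_zero] at hr0
  rw [hrd, h.mu_half_period] at hr1
  rw [intervalIntegral.integral_add hi hg, intervalIntegral.integral_const_mul] at h1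
  have hva := h.add_two_mul_pos
  have e0 : (a + 2 * lam) / |a + 2 * lam| = 1 := by
    rw [abs_of_pos hva, div_self hva.ne']
  simp only [Function.comp_apply, hr0, hr1, zero_pow two_ne_zero, zero_add, Real.sqrt_sq_eq_abs,
    h.mu_zero, h.mu_half_period, e0, Real.arccos_one, sub_zero] at h1
  rw [← h1, rotAngle]
  ring

end RootPair

/-- The integrand is even about the maximum of `μ`, so the jump is twice the half-period integral.
-/
theorem jump_stdCurve {lam e : ℝ} (he : eta lam < e) : jump lam e (stdCurve lam e)
    (stdPeriod lam e) = 2 * Real.arccos ((smallRoot lam e + 2 * lam) / |smallRoot lam e + 2 * lam|) -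
      stdRotPeriod lam e := by
  have hp := rootPair_smallRoot he
  have hang : ∀ s, angular lam e (stdCurve lam e) (stdPeriod lam e) s = 2 * xi lam e *
      ∫ t in (0 : ℝ)..(s + -(stdPeriod lam e / 2)),
        angularDensity lam (xi lam e) (mu e (smallRoot lam e) t) := by
    intro s
    rw [angular, muInv_stdCurve he]
    have := intervalIntegral.integral_comp_add_right (a := stdPeriod lam e / 2) (b := s)
      (fun t => angularDensity lam (xi lam e) (mu e (smallRoot lam e) t)) (-(stdPeriod lam e / 2))
    rw [add_neg_cancel] at this
    rw [← this]
    rfl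
  have heven : ∀ x, ∫ t in (0 : ℝ)..(-x),
      angularDensity lam (xi lam e) (mu e (smallRoot lam e) t) =
      -∫ t in (0 : ℝ)..x, angularDensity lam (xi lam e) (mu e (smallRoot lam e) t) := by
    intro x
    have h1 : ∫ t in (0 : ℝ)..(-x), angularDensity lam (xi lam e) (mu e (smallRoot lam e) t) =
        ∫ t in (0 : ℝ)..(-x), angularDensity lam (xi lam e) (mu e (smallRoot lam e) (-t)) := by
      simp only [hp.mu_neg]
    rw [h1, intervalIntegral.integral_comp_neg
      (fun t => angularDensity lam (xi lam e) (mu e (smallRoot lam e) t)), neg_neg, neg_zero,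
      intervalIntegral.integral_symm]
  have hhalf : stdPeriod lam e + -(stdPeriod lam e / 2) = stdPeriod lam e / 2 := by ring
  rw [jump, hang, hang, hhalf, zero_add, heven]
  have := hp.integral_angularDensity
  rw [stdRotPeriod, rotPeriod]
  simp only [stdPeriod]
  linear_combination 2 * this

theorem jump_of_pos {lam e : ℝ} (he : eta lam < e) (hb : 0 < smallRoot lam e + 2 * lam) :
    jump lam e (stdCurve lam e) (stdPeriod lam e) = -stdRotPeriod lam e := by
  rw [jump_stdCurve he, abs_of_pos hb, div_self hb.ne', Real.arccos_one]
  ring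

theorem jump_of_neg {lam e : ℝ} (he : eta lam < e) (hb : smallRoot lam e + 2 * lam < 0) :
    jump lam e (stdCurve lam e) (stdPeriod lam e) = 2 * Real.pi - stdRotPeriod lam e := by
  rw [jump_stdCurve he, abs_of_neg hb, div_neg, div_self hb.ne, Real.arccos_neg_one]

/-- Twice the final polar angle is `0`, `2π` or, in the exceptional case, `π`. The added `π` is what
makes the three cases agree modulo `2π`. -/
theorem regularizedJump_stdCurve {lam e : ℝ} (he : eta lam < e) :
    regularizedJump lam e (stdCurve lam e) (stdPeriod lam e) =
      ((-stdRotPeriod lam e : ℝ) : Real.Angle) := by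
  have hiff := (rootPair_smallRoot he).exceptional_iff
  have h2 : ((2 * Real.pi - stdRotPeriod lam e : ℝ) : Real.Angle) =
      ((-stdRotPeriod lam e : ℝ) : Real.Angle) := by
    rw [sub_eq_add_neg, Real.Angle.coe_add, Real.Angle.coe_two_pi, zero_add]
  unfold regularizedJump
  split_ifs with h0
  · rw [jump_stdCurve he, hiff.1 h0, ← h2]
    simp only [zero_div, Real.arccos_zero]
    congr 1
    ring
  · rcases lt_or_gt_of_ne (fun h1 => h0 (hiff.2 h1)) with h1 | h1
    · rw [jump_of_neg he h1, h2]
    · rw [jump_of_pos he h1]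

/-! ### The closed B-curves -/

/-- The parameters of the closed B-curves. -/
def closedParams (lam : ℝ) : Set ℝ :=
  {e | eta lam < e ∧ ∃ q : ℚ, stdRotPeriod lam e = 2 * Real.pi * q}

theorem stdRotPeriod_root {lam τ : ℝ} (hτ : 0 < τ) :
    stdRotPeriod lam (root lam τ) = rotIntegral lam τ := by
  rw [← rotIntegral_rootParam (eta_lt_root hτ), rootParam_root]

theorem countable_closedParams (lam : ℝ) : (closedParams lam).Countable := by
  have h : (⋃ q : ℚ, root lam '' {τ | rotIntegral lam τ = 2 * Real.pi * q}).Countable :=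
    Set.countable_iUnion fun q => (countable_rotIntegral_eq lam _).image _
  refine h.mono ?_
  rintro e ⟨he, q, hq⟩
  refine Set.mem_iUnion.2 ⟨q, rootParam lam e, ?_, root_rootParam he⟩
  rw [← hq]
  exact rotIntegral_rootParam he

theorem not_bddAbove_closedParams (lam : ℝ) : ¬BddAbove (closedParams lam) := by
  rintro ⟨M, hM⟩
  obtain ⟨T, hT, hT0⟩ := (((tendsto_root lam).eventually_ge_atTop M).and
    (eventually_ge_atTop 0)).exists
  obtain ⟨τ, hτ, q, hq⟩ := exists_rotIntegral_rational lam T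
  have hτ0 : 0 < τ := hT0.trans_lt hτ
  have h1 : root lam τ ∈ closedParams lam :=
    ⟨eta_lt_root hτ0, q, by rw [stdRotPeriod_root hτ0, hq]⟩
  have h2 := root_strictMono lam hτ
  have h3 := hM h1
  linarith

theorem IsBCurveWithParams.isClosedCurve_iff_mem {lam e : ℝ} {γ : ℝ → Fin 3 → ℝ}
    (h : IsBCurveWithParams lam e γ) : IsClosedCurve γ ↔ e ∈ closedParams lam := by
  rw [h.isClosedCurve_iff]
  exact ⟨fun hq => ⟨h.exists_const.1, hq⟩, fun hq => hq.2⟩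

/-- The bounds on `q` say exactly that `2π(1 - q)` lies strictly between `π` and `-2πp`. -/
theorem exists_closed_with_rotation {lam q : ℝ} (h1 : 1 + p lam < q) (h2 : q < 1 / 2) :
    ∃ e, eta lam < e ∧ stdRotPeriod lam e = 2 * Real.pi * (1 - q) := by
  have hπ := Real.pi_pos
  obtain ⟨τ, hτ, he⟩ := exists_rotIntegral_eq (lam := lam) (c := 2 * Real.pi * (1 - q))
    (by nlinarith) (by nlinarith)
  exact ⟨root lam τ, eta_lt_root hτ, by rw [stdRotPeriod_root hτ, he]⟩

/-! ### Limits of the rotation angle and of the jump at the ends of the parameter range -/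

theorem tendsto_stdRotPeriod_eta (lam : ℝ) :
    Tendsto (stdRotPeriod lam) (𝓝[>] (eta lam)) (𝓝 (-(2 * Real.pi * p lam))) := by
  have h1 := ((continuous_rotIntegral lam).tendsto 0).comp (tendsto_rootParam_eta lam)
  rw [rotIntegral_zero] at h1
  refine h1.congr' ?_
  filter_upwards [self_mem_nhdsWithin] with e he
  exact rotIntegral_rootParam he

theorem tendsto_stdRotPeriod_atTop (lam : ℝ) :
    Tendsto (stdRotPeriod lam) atTop (𝓝 Real.pi) := by
  have h1 := (tendsto_rotIntegral lam).comp (tendsto_rootParam_atTop lam)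
  refine h1.congr' ?_
  filter_upwards [eventually_gt_atTop (eta lam)] with e he
  exact rotIntegral_rootParam he

theorem tendsto_smallRoot_eta (lam : ℝ) :
    Tendsto (smallRoot lam) (𝓝[>] (eta lam)) (𝓝 (eta lam)) := by
  have h1 := ((continuous_root lam).tendsto (-0)).comp (tendsto_rootParam_eta lam).neg
  rwa [neg_zero, root_zero] at h1

theorem tendsto_smallRoot_atTop (lam : ℝ) : Tendsto (smallRoot lam) atTop (𝓝 0) := by
  have h1 : Tendsto (fun τ => root lam (-τ)) atTop (𝓝 (1 * 0)) := by
    refine ((tendsto_rootMean lam).mul Real.tendsto_exp_neg_atTop_nhds_zero).congr fun τ => ?_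
    rw [root, rootMean_neg]
  rw [one_mul] at h1
  exact h1.comp (tendsto_rootParam_atTop lam)

theorem eta_add_two_mul_pos (lam : ℝ) : 0 < eta lam + 2 * lam := by
  have h1 := eta_pos lam
  have h2 : eta lam ^ 3 * (eta lam + 2 * lam) = 1 := by linear_combination eta_eq lam
  exact pos_of_mul_pos_right (by rw [h2]; exact one_pos) (by positivity)

/-- Near `η` the smaller root is also near `η`, and `η + 2λ > 0`, so the polar angle contributes
nothing. -/
theorem tendsto_jump_eta (lam : ℝ) :
    Tendsto (fun e => jump lam e (stdCurve lam e) (stdPeriod lam e)) (𝓝[>] (eta lam))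
      (𝓝 (2 * Real.pi * p lam)) := by
  have h1 := (tendsto_stdRotPeriod_eta lam).neg
  rw [neg_neg] at h1
  refine h1.congr' ?_
  have h2 := (tendsto_smallRoot_eta lam).add_const (2 * lam)
  filter_upwards [self_mem_nhdsWithin, h2.eventually_const_lt (eta_add_two_mul_pos lam)] with e he hb
  exact (jump_of_pos he hb).symm

theorem tendsto_jump_atTop_of_nonneg {lam : ℝ} (hl : 0 ≤ lam) :
    Tendsto (fun e => jump lam e (stdCurve lam e) (stdPeriod lam e)) atTop (𝓝 (-Real.pi)) := by
  refine (tendsto_stdRotPeriod_atTop lam).neg.congr' ?_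
  filter_upwards [eventually_gt_atTop (eta lam)] with e he
  have := (rootPair_smallRoot he).b_pos
  exact (jump_of_pos he (by linarith)).symm

/-- The smaller root tends to `0`, so `b + 2λ` is eventually negative and the polar angle
contributes a full turn `2π`. -/
theorem tendsto_jump_atTop_of_neg {lam : ℝ} (hl : lam < 0) :
    Tendsto (fun e => jump lam e (stdCurve lam e) (stdPeriod lam e)) atTop (𝓝 Real.pi) := by
  have h1 := (tendsto_stdRotPeriod_atTop lam).const_sub (2 * Real.pi)
  rw [two_mul, add_sub_cancel_right] at h1
  refine h1.congr' ?_
  have h2 := (tendsto_smallRoot_atTop lam).add_const (2 * lam)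
  filter_upwards [eventually_gt_atTop (eta lam),
    h2.eventually_lt_const (by linarith : 0 + 2 * lam < 0)] with e he hb
  rw [jump_of_neg he hb, two_mul]

end

end BCurve

theorem mainTheorem2 (lam : ℝ) :
    -- the standard B-curves `Γ e₁` with least periods `ω e₁`, for `e₁ ∈ (η_λ, ∞)`
    ∃ (Γ : ℝ → ℝ → Fin 3 → ℝ) (ω : ℝ → ℝ),
      (∀ e₁, BCurve.eta lam < e₁ → ∀ (γ : ℝ → Fin 3 → ℝ) (w : ℝ),
        BCurve.IsStandardBCurve lam e₁ γ w ↔ γ = Γ e₁ ∧ w = ω e₁) ∧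
      -- the closed B-curves
      (∃ Δ : Set ℝ, Δ ⊆ Set.Ioi (BCurve.eta lam) ∧ Δ.Countable ∧ ¬ BddAbove Δ ∧
        (∀ (e₁ : ℝ) (γ : ℝ → Fin 3 → ℝ), BCurve.IsBCurveWithParams lam e₁ γ →
          (BCurve.IsClosedCurve γ ↔ e₁ ∈ Δ)) ∧
        (∀ q : ℚ, 1 + BCurve.p lam < (q : ℝ) → (q : ℝ) < 1 / 2 →
          -- a closed standard B-curve with characteristic number `q`
          (∃ e₁ ∈ Δ,
            BCurve.regularizedJump lam e₁ (Γ e₁) (ω e₁) =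
              ((2 * Real.pi * (q : ℝ) : ℝ) : Real.Angle) ∧
            BCurve.HasMonodromy (Γ e₁) (BCurve.rotX (-(2 * Real.pi * (q : ℝ)))) ∧
            -- a B-string with the same parameters (not in standard form), with monodromy `2πq`
            ∃ γ : ℝ → Fin 3 → ℝ, BCurve.IsBCurveWithParams lam e₁ γ ∧
              BCurve.IsClosedCurve γ ∧
              BCurve.HasMonodromy γ (BCurve.rotX (2 * Real.pi * (q : ℝ)))))) ∧
      -- the limits of the jump function at the ends of its domain
      Tendsto (fun e₁ => BCurve.jump lam e₁ (Γ e₁) (ω e₁)) (𝓝[>] (BCurve.eta lam))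
        (𝓝 (2 * Real.pi * BCurve.p lam)) ∧
      (0 ≤ lam → Tendsto (fun e₁ => BCurve.jump lam e₁ (Γ e₁) (ω e₁)) atTop
        (𝓝 (-Real.pi))) ∧
      (lam < 0 → Tendsto (fun e₁ => BCurve.jump lam e₁ (Γ e₁) (ω e₁)) atTop
        (𝓝 Real.pi)) := by
  refine ⟨BCurve.stdCurve lam, BCurve.stdPeriod lam,
    fun e₁ he γ w => BCurve.isStandardBCurve_iff he,
    ⟨BCurve.closedParams lam, fun e he => he.1, BCurve.countable_closedParams lam,
      BCurve.not_bddAbove_closedParams lam, fun e₁ γ h => h.isClosedCurve_iff_mem, ?_⟩,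
    BCurve.tendsto_jump_eta lam, BCurve.tendsto_jump_atTop_of_nonneg,
    BCurve.tendsto_jump_atTop_of_neg⟩
  intro q hq1 hq2
  obtain ⟨e, he, hA⟩ := BCurve.exists_closed_with_rotation hq1 hq2
  -- The angle is `2π(1 - q)`, so the rational number is `1 - q`; modulo `2π` this is the rotation
  -- by `-2πq`.
  have hmem : e ∈ BCurve.closedParams lam := ⟨he, 1 - q, by rw [hA]; push_cast; rfl⟩
  have hparams := (BCurve.isStandardBCurve_stdCurve he).params
  have hclosed := hparams.isClosedCurve_iff_mem.2 hmem
  have hM := BCurve.hasMonodromy_stdCurve he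
  have hF := BCurve.isFrenet_stdCurve he
  have hrot : BCurve.rotX (BCurve.stdRotPeriod lam e) = BCurve.rotX (-(2 * Real.pi * q)) := by
    rw [hA, ← BCurve.rotX_add_two_pi_mul (-(2 * Real.pi * q)) 1]
    congr 1
    push_cast
    ring
  have hrot' : BCurve.rotX (-BCurve.stdRotPeriod lam e) = BCurve.rotX (2 * Real.pi * q) := by
    rw [hA, ← BCurve.rotX_add_two_pi_mul (2 * Real.pi * q) (-1)]
    congr 1
    push_cast
    ring
  -- The second B-string is the image of the standard one under the half-turn about `Oy`, which
  -- keeps the parameters and inverts the monodromy.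
  refine ⟨e, hmem, ?_, ?_, fun s => BCurve.halfTurn (BCurve.stdCurve lam e s),
    (BCurve.rootPair_smallRoot he).isBCurveWithParams
      (BCurve.contDiff_halfTurn (BCurve.contDiff_stdCurve he)) hF.comp_halfTurn,
    hclosed.halfTurn, ?_⟩
  · rw [BCurve.regularizedJump_stdCurve he, hA,
      show -(2 * Real.pi * (1 - (q : ℝ))) = 2 * Real.pi * q - 2 * Real.pi by ring,
      Real.Angle.coe_sub, Real.Angle.coe_two_pi, sub_zero]
  · rwa [← hrot]
  · rw [← hrot']
    exact hF.hasMonodromy_halfTurn hM
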